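/- Let $k$ be a perfect field of characteristic $p>0$, let $K=W(k)[1/p]$ with valuation $v$ normalised by $v(p)=1$ and $|x|=p^{-v(x)}$, and let $n,m\ge 0$. Let $\mathcal A=K\langle T_1^{\pm},\dots,T_n^{\pm},T_{n+1},\dots,T_{n+m}\rangle$ be the ring of series $\sum_u x_uT^u$ with $x_u\in K$, $x_u\to 0$, where $u\in\mathbb Z^n\times\mathbb Z_{\ge 0}^m$. For $i\le n$ write $x=\sum_{d\in\mathbb Z}a_dT_i^d$ (with $a_d$ not involving $T_i$), let $v(a_d)$ be the Gauss valuation and put $w^{(i)}_j(x)=\min\{d : v(a_d)\le j\}$. For $r\in\mathbb R$ let $\mathcal A^r\subset\mathcal A$ be the subring of those $x$ for which there is a $c>0$ such that $w^{(i)}_j(x)\ge -c\,p^{rj}$ for all $i=1,\dots,n$ and all sufficiently large integers $j$. Let $\Omega_{\mathcal A^r}$ and $\Omega_{\mathcal A}$ be the modules of continuous differentials, free on $dT_1,\dots,dT_{n+m}$. A $\nabla$-module over $\mathcal A^r$ is a finitely generated locally free $\mathcal A^r$-module $M$ with a connection $\nabla:M\to M\otimes\Omega_{\mathcal A^r}$;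 it is integrable if its curvature vanishes. Proposition. Let $r<1$ and let $M$ be a rank one integrable $\nabla$-module over $\mathcal A^r$. Then there is an integer $N\ge 0$ such that $M^{\otimes p^N}$ (with the tensor product connection) has regular singularities, in the following sense: after base change to $\mathcal A$, the module $\mathcal A\otimes_{\mathcal A^r}M^{\otimes p^N}$ is free with a basis element $e$ such that $$\nabla(e)=\sum_{i=1}^{n}\Bigl(\frac{c_i}{T_i}+g_i\Bigr)dT_i\otimes e+\sum_{i=n+1}^{n+m}g_i\,dT_i\otimes e$$ with $c_i\in K$ and $g_i\in K\langle T_1,\dots,T_{n+m}\rangle$. -/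

import Mathlib

open scoped TensorProduct NNReal
open Filter Topology


/-- The field `K = W(k)[1/p]`, the fraction field of the ring of `p`-typical Witt vectors. -/
def WittField (p : ℕ) [Fact p.Prime] (k : Type*) [Field k] [CharP k p] [PerfectRing k p] :=
  FractionRing (WittVector p k)

namespace WittField

variable (p : ℕ) [Fact p.Prime] (k : Type*) [Field k] [CharP k p] [PerfectRing k p]

noncomputable instance : Field (WittField p k) :=
  inferInstanceAs (Field (FractionRing (WittVector p k)))

noncomputable instance : Algebra (WittVector p k) (WittField p k) :=
  inferInstanceAs (Algebra (WittVector p k) (FractionRing (WittVector p k)))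

instance : IsFractionRing (WittVector p k) (WittField p k) :=
  inferInstanceAs (IsFractionRing (WittVector p k) (FractionRing (WittVector p k)))

/-- The prime `(p)` of `W(k)`. -/
noncomputable def primeP : IsDedekindDomain.HeightOneSpectrum (WittVector p k) where
  asIdeal := Ideal.span {(p : WittVector p k)}
  isPrime := (Ideal.span_singleton_prime (WittVector.irreducible p).ne_zero).2
    (WittVector.irreducible p).prime
  ne_bot := by
    simpa using (WittVector.irreducible (p := p) (k := k)).ne_zero

theorem one_lt_p : (1 : ℝ≥0) < (p : ℝ≥0) := by
  exact_mod_cast (Fact.out : p.Prime).one_lt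

/-- The `p`-adic absolute value `|x| = p ^ (-v(x))` on `K`, where `v(p) = 1`. -/
noncomputable def absP : AbsoluteValue (WittField p k) ℝ :=
  (primeP p k).adicAbv (one_lt_p p)

noncomputable instance : NormedField (WittField p k) := (absP p k).toNormedField

theorem norm_def (x : WittField p k) : ‖x‖ = absP p k x := rfl

instance : IsUltrametricDist (WittField p k) :=
  IsUltrametricDist.isUltrametricDist_of_isNonarchimedean_norm
    ((primeP p k).isNonarchimedean_adicAbv (one_lt_p p))

theorem toNNReal_exp_neg (N : ℕ) :
    (WithZeroMulInt.toNNReal (ne_zero_of_lt (one_lt_p p))) (WithZero.exp (-(N : ℤ))) =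
      (p : ℝ≥0) ^ (-(N : ℤ)) := by
  rw [WithZeroMulInt.toNNReal_neg_apply _ (WithZero.exp_ne_zero)]
  rfl

theorem norm_algebraMap_le_iff (a : WittVector p k) (N : ℕ) :
    ‖algebraMap (WittVector p k) (WittField p k) a‖ ≤ (p : ℝ) ^ (-(N : ℤ)) ↔
      a ∈ (Ideal.span {(p : WittVector p k)}) ^ N := by
  have h := (primeP p k).intValuation_le_pow_iff_mem a N
  change _ ↔ a ∈ (primeP p k).asIdeal ^ N
  rw [← h, ← (primeP p k).valuation_of_algebraMap (K := WittField p k)]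
  have hm := WithZeroMulInt.toNNReal_strictMono (one_lt_p p)
  rw [← hm.le_iff_le]
  rw [toNNReal_exp_neg]
  rw [← NNReal.coe_le_coe]
  push_cast
  rfl

theorem exists_of_norm_le_one (x : WittField p k) (hx : ‖x‖ ≤ 1) :
    ∃ a : WittVector p k, algebraMap _ _ a = x := by
  have h1 : (primeP p k).valuation (WittField p k) x ≤ 1 := by
    rw [← WithZeroMulInt.toNNReal_le_one_iff (one_lt_p p)]
    exact_mod_cast hx
  obtain ⟨a, ha⟩ := IsDedekindDomain.HeightOneSpectrum.mem_integers_of_valuation_le_one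
    (WittField p k) x (R := WittVector p k) (fun v => by
      have : v = primeP p k := by
        ext1
        rw [IsLocalRing.eq_maximalIdeal v.isMaximal,
          IsLocalRing.eq_maximalIdeal (primeP p k).isMaximal]
      rw [this]
      exact h1)
  exact ⟨a, ha⟩

theorem norm_p : ‖(p : WittField p k)‖ = (p : ℝ)⁻¹ := by
  have h := (primeP p k).intValuation_singleton (r := (p : WittVector p k))
    (WittVector.irreducible p).ne_zero rfl
  rw [← (primeP p k).valuation_of_algebraMap (K := WittField p k)] at h
  have h2 := toNNReal_exp_neg p 1
  simp only [Nat.cast_one] at h2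
  rw [← h] at h2
  have h4 : algebraMap (WittVector p k) (WittField p k) p = p := map_natCast _ p
  rw [← h4]
  refine (congrArg NNReal.toReal h2 : _).trans ?_
  simp

instance : CompleteSpace (WittField p k) := by
  have hp : (1 : ℝ) < p := by exact_mod_cast one_lt_p p
  refine Metric.complete_of_convergent_controlled_sequences
    (fun N => (p : ℝ) ^ (-(N : ℤ))) (fun N => by positivity) fun u hu => ?_
  have h0 : ∀ n, ∃ a : WittVector p k, algebraMap _ (WittField p k) a = u n - u 0 := fun n => by
    apply exists_of_norm_le_one
    have := (hu 0 n 0 (by simp) le_rfl).le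
    simpa [dist_eq_norm] using this
  choose a ha using h0
  obtain ⟨L, hL⟩ := IsPrecomplete.prec
    (inferInstance : IsPrecomplete (Ideal.span {(p : WittVector p k)}) (WittVector p k))
    (f := a) (by
      intro m n hmn
      rw [SModEq.sub_mem, smul_eq_mul, Ideal.mul_top, ← norm_algebraMap_le_iff, map_sub, ha, ha]
      have := (hu m m n le_rfl hmn).le
      simpa [dist_eq_norm] using this)
  refine ⟨u 0 + algebraMap _ _ L, ?_⟩
  rw [tendsto_iff_norm_sub_tendsto_zero]
  refine squeeze_zero (g := fun n : ℕ => ((p : ℝ)⁻¹) ^ n) (fun _ => norm_nonneg _) (fun n => ?_)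
    (tendsto_pow_atTop_nhds_zero_of_lt_one (by positivity) (inv_lt_one_of_one_lt₀ hp))
  have := hL n
  rw [SModEq.sub_mem, smul_eq_mul, Ideal.mul_top, ← norm_algebraMap_le_iff, map_sub, ha] at this
  calc _ = ‖u n - u 0 - algebraMap _ _ L‖ := by congr 1; ring
    _ ≤ _ := this
    _ = _ := by simp

end WittField

/-- Families `(a_u)`, `u ∈ ℤ^σ`, of elements of `K` with `a_u → 0`. The family `a` stands for the
series `∑ a_u T^u`, so this is `K⟨T_s, T_s⁻¹ : s ∈ σ⟩`. -/
def nullFamilies (K σ : Type*) [NormedField K] : Submodule K ((σ → ℤ) → K) where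
  carrier := {a | Tendsto a cofinite (𝓝 0)}
  add_mem' {a b} ha hb := by
    have h : Tendsto (fun u => a u + b u) cofinite (𝓝 (0 + 0)) := Tendsto.add ha hb
    rwa [add_zero] at h
  zero_mem' := tendsto_const_nhds
  smul_mem' c a ha := by
    have h : Tendsto (fun u => c * a u) cofinite (𝓝 (c * 0)) := Tendsto.const_mul c ha
    rwa [mul_zero] at h

/-- The ring `K⟨T_s, T_s⁻¹ : s ∈ σ⟩` of series `∑ a_u T^u` with `a_u → 0`. -/
def Laurent (K σ : Type*) [NormedField K] : Type _ := ↥(nullFamilies K σ)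

namespace Laurent

variable {K σ : Type*} [NormedField K]

noncomputable instance : AddCommGroup (Laurent K σ) :=
  inferInstanceAs (AddCommGroup ↥(nullFamilies K σ))

noncomputable instance : Module K (Laurent K σ) :=
  inferInstanceAs (Module K ↥(nullFamilies K σ))

/-- The coefficient of `T^u`. -/
def coeff (a : Laurent K σ) (u : σ → ℤ) : K := a.1 u

theorem coeff_null (a : Laurent K σ) : Tendsto a.coeff cofinite (𝓝 0) := a.2

@[ext] theorem ext {a b : Laurent K σ} (h : ∀ u, a.coeff u = b.coeff u) : a = b :=
  Subtype.ext (funext h)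

@[simp] theorem coeff_add (a b : Laurent K σ) (u) : (a + b).coeff u = a.coeff u + b.coeff u := rfl
@[simp] theorem coeff_zero (u) : (0 : Laurent K σ).coeff u = 0 := rfl
@[simp] theorem coeff_smul (c : K) (a : Laurent K σ) (u) : (c • a).coeff u = c * a.coeff u := rfl

open Classical in
/-- The monomial `c T^u`. -/
noncomputable def monomial (u : σ → ℤ) (c : K) : Laurent K σ :=
  ⟨fun v => if v = u then c else 0, by
    refine tendsto_const_nhds.congr' ?_
    have : {u}ᶜ ∈ (cofinite : Filter (σ → ℤ)) := (Set.finite_singleton u).compl_mem_cofinite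
    filter_upwards [this] with v hv
    rw [if_neg (by simpa using hv)]⟩

open Classical in
theorem coeff_monomial (u v : σ → ℤ) (c : K) :
    (monomial u c).coeff v = if v = u then c else 0 := rfl

theorem exists_bound (a : Laurent K σ) (p : ℝ) (hp : 1 < p) :
    ∃ N : ℕ, ∀ u, ‖a.coeff u‖ ≤ p ^ N := by
  have h := a.coeff_null.norm
  rw [norm_zero] at h
  have h1 : ∀ᶠ u in cofinite, ‖a.coeff u‖ < 1 := h.eventually_lt_const one_pos
  rw [eventually_cofinite] at h1
  obtain ⟨C, hC⟩ := (h1.image fun u => ‖a.coeff u‖).bddAbove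
  obtain ⟨N, hN⟩ := pow_unbounded_of_one_lt C hp
  refine ⟨N, fun u => ?_⟩
  by_cases hu : ‖a.coeff u‖ < 1
  · exact hu.le.trans (one_le_pow₀ hp.le)
  · exact (hC ⟨u, hu, rfl⟩).trans hN.le

variable [IsUltrametricDist K]

theorem pair_null (a b : Laurent K σ) :
    Tendsto (fun x : (σ → ℤ) × (σ → ℤ) => a.coeff x.1 * b.coeff x.2) cofinite (𝓝 0) :=
  tendsto_mul_cofinite_nhds_zero a.coeff_null b.coeff_null

theorem conv_null (a b : Laurent K σ) (w : σ → ℤ) :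
    Tendsto (fun u => a.coeff u * b.coeff (w - u)) cofinite (𝓝 0) := by
  have hinj : Function.Injective (fun u : σ → ℤ => (u, w - u)) := fun u v h => (Prod.ext_iff.1 h).1
  exact (pair_null a b).comp hinj.tendsto_cofinite

theorem null_mul (a b : Laurent K σ) :
    Tendsto (fun w => ∑' u, a.coeff u * b.coeff (w - u)) cofinite (𝓝 0) := by
  rw [NormedAddGroup.tendsto_nhds_zero]
  intro ε hε
  have h := (NormedAddGroup.tendsto_nhds_zero.1 (pair_null a b)) (ε / 2) (by positivity)
  rw [eventually_cofinite] at h ⊢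
  refine (h.image fun x => x.1 + x.2).subset fun w hw => ?_
  by_contra hcon
  apply hw
  refine lt_of_le_of_lt (IsUltrametricDist.norm_tsum_le_of_forall_le_of_nonneg
    (by positivity : 0 ≤ ε / 2) fun u => ?_) (half_lt_self hε)
  by_contra hu
  exact hcon ⟨(u, w - u), fun h' => hu h'.le, by simp⟩

variable [CompleteSpace K]

theorem conv_summable (a b : Laurent K σ) (w : σ → ℤ) :
    Summable (fun u => a.coeff u * b.coeff (w - u)) :=
  NonarchimedeanAddGroup.summable_of_tendsto_cofinite_zero (conv_null a b w)

noncomputable instance : Mul (Laurent K σ) :=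
  ⟨fun a b => ⟨fun w => ∑' u, a.coeff u * b.coeff (w - u), null_mul a b⟩⟩

noncomputable instance : One (Laurent K σ) := ⟨monomial 0 1⟩

theorem coeff_mul (a b : Laurent K σ) (w : σ → ℤ) :
    (a * b).coeff w = ∑' u, a.coeff u * b.coeff (w - u) := rfl

open Classical in
theorem coeff_one (v : σ → ℤ) : (1 : Laurent K σ).coeff v = if v = 0 then 1 else 0 := rfl

protected theorem mul_comm' (a b : Laurent K σ) : a * b = b * a := by
  ext w
  rw [coeff_mul, coeff_mul, ← (Equiv.subLeft w).tsum_eq]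
  simp [mul_comm]

protected theorem one_mul' (a : Laurent K σ) : 1 * a = a := by
  ext w
  rw [coeff_mul, tsum_eq_single 0]
  · simp [coeff_one]
  · intro u hu
    simp [coeff_one, hu]

protected theorem add_mul' (a b c : Laurent K σ) : (a + b) * c = a * c + b * c := by
  ext w
  simp only [coeff_add, coeff_mul]
  rw [← (conv_summable a c w).tsum_add (conv_summable b c w)]
  simp [add_mul]

protected theorem mul_assoc' (a b c : Laurent K σ) : a * b * c = a * (b * c) := by
  ext w
  simp only [coeff_mul]
  have h3 : Tendsto (fun x : ((σ → ℤ) × (σ → ℤ)) × (σ → ℤ) =>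
      a.coeff x.1.1 * b.coeff x.1.2 * c.coeff x.2) cofinite (𝓝 0) :=
    tendsto_mul_cofinite_nhds_zero (pair_null a b) c.coeff_null
  have hinj : Function.Injective (fun x : (σ → ℤ) × (σ → ℤ) =>
      (((x.1, x.2 - x.1), w - x.2) : ((σ → ℤ) × (σ → ℤ)) × (σ → ℤ))) := by
    rintro ⟨t, u⟩ ⟨t', u'⟩ h
    simp only [Prod.mk.injEq] at h
    simp only [Prod.mk.injEq]
    exact ⟨h.1.1, by simpa using h.2⟩
  have hs : Summable (Function.uncurry fun t u : σ → ℤ =>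
      a.coeff t * b.coeff (u - t) * c.coeff (w - u)) :=
    NonarchimedeanAddGroup.summable_of_tendsto_cofinite_zero (h3.comp hinj.tendsto_cofinite)
  calc ∑' u, (∑' t, a.coeff t * b.coeff (u - t)) * c.coeff (w - u)
      = ∑' u, ∑' t, a.coeff t * b.coeff (u - t) * c.coeff (w - u) := by
        refine tsum_congr fun u => ?_
        rw [(conv_summable a b u).tsum_mul_right]
    _ = ∑' t, ∑' u, a.coeff t * b.coeff (u - t) * c.coeff (w - u) := Summable.tsum_comm hs
    _ = ∑' t, a.coeff t * ∑' s, b.coeff s * c.coeff (w - t - s) := by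
        refine tsum_congr fun t => ?_
        rw [← (conv_summable b c (w - t)).tsum_mul_left]
        refine Eq.trans (tsum_congr fun u => ?_) ((Equiv.subRight t).tsum_eq _)
        simp only [Equiv.subRight_apply]
        rw [mul_assoc, sub_sub_sub_cancel_right]

noncomputable instance : CommRing (Laurent K σ) :=
  { (inferInstance : AddCommGroup (Laurent K σ)) with
    mul := (· * ·)
    one := 1
    mul_comm := Laurent.mul_comm'
    one_mul := Laurent.one_mul'
    mul_one := fun a => by rw [Laurent.mul_comm', Laurent.one_mul']
    mul_assoc := Laurent.mul_assoc'
    left_distrib := fun a b c => by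
      rw [Laurent.mul_comm', Laurent.add_mul', Laurent.mul_comm' b, Laurent.mul_comm' c]
    right_distrib := Laurent.add_mul'
    zero_mul := fun a => by ext w; simp [coeff_mul]
    mul_zero := fun a => by ext w; simp [coeff_mul] }

theorem smul_mul' (c : K) (a b : Laurent K σ) : c • a * b = c • (a * b) := by
  ext w
  simp only [coeff_smul, coeff_mul]
  rw [← (conv_summable a b w).tsum_mul_left]
  simp [mul_assoc]

noncomputable instance : Algebra K (Laurent K σ) :=
  Algebra.ofModule smul_mul' fun c a b => by
    rw [mul_comm, smul_mul', mul_comm]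

open Classical in
theorem coeff_algebraMap (c : K) (v : σ → ℤ) :
    (algebraMap K (Laurent K σ) c).coeff v = if v = 0 then c else 0 := by
  rw [Algebra.algebraMap_eq_smul_one, coeff_smul, coeff_one]
  simp

/-- If a coefficient of a product is large then some product of coefficients is large. -/
theorem exists_of_le_coeff_mul (a b : Laurent K σ) (w : σ → ℤ) {ε δ : ℝ} (hε : 0 ≤ ε) (hδ : ε < δ)
    (h : δ ≤ ‖(a * b).coeff w‖) : ∃ u, ε < ‖a.coeff u‖ * ‖b.coeff (w - u)‖ := by
  by_contra! hcon
  rw [coeff_mul] at h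
  have := IsUltrametricDist.norm_tsum_le_of_forall_le_of_nonneg hε
    (f := fun u => a.coeff u * b.coeff (w - u)) (fun u => by simpa using hcon u)
  linarith

variable [DecidableEq σ]

/-- The partial derivative `∂/∂T_s`: the coefficient of `T^u` in `∂a/∂T_s` is
`(u_s + 1) a_{u + e_s}`. -/
def derivFun (s : σ) (a : Laurent K σ) : Laurent K σ :=
  ⟨fun u => ((u s + 1 : ℤ) : K) * a.coeff (u + Pi.single s 1), by
    have hinj : Function.Injective (fun u : σ → ℤ => u + Pi.single s 1) := fun u v h => by
      simpa using h
    have h : Tendsto (fun u : σ → ℤ => ‖a.coeff (u + Pi.single s 1)‖) cofinite (𝓝 0) := by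
      have h := a.coeff_null.norm
      rw [norm_zero] at h
      exact h.comp hinj.tendsto_cofinite
    refine squeeze_zero_norm (fun u : σ → ℤ => ?_) h
    rw [norm_mul]
    exact mul_le_of_le_one_left (norm_nonneg _) (IsUltrametricDist.norm_intCast_le_one K _)⟩

theorem coeff_derivFun (s : σ) (a : Laurent K σ) (u : σ → ℤ) :
    (derivFun s a).coeff u = ((u s + 1 : ℤ) : K) * a.coeff (u + Pi.single s 1) := rfl

theorem derivFun_mul (s : σ) (a b : Laurent K σ) :
    derivFun s (a * b) = a * derivFun s b + b * derivFun s a := by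
  ext w
  have h1 := conv_summable a b (w + Pi.single s 1)
  have h2 := conv_summable a (derivFun s b) w
  have h3 := (Equiv.subLeft (w + Pi.single s 1)).summable_iff.2
    (conv_summable b (derivFun s a) w)
  rw [coeff_derivFun, coeff_add, coeff_mul, coeff_mul, coeff_mul b,
    ← (Equiv.subLeft (w + Pi.single s 1)).tsum_eq (fun u => b.coeff u * _)]
  refine Eq.trans ?_ (h2.tsum_add h3)
  rw [← h1.tsum_mul_left]
  refine tsum_congr fun u => ?_
  simp only [Equiv.subLeft_apply, coeff_derivFun]
  have e1 : w + Pi.single s 1 - u = w - u + Pi.single s 1 := by abel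
  have e2 : w - (w + Pi.single s 1 - u) + Pi.single s 1 = u := by abel
  have e3 : (w - (w + (Pi.single s 1 : σ → ℤ) - u)) s = u s - 1 := by
    simp only [Pi.sub_apply, Pi.add_apply, Pi.single_eq_same]
    ring
  rw [e2, e3, e1]
  simp only [Pi.sub_apply]
  push_cast
  ring

/-- The derivation `∂/∂T_s`. -/
noncomputable def deriv (s : σ) : Derivation K (Laurent K σ) (Laurent K σ) :=
  Derivation.mk'
    { toFun := derivFun s
      map_add' := fun a b => by ext u; exact mul_add _ _ _
      map_smul' := fun c a => by ext u; exact mul_left_comm _ _ _ }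
    (derivFun_mul s)

theorem coeff_deriv (s : σ) (a : Laurent K σ) (u : σ → ℤ) :
    (deriv s a).coeff u = ((u s + 1 : ℤ) : K) * a.coeff (u + Pi.single s 1) := rfl

end Laurent

/-- The restriction of a derivation to a subalgebra that it preserves. -/
def derivationRestrict {K B : Type*} [CommRing K] [CommRing B] [Algebra K B] (d : Derivation K B B)
    (S : Subalgebra K B) (h : ∀ a ∈ S, d a ∈ S) : Derivation K S S :=
  Derivation.mk'
    { toFun := fun a => ⟨d a, h a a.2⟩
      map_add' := fun a b => Subtype.ext (by simp)
      map_smul' := fun c a => Subtype.ext (by simp) }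
    (fun a b => Subtype.ext (by simp))

theorem coe_derivationRestrict {K B : Type*} [CommRing K] [CommRing B] [Algebra K B]
    (d : Derivation K B B) (S : Subalgebra K B) (h : ∀ a ∈ S, d a ∈ S) (a : S) :
    (derivationRestrict d S h a : B) = d a := rfl

namespace Polyannulus

open Laurent

section Rings

variable (K : Type*) [NormedField K] [IsUltrametricDist K] [CompleteSpace K] (n m : ℕ)

/-- The ring `𝒜 = K⟨T_1^±, …, T_n^±, T_{n+1}, …, T_{n+m}⟩`. The variable `T_i`, `i ≤ n`, has index
`Sum.inl i`, and `T_{n+j}` has index `Sum.inr j`. -/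
def ringA : Subalgebra K (Laurent K (Fin n ⊕ Fin m)) where
  carrier := {a | ∀ u : Fin n ⊕ Fin m → ℤ, (∃ j : Fin m, u (Sum.inr j) < 0) → a.coeff u = 0}
  add_mem' := fun {a b} ha hb u hu => by rw [coeff_add, ha u hu, hb u hu, add_zero]
  mul_mem' := fun {a b} ha hb w hw => by
    obtain ⟨j, hj⟩ := hw
    rw [coeff_mul]
    refine (tsum_congr fun u => ?_).trans tsum_zero
    by_cases hu : u (Sum.inr j) < 0
    · rw [ha u ⟨j, hu⟩, zero_mul]
    · rw [hb (w - u) ⟨j, by simp only [Pi.sub_apply]; omega⟩, mul_zero]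
  algebraMap_mem' := fun c u hu => by
    obtain ⟨j, hj⟩ := hu
    rw [coeff_algebraMap, if_neg]
    rintro rfl
    simp at hj

theorem deriv_mem_ringA (s : Fin n ⊕ Fin m) (a : Laurent K (Fin n ⊕ Fin m))
    (ha : a ∈ ringA K n m) : deriv s a ∈ ringA K n m := by
  rintro u ⟨j, hj⟩
  rw [coeff_deriv]
  by_cases hs : s = Sum.inr j ∧ u (Sum.inr j) = -1
  · obtain ⟨rfl, h2⟩ := hs
    simp [h2]
  · rw [ha _ ⟨j, ?_⟩, mul_zero]
    rw [Pi.add_apply]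
    by_cases h1 : s = Sum.inr j
    · subst h1
      have : u (Sum.inr j) ≠ -1 := fun h => hs ⟨rfl, h⟩
      simp only [Pi.single_eq_same]
      omega
    · rw [Pi.single_eq_of_ne (Ne.symm h1)]
      omega

/-- The derivation `∂/∂T_s` of `𝒜`. -/
noncomputable def derivA (s : Fin n ⊕ Fin m) : Derivation K (ringA K n m) (ringA K n m) :=
  derivationRestrict (deriv s) (ringA K n m) (deriv_mem_ringA K n m s)

/-- The subring `K⟨T_1, …, T_{n+m}⟩` of `𝒜`. -/
def ringTate : Subalgebra K (ringA K n m) where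
  carrier := {a | ∀ u : Fin n ⊕ Fin m → ℤ, (∃ s, u s < 0) → a.1.coeff u = 0}
  add_mem' := fun {a b} ha hb u hu => by
    change (a.1 + b.1).coeff u = 0
    rw [coeff_add, ha u hu, hb u hu, add_zero]
  mul_mem' := fun {a b} ha hb w hw => by
    change (a.1 * b.1).coeff w = 0
    obtain ⟨j, hj⟩ := hw
    rw [coeff_mul]
    refine (tsum_congr fun u => ?_).trans tsum_zero
    by_cases hu : u j < 0
    · rw [ha u ⟨j, hu⟩, zero_mul]
    · rw [hb (w - u) ⟨j, by simp only [Pi.sub_apply]; omega⟩, mul_zero]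
  algebraMap_mem' := fun c u hu => by
    change (algebraMap K (Laurent K (Fin n ⊕ Fin m)) c).coeff u = 0
    obtain ⟨j, hj⟩ := hu
    rw [coeff_algebraMap, if_neg]
    rintro rfl
    simp at hj

/-- The element `T_i⁻¹` of `𝒜`, for `i ≤ n`. -/
noncomputable def invT (i : Fin n) : ringA K n m :=
  ⟨monomial (Pi.single (Sum.inl i) (-1)) 1, by
    rintro u ⟨j, hj⟩
    rw [coeff_monomial, if_neg]
    rintro rfl
    simp at hj⟩

variable (p : ℕ) [hp : Fact p.Prime] (r : ℝ)

/-- The ring `𝒜^r` of series with `r`-log-decay. For `x = ∑ x_u T^u` with `T_i`-adic expansion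
`x = ∑_d a_d T_i^d`, the valuation of `a_d` is the minimum of the `v(x_u)` with `u_i = d`, and
`v(x_u) ≤ j` reads `p ^ (-j) ≤ |x_u|`. So the condition below says that there is a `c > 0` with
`w_j^{(i)}(x) = min {d | v(a_d) ≤ j} ≥ -c p^{rj}` for all `i = 1, …, n` and all large `j`. -/
def ringAr : Subalgebra K (ringA K n m) where
  carrier := {x | ∃ c : ℝ, 0 < c ∧ ∃ J : ℕ, ∀ j : ℕ, J ≤ j → ∀ (i : Fin n) (u : Fin n ⊕ Fin m → ℤ),
    (p : ℝ) ^ (-(j : ℤ)) ≤ ‖x.1.coeff u‖ → -c * (p : ℝ) ^ (r * j) ≤ (u (Sum.inl i) : ℝ)}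
  add_mem' := by
    rintro a b ⟨c, hc, J, h⟩ ⟨c', hc', J', h'⟩
    refine ⟨c + c', by positivity, max J J', fun j hj i u hu => ?_⟩
    have hpos : (0 : ℝ) ≤ (p : ℝ) ^ (r * j) := by positivity
    change _ ≤ ‖(a.1 + b.1).coeff u‖ at hu
    rw [coeff_add] at hu
    have hmax := hu.trans (IsUltrametricDist.norm_add_le_max _ _)
    rcases le_max_iff.1 hmax with h1 | h1
    · have := h j (le_of_max_le_left hj) i u h1
      nlinarith [mul_nonneg hc'.le hpos]
    · have := h' j (le_of_max_le_right hj) i u h1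
      nlinarith [mul_nonneg hc.le hpos]
  mul_mem' := by
    rintro a b ⟨c, hc, J, h⟩ ⟨c', hc', J', h'⟩
    have hp1 : (1 : ℝ) < p := by exact_mod_cast hp.out.one_lt
    have hp0 : (0 : ℝ) < p := by linarith
    obtain ⟨N, hN⟩ := a.1.exists_bound p hp1
    obtain ⟨N', hN'⟩ := b.1.exists_bound p hp1
    set L : ℕ := 1 + N + N' with hL
    refine ⟨(c + c') * (p : ℝ) ^ (r * L), by positivity, max J J', fun j hj i w hw => ?_⟩
    change _ ≤ ‖(a.1 * b.1).coeff w‖ at hw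
    obtain ⟨u, hu⟩ := exists_of_le_coeff_mul a.1 b.1 w (ε := (p : ℝ) ^ (-((j + 1 : ℕ) : ℤ)))
      (by positivity) (zpow_lt_zpow_right₀ hp1 (by push_cast; omega)) hw
    have key : ∀ x y : ℝ, 0 ≤ x → ∀ M : ℕ, M ≤ N + N' → y ≤ (p : ℝ) ^ M →
        (p : ℝ) ^ (-((j + 1 : ℕ) : ℤ)) < x * y → (p : ℝ) ^ (-((j + L : ℕ) : ℤ)) ≤ x := by
      intro x y hx M hM hy hxy
      have h1 : (p : ℝ) ^ (-((j + 1 : ℕ) : ℤ)) ≤ x * (p : ℝ) ^ (N + N') :=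
        hxy.le.trans (mul_le_mul_of_nonneg_left
          (hy.trans (pow_le_pow_right₀ hp1.le hM)) hx)
      have h2 : (p : ℝ) ^ (-((j + L : ℕ) : ℤ)) * (p : ℝ) ^ (N + N') =
          (p : ℝ) ^ (-((j + 1 : ℕ) : ℤ)) := by
        rw [← zpow_natCast, ← zpow_add₀ hp0.ne']
        congr 1
        push_cast [hL]
        ring
      rw [← h2] at h1
      exact le_of_mul_le_mul_right h1 (by positivity)
    have ha := h (j + L) (by have := le_of_max_le_left hj; omega) i u
      (key _ _ (norm_nonneg _) N' (by omega) (hN' (w - u)) hu)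
    have hb := h' (j + L) (by have := le_of_max_le_right hj; omega) i (w - u)
      (key _ _ (norm_nonneg _) N (by omega) (hN u) (by rwa [mul_comm] at hu))
    have hexp : (p : ℝ) ^ (r * ((j + L : ℕ) : ℝ)) = (p : ℝ) ^ (r * L) * (p : ℝ) ^ (r * j) := by
      rw [← Real.rpow_add hp0]
      congr 1
      push_cast
      ring
    rw [hexp] at ha hb
    rw [Pi.sub_apply] at hb
    push_cast at hb
    nlinarith
  algebraMap_mem' := fun c => by
    refine ⟨1, one_pos, 0, fun j _ i u hu => ?_⟩
    change _ ≤ ‖(algebraMap K (Laurent K (Fin n ⊕ Fin m)) c).coeff u‖ at hu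
    rw [coeff_algebraMap] at hu
    have hp0 : (0 : ℝ) < p := by exact_mod_cast hp.out.pos
    split_ifs at hu with h0
    · subst h0
      simp
      positivity
    · rw [norm_zero] at hu
      exact absurd hu (not_le.2 (by positivity))

theorem derivA_mem_ringAr (s : Fin n ⊕ Fin m) (a : ringA K n m) (ha : a ∈ ringAr K n m p r) :
    derivA K n m s a ∈ ringAr K n m p r := by
  obtain ⟨c, hc, J, h⟩ := ha
  refine ⟨2 * c, by positivity, J, fun j hj i u hu => ?_⟩
  have hp0 : (0 : ℝ) < p := by exact_mod_cast hp.out.pos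
  have hpos : (0 : ℝ) ≤ c * (p : ℝ) ^ (r * j) := by positivity
  change _ ≤ ‖(deriv s a.1).coeff u‖ at hu
  rw [coeff_deriv, norm_mul] at hu
  have h1 := h j hj i _ (hu.trans (mul_le_of_le_one_left (norm_nonneg _)
    (IsUltrametricDist.norm_intCast_le_one K _)))
  rw [Pi.add_apply] at h1
  by_cases hs : s = Sum.inl i
  · subst hs
    rw [Pi.single_eq_same] at h1
    have h2 : u (Sum.inl i) ≠ -1 := by
      intro h2
      rw [h2] at hu
      simp only [neg_add_cancel, Int.cast_zero, norm_zero, zero_mul] at hu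
      exact absurd hu (not_le.2 (by positivity))
    rcases lt_or_gt_of_ne h2 with h3 | h3
    · have h4 : (u (Sum.inl i) : ℝ) ≤ -2 := by exact_mod_cast (by omega : u (Sum.inl i) ≤ -2)
      push_cast at h1
      linarith
    · have h4 : (0 : ℝ) ≤ (u (Sum.inl i) : ℝ) := by exact_mod_cast (by omega : 0 ≤ u (Sum.inl i))
      linarith
  · rw [Pi.single_eq_of_ne (Ne.symm hs), add_zero] at h1
    linarith

/-- The derivation `∂/∂T_s` of `𝒜^r`. -/
noncomputable def derivAr (s : Fin n ⊕ Fin m) :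
    Derivation K (ringAr K n m p r) (ringAr K n m p r) :=
  derivationRestrict (derivA K n m s) (ringAr K n m p r) (derivA_mem_ringAr K n m p r s)

end Rings

end Polyannulus

/-- A connection on the module `M` over the `K`-algebra `R` whose module of differentials is free
with basis `(dT_s)`, `d a = ∑ ∂_s(a) dT_s`. The map `∇ : M → M ⊗ Ω_R` is given by its components,
`∇(x) = ∑ ∇_s(x) ⊗ dT_s`. The Leibniz rule `∇(a x) = x ⊗ d a + a ∇(x)` implies `K`-linearity. -/
structure Connection {K R ι : Type*} [CommRing K] [CommRing R] [Algebra K R]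
    (partials : ι → Derivation K R R) (M : Type*) [AddCommGroup M] [Module R M] where
  nabla : ι → M →+ M
  leibniz : ∀ (s : ι) (a : R) (x : M), nabla s (a • x) = partials s a • x + a • nabla s x

namespace Connection

section General

variable {K R ι : Type*} [CommRing K] [CommRing R] [Algebra K R]
  {partials : ι → Derivation K R R} {M : Type*} [AddCommGroup M] [Module R M]

/-- Integrability: the curvature vanishes, that is, the `∇_s` commute (as the `∂_s` do). -/
def Integrable (D : Connection partials M) : Prop :=
  ∀ (s t : ι) (x : M), D.nabla s (D.nabla t x) = D.nabla t (D.nabla s x)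

section TensorPower

variable (D : Connection partials M) (N : ℕ)

/-- `∑_i x_1 ⊗ ⋯ ⊗ ∇_s(x_i) ⊗ ⋯ ⊗ x_N`. -/
noncomputable def tensorSum (s : ι) (x : Fin N → M) : ⨂[R]^N M :=
  ∑ i, PiTensorProduct.tprod R (Function.update x i (D.nabla s (x i)))

theorem tensorSum_smul (s : ι) (x : Fin N → M) (i : Fin N) (a : R) :
    D.tensorSum N s (Function.update x i (a • x i)) =
      partials s a • PiTensorProduct.tprod R x + a • D.tensorSum N s x := by
  unfold tensorSum
  rw [← Finset.add_sum_erase _ _ (Finset.mem_univ i), Finset.smul_sum,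
    ← Finset.add_sum_erase _ (fun i => a • _) (Finset.mem_univ i), ← add_assoc]
  congr 1
  · simp [D.leibniz]
  · refine Finset.sum_congr rfl fun j hj => ?_
    have hji : j ≠ i := (Finset.mem_erase.1 hj).1
    rw [Function.update_of_ne hji, Function.update_comm hji.symm, MultilinearMap.map_update_smul,
      Function.update_comm hji, Function.update_eq_self]

theorem tensorSum_add (s : ι) (x : Fin N → M) (i : Fin N) (y z : M) :
    D.tensorSum N s (Function.update x i (y + z)) =
      D.tensorSum N s (Function.update x i y) + D.tensorSum N s (Function.update x i z) := by
  unfold tensorSum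
  rw [← Finset.sum_add_distrib]
  refine Finset.sum_congr rfl fun j _ => ?_
  by_cases hji : j = i
  · subst hji
    simp
  · simp only [Function.update_of_ne hji, Function.update_comm (Ne.symm hji)]
    rw [MultilinearMap.map_update_add]

theorem tensorSum_zero (s : ι) (x : Fin N → M) (i : Fin N) (h : x i = 0) :
    D.tensorSum N s x = 0 := by
  have := D.tensorSum_add N s x i 0 0
  rw [← h, Function.update_eq_self, h, add_zero, ← h, Function.update_eq_self] at this
  simpa using this

/-- The additive map `∇_s` on `M^{⊗N}`, with
`a (x_1 ⊗ ⋯ ⊗ x_N) ↦ ∂_s(a) (x_1 ⊗ ⋯ ⊗ x_N) + a ∑_i x_1 ⊗ ⋯ ⊗ ∇_s(x_i) ⊗ ⋯ ⊗ x_N`. -/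
noncomputable def tensorNabla (s : ι) : ⨂[R]^N M →+ ⨂[R]^N M :=
  PiTensorProduct.liftAddHom
    (fun ax : R × (Fin N → M) =>
      partials s ax.1 • PiTensorProduct.tprod R ax.2 + ax.1 • D.tensorSum N s ax.2)
    (fun a x i h => by
      simp only
      rw [D.tensorSum_zero N s x i h, MultilinearMap.map_coord_zero _ i h]
      simp)
    (fun x => by simp)
    (by
      intro inst a x i y z
      obtain rfl : inst = instDecidableEqFin N := Subsingleton.elim _ _
      simp only [tensorSum_add, MultilinearMap.map_update_add, smul_add]
      abel)
    (fun a b x => by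
      simp only [map_add, add_smul]
      abel)
    (by
      intro inst a x i b
      obtain rfl : inst = instDecidableEqFin N := Subsingleton.elim _ _
      simp only [tensorSum_smul, MultilinearMap.map_update_smul, Function.update_eq_self,
        Derivation.leibniz, smul_add, add_smul, smul_smul, smul_eq_mul, mul_comm b]
      abel)

theorem tensorNabla_smul_tprod (s : ι) (a : R) (x : Fin N → M) :
    D.tensorNabla N s (a • PiTensorProduct.tprod R x) =
      partials s a • PiTensorProduct.tprod R x + a • D.tensorSum N s x := by
  rw [← PiTensorProduct.tprodCoeff_eq_smul_tprod]
  rfl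

/-- The tensor power `M^{⊗N}` of a module with connection. -/
noncomputable def tensorPower : Connection partials (⨂[R]^N M) where
  nabla := D.tensorNabla N
  leibniz s a z := by
    induction z using PiTensorProduct.induction_on with
    | smul_tprod b x =>
      rw [smul_smul, tensorNabla_smul_tprod, tensorNabla_smul_tprod, Derivation.leibniz]
      simp only [smul_add, add_smul, smul_smul, smul_eq_mul, mul_comm b]
      abel
    | add y z hy hz =>
      rw [smul_add, map_add, map_add, hy, hz, smul_add, smul_add]
      abel

theorem tensorPower_tprod (s : ι) (x : Fin N → M) :
    (D.tensorPower N).nabla s (PiTensorProduct.tprod R x) =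
      ∑ i, PiTensorProduct.tprod R (Function.update x i (D.nabla s (x i))) := by
  have := D.tensorNabla_smul_tprod N s 1 x
  rwa [one_smul, one_smul, Derivation.map_one_eq_zero, zero_smul, zero_add] at this

end TensorPower

section BaseChange

variable {S : Type*} [CommRing S] [Algebra K S] [Algebra R S] {partials' : ι → Derivation K S S}

/-- The additive map `b ⊗ x ↦ ∂_s(b) ⊗ x + b ⊗ ∇_s(x)` on `S ⊗ M`. -/
noncomputable def baseChangeNabla (D : Connection partials M)
    (h : ∀ s a, partials' s (algebraMap R S a) = algebraMap R S (partials s a)) (s : ι) :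
    S ⊗[R] M →+ S ⊗[R] M :=
  TensorProduct.liftAddHom
    (AddMonoidHom.mk' (fun b => AddMonoidHom.mk' (fun x => partials' s b ⊗ₜ x + b ⊗ₜ D.nabla s x)
        (fun x y => by simp only [map_add, TensorProduct.tmul_add]; abel))
      (fun b c => by ext x; simp [TensorProduct.add_tmul]; abel))
    (fun a b x => by
      have hab : partials' s (a • b) = partials s a • b + a • partials' s b := by
        rw [Algebra.smul_def, Derivation.leibniz, h]
        simp only [smul_eq_mul]
        simp only [Algebra.smul_def]
        ring
      simp only [AddMonoidHom.mk'_apply, D.leibniz, hab, TensorProduct.add_tmul,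
        TensorProduct.tmul_add, TensorProduct.tmul_smul, TensorProduct.smul_tmul']
      abel)

/-- The base change `S ⊗_R M` of a module with connection along `R → S`, where the derivations of
`S` extend those of `R`. -/
noncomputable def baseChange (D : Connection partials M)
    (h : ∀ s a, partials' s (algebraMap R S a) = algebraMap R S (partials s a)) :
    Connection partials' (S ⊗[R] M) where
  nabla := D.baseChangeNabla h
  leibniz s a z := by
    induction z using TensorProduct.induction_on with
    | zero => simp
    | tmul b x =>
      change partials' s (a * b) ⊗ₜ x + (a * b) ⊗ₜ D.nabla s x =
        partials' s a • (b ⊗ₜ x) + a • (partials' s b ⊗ₜ x + b ⊗ₜ D.nabla s x)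
      rw [Derivation.leibniz]
      simp only [smul_eq_mul, TensorProduct.add_tmul, smul_add, TensorProduct.smul_tmul',
        mul_comm b]
      abel
    | add y z hy hz =>
      rw [smul_add, map_add, map_add, hy, hz, smul_add, smul_add]
      abel

theorem baseChange_tmul (D : Connection partials M)
    (h : ∀ s a, partials' s (algebraMap R S a) = algebraMap R S (partials s a))
    (s : ι) (b : S) (x : M) :
    (D.baseChange h).nabla s (b ⊗ₜ x) = partials' s b ⊗ₜ x + b ⊗ₜ D.nabla s x := rfl

end BaseChange

end General

end Connection

namespace Polyannulus

variable {K : Type*} [NormedField K] [IsUltrametricDist K] [CompleteSpace K] {n m p : ℕ}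
  [Fact p.Prime] {r : ℝ} {M : Type*} [AddCommGroup M] [Module (ringAr K n m p r) M]

/-- A rank one `∇`-module `M` over `𝒜^r` has regular singularities (a logarithmic connection along
`T_1 ⋯ T_n = 0`) if `𝒜 ⊗ M` has a basis consisting of one element `e` with
`∇(e) = ∑_{i ≤ n} (c_i / T_i + g_i) dT_i ⊗ e + ∑_{i > n} g_i dT_i ⊗ e`, where `c_i ∈ K` and
`g_i ∈ K⟨T_1, …, T_{n+m}⟩`. -/
def HasRegularSingularities (D : Connection (derivAr K n m p r) M) : Prop :=
  ∃ (b : Module.Basis Unit (ringA K n m) (ringA K n m ⊗[ringAr K n m p r] M))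
    (c : Fin n → K) (g : Fin n ⊕ Fin m → ringA K n m),
    (∀ s, g s ∈ ringTate K n m) ∧
    (∀ i : Fin n, (D.baseChange (partials' := derivA K n m) fun _ _ => rfl).nabla (Sum.inl i)
      (b ()) = (c i • invT K n m i + g (Sum.inl i)) • b ()) ∧
    (∀ j : Fin m, (D.baseChange (partials' := derivA K n m) fun _ _ => rfl).nabla (Sum.inr j)
      (b ()) = g (Sum.inr j) • b ())

end Polyannulus

/-!
A line bundle over `𝒜` is trivial: the reduction of `𝒜` is a localization of a polynomial ring over
a field, finite free resolutions lift from the reduction to `𝒜`, so finite projective modules over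
`𝒜` are stably free, and a stably free module of rank one is free. By density of
`K⟨T_1, …, T_{n+m}⟩[1 / (T_1 ⋯ T_n)]` in `𝒜`, the basis of `𝒜 ⊗ M` can be taken to be some `e ∈ M`,
with coordinate function `x ↦ ψ x / ψ e` for a linear form `ψ` on `M`. If `r * ρ ≤ 1`, the
coefficients `x_u` of an element of `𝒜^r` decay like the `-ρ`-th power of the pole order of `T^u`,
and this persists under division by `ψ e`. As `r < 1`, some `ρ > 1` is allowed, so the coefficients
of the connection form `ω` of `e` decay fast enough to beat the denominators arising from the
integration of monomials with negative exponents. Hence the closed form `ω` can be written as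
`df + ∑ c_i dT_i / T_i + g` with `f` in `𝒜` and `g` without negative powers. For `N` large
`exp (-p ^ N f)` converges, and its product with the `p ^ N`-th tensor power of `e` is the required
basis element.
-/

universe u

/-! ### Finite free resolutions -/

/-- The modules with a finite resolution `0 → F_{n-1} → ⋯ → F_0 → M → 0` by finite free modules,
generated inductively from the zero modules through `F_0 → M` and its kernel. -/
inductive HasFiniteFreeResolution (R : Type u) [CommRing R] :
    ∀ (M : Type u) [AddCommGroup M] [Module R M], Prop
  | of_subsingleton (M : Type u) [AddCommGroup M] [Module R M] [Subsingleton M] :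
      HasFiniteFreeResolution R M
  | of_surjective {F M : Type u} [AddCommGroup F] [Module R F] [Module.Free R F]
      [Module.Finite R F] [AddCommGroup M] [Module R M] (f : F →ₗ[R] M)
      (hf : Function.Surjective f) (hker : HasFiniteFreeResolution R (LinearMap.ker f)) :
      HasFiniteFreeResolution R M

namespace HasFiniteFreeResolution

variable {R : Type u} [CommRing R] {M' M M'' : Type u} [AddCommGroup M'] [Module R M']
  [AddCommGroup M] [Module R M] [AddCommGroup M''] [Module R M'']

theorem of_equiv (e : M ≃ₗ[R] M') (h : HasFiniteFreeResolution R M) :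
    HasFiniteFreeResolution R M' := by
  cases h with
  | of_subsingleton =>
    have := e.symm.subsingleton
    exact of_subsingleton M'
  | of_surjective f hf hker =>
    refine of_surjective (e.toLinearMap ∘ₗ f) (e.surjective.comp hf) ?_
    rwa [LinearEquiv.ker_comp]

theorem of_free [Module.Free R M] [Module.Finite R M] : HasFiniteFreeResolution R M :=
  of_surjective LinearMap.id Function.surjective_id <| by
    rw [LinearMap.ker_id]
    exact of_subsingleton _

/-- The kernels in the horseshoe diagram: presentations of `M'` and `M''` assemble to one of `M`. -/
theorem exists_exact_ker_coprod {F' F'' : Type u} [AddCommGroup F'] [Module R F']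
    [AddCommGroup F''] [Module R F''] {i : M' →ₗ[R] M} {q : M →ₗ[R] M''}
    (hi : Function.Injective i) (hex : Function.Exact i q) {f : F' →ₗ[R] M'}
    (hf : Function.Surjective f) (g : F'' →ₗ[R] M) :
    ∃ (j : LinearMap.ker f →ₗ[R] LinearMap.ker ((i ∘ₗ f).coprod g))
      (r : LinearMap.ker ((i ∘ₗ f).coprod g) →ₗ[R] LinearMap.ker (q ∘ₗ g)),
      Function.Injective j ∧ Function.Exact j r ∧ Function.Surjective r := by
  let j : LinearMap.ker f →ₗ[R] LinearMap.ker ((i ∘ₗ f).coprod g) :=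
    (LinearMap.inl R F' F'').restrict fun x (hx : f x = 0) => by simp [hx]
  let r : LinearMap.ker ((i ∘ₗ f).coprod g) →ₗ[R] LinearMap.ker (q ∘ₗ g) :=
    (LinearMap.snd R F' F'').restrict fun x (hx : i (f x.1) + g x.2 = 0) => by
      simpa [hex.apply_apply_eq_zero] using congrArg q hx
  refine ⟨j, r, fun x y hxy => ?_, fun x => ⟨fun hx => ?_, ?_⟩, fun y => ?_⟩
  · exact Subtype.ext congr(($hxy).1.1)
  · have hsnd : x.1.2 = 0 := congrArg Subtype.val hx
    have hsum : i (f x.1.1) + g x.1.2 = 0 := x.2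
    rw [hsnd, map_zero, add_zero] at hsum
    exact ⟨⟨x.1.1, hi (hsum.trans (map_zero i).symm)⟩, Subtype.ext (Prod.ext rfl hsnd.symm)⟩
  · rintro ⟨y, rfl⟩
    rfl
  · obtain ⟨z, hz⟩ := (hex (g y)).1 y.2
    obtain ⟨w, rfl⟩ := hf z
    exact ⟨⟨(-w, y), by simp [hz]⟩, rfl⟩

theorem of_exact {i : M' →ₗ[R] M} {q : M →ₗ[R] M''} (hi : Function.Injective i)
    (hex : Function.Exact i q) (hq : Function.Surjective q) (h' : HasFiniteFreeResolution R M')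
    (h'' : HasFiniteFreeResolution R M'') : HasFiniteFreeResolution R M := by
  induction h'' generalizing M' M with
  | of_subsingleton M'' =>
    have hi' : Function.Surjective i := fun x => (hex x).1 (Subsingleton.elim _ _)
    exact h'.of_equiv (LinearEquiv.ofBijective i ⟨hi, hi'⟩)
  | of_surjective g hg hker'' ih =>
    cases h' with
    | of_subsingleton =>
      have hq' : Function.Injective q := (injective_iff_map_eq_zero q).2 fun x hx => by
        obtain ⟨y, rfl⟩ := (hex x).1 hx
        rw [Subsingleton.elim y 0, map_zero]
      exact (of_surjective g hg hker'').of_equiv (LinearEquiv.ofBijective q ⟨hq', hq⟩).symm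
    | of_surjective f hf hker' =>
      obtain ⟨g, rfl⟩ := Module.projective_lifting_property q g hq
      obtain ⟨j, r, hj, hjr, hr⟩ := exists_exact_ker_coprod hi hex hf g
      refine of_surjective ((i ∘ₗ f).coprod g) (fun x => ?_) (ih hj hjr hr hker')
      obtain ⟨y, hy⟩ := hg (q x)
      obtain ⟨z, hz⟩ := (hex (x - g y)).1 (by simpa [sub_eq_zero] using hy.symm)
      obtain ⟨w, rfl⟩ := hf z
      exact ⟨(w, y), by simp [hz]⟩

theorem of_exact_cokernel {i : M' →ₗ[R] M} {q : M →ₗ[R] M''} (hi : Function.Injective i)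
    (hex : Function.Exact i q) (hq : Function.Surjective q) (h' : HasFiniteFreeResolution R M')
    (h : HasFiniteFreeResolution R M) : HasFiniteFreeResolution R M'' := by
  cases h with
  | of_subsingleton =>
    have := hq.subsingleton
    exact of_subsingleton M''
  | of_surjective f hf hker =>
    let j : LinearMap.ker f →ₗ[R] LinearMap.ker (q ∘ₗ f) :=
      Submodule.inclusion (LinearMap.ker_le_ker_comp f q)
    have hrange : ∀ x : LinearMap.ker (q ∘ₗ f), f x ∈ LinearMap.range i := fun x => (hex _).1 x.2
    let r : LinearMap.ker (q ∘ₗ f) →ₗ[R] M' :=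
      (LinearEquiv.ofInjective i hi).symm.toLinearMap ∘ₗ
        (f.domRestrict _).codRestrict (LinearMap.range i) hrange
    have hir : ∀ x, i (r x) = f x := fun x =>
      congrArg Subtype.val ((LinearEquiv.ofInjective i hi).apply_symm_apply ⟨f x, hrange x⟩)
    have hjr : Function.Exact j r := fun x => by
      rw [← map_eq_zero_iff i hi, hir]
      exact ⟨fun hx => ⟨⟨x, hx⟩, rfl⟩, by rintro ⟨y, rfl⟩; exact y.2⟩
    have hr : Function.Surjective r := fun z => by
      obtain ⟨w, hw⟩ := hf (i z)
      exact ⟨⟨w, by simp [hw, hex.apply_apply_eq_zero]⟩, hi (by rw [hir, hw])⟩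
    exact of_surjective (q ∘ₗ f) (hq.comp hf)
      (of_exact (Submodule.inclusion_injective _) hjr hr hker h')

theorem baseChange (S : Type u) [CommRing S] [Algebra R S] [Module.Flat R S]
    (h : HasFiniteFreeResolution R M) : HasFiniteFreeResolution S (S ⊗[R] M) := by
  induction h with
  | of_subsingleton M => exact of_subsingleton _
  | of_surjective f hf _ ih =>
    exact of_surjective (TensorProduct.AlgebraTensorModule.lTensor S S f)
      (LinearMap.lTensor_surjective S hf) (ih.of_equiv (LinearMap.tensorKerEquiv S S f))

end HasFiniteFreeResolution

/-- A ring over which every finite module has a finite free resolution. -/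
def HasFiniteFreeResolutions (R : Type u) [CommRing R] : Prop :=
  ∀ (M : Type u) [AddCommGroup M] [Module R M] [Module.Finite R M], HasFiniteFreeResolution R M

namespace HasFiniteFreeResolutions

theorem of_field (F : Type u) [Field F] : HasFiniteFreeResolutions F :=
  fun _ _ _ _ => HasFiniteFreeResolution.of_free

variable {R : Type u} [CommRing R]

theorem of_isLocalization (T : Submonoid R) (S : Type u) [CommRing S] [Algebra R S]
    [IsLocalization T S] (h : HasFiniteFreeResolutions R) : HasFiniteFreeResolutions S := by
  intro M _ _ hM
  have : Module.Flat R S := IsLocalization.flat S T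
  let : Module R M := Module.compHom M (algebraMap R S)
  have : IsScalarTower R S M := ⟨fun r s x => by rw [Algebra.smul_def, mul_smul]; rfl⟩
  have : IsLocalizedModule T (LinearMap.id : M →ₗ[R] M) := isLocalizedModule_id T M S
  obtain ⟨s, hs⟩ := hM.fg_top
  let M₀ : Submodule R M := Submodule.span R s
  have : Module.Finite R M₀ := Module.Finite.span_finset R s
  have hM₀ : M₀.localized' S T LinearMap.id = ⊤ := by
    rw [Submodule.localized'_span, LinearMap.id_coe, Set.image_id, hs]
  have hbase : IsBaseChange S (M₀.toLocalized' S T LinearMap.id) :=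
    (isLocalizedModule_iff_isBaseChange T S _).1 inferInstance
  exact ((h M₀).baseChange S).of_equiv
    (hbase.equiv.trans ((LinearEquiv.ofEq _ _ hM₀).trans Submodule.topEquiv))

theorem of_ringEquiv {S : Type u} [CommRing S] (e : R ≃+* S) (h : HasFiniteFreeResolutions R) :
    HasFiniteFreeResolutions S := by
  let : Algebra R S := e.toRingHom.toAlgebra
  have : IsLocalization (⊥ : Submonoid R) R := IsLocalization.self bot_le
  have : IsLocalization (⊥ : Submonoid R) S :=
    IsLocalization.isLocalization_of_algEquiv (S := R) ⊥
      (AlgEquiv.ofRingEquiv (f := e) fun _ => rfl)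
  exact h.of_isLocalization ⊥ S

end HasFiniteFreeResolutions

section DegreeFiltration

open Polynomial

variable {R : Type u} [CommRing R]

section TensorCoeff

variable {V : Type*} [AddCommGroup V] [Module R V]

/-- The `i`-th coefficient `V[X] → V`, where the module of polynomials with coefficients in `V` is
encoded as `R[X] ⊗ V`. -/
noncomputable def tensorCoeff (i : ℕ) : R[X] ⊗[R] V →ₗ[R] V :=
  (TensorProduct.lid R V).toLinearMap ∘ₗ (Polynomial.lcoeff R i).rTensor V

theorem tensorCoeff_tmul (i : ℕ) (f : R[X]) (v : V) :
    tensorCoeff i (f ⊗ₜ[R] v) = f.coeff i • v := by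
  simp [tensorCoeff]

theorem exists_eq_sum_X_pow_tmul_tensorCoeff (z : R[X] ⊗[R] V) :
    ∃ n, z = ∑ i ∈ Finset.range n, (X ^ i : R[X]) ⊗ₜ[R] tensorCoeff i z := by
  suffices h : ∃ n, ∀ n' ≥ n, z = ∑ i ∈ Finset.range n', (X ^ i : R[X]) ⊗ₜ[R] tensorCoeff i z from
    h.imp fun n hn => hn n le_rfl
  induction z using TensorProduct.induction_on with
  | zero => exact ⟨0, fun n' _ => by simp⟩
  | tmul f v =>
    refine ⟨f.natDegree + 1, fun n' hn' => ?_⟩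
    conv_lhs => rw [f.as_sum_range' n' (by omega), TensorProduct.sum_tmul]
    simp only [tensorCoeff_tmul, ← TensorProduct.smul_tmul, Polynomial.smul_X_eq_monomial]
  | add x y hx hy =>
    obtain ⟨n₁, h₁⟩ := hx
    obtain ⟨n₂, h₂⟩ := hy
    refine ⟨max n₁ n₂, fun n' hn' => ?_⟩
    simp only [map_add, TensorProduct.tmul_add, Finset.sum_add_distrib]
    rw [← h₁ n' (le_of_max_le_left hn'), ← h₂ n' (le_of_max_le_right hn')]

theorem eq_zero_of_tensorCoeff_eq_zero {z : R[X] ⊗[R] V} (h : ∀ i, tensorCoeff i z = 0) :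
    z = 0 := by
  obtain ⟨n, hn⟩ := exists_eq_sum_X_pow_tmul_tensorCoeff z
  simpa only [h, TensorProduct.tmul_zero, Finset.sum_const_zero] using hn

end TensorCoeff

variable {N : Type*} [AddCommGroup N] [Module R N] [Module R[X] N]

/-- A filtration of an `R[X]`-module by `R`-submodules with the properties of the filtration by
"degree less than `d`" of a submodule of a free module. -/
structure IsDegreeFiltration (F : ℕ → Submodule R N) : Prop where
  mono : Monotone F
  zero : F 0 = ⊥
  X_smul_mem_iff {d : ℕ} {x : N} : (X : R[X]) • x ∈ F (d + 1) ↔ x ∈ F d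

namespace IsDegreeFiltration

variable {F : ℕ → Submodule R N}

theorem X_pow_smul_mem_iff (hF : IsDegreeFiltration F) {d k : ℕ} {x : N} :
    (X ^ k : R[X]) • x ∈ F (d + k) ↔ x ∈ F d := by
  induction k with
  | zero => simp
  | succ k ih => rw [pow_succ', mul_smul, ← add_assoc, hF.X_smul_mem_iff, ih]

theorem eq_zero_of_X_smul_eq_zero (hF : IsDegreeFiltration F) {x : N} (hx : (X : R[X]) • x = 0) :
    x = 0 := by
  have hx₀ : x ∈ F 0 := hF.X_smul_mem_iff.1 (by rw [hx]; exact zero_mem _)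
  rwa [hF.zero] at hx₀

theorem leadingCoeff_mem (hF : IsDegreeFiltration F) {d n : ℕ} {w : ℕ → F (d + 1)} {v : N}
    (hw : ∑ i ∈ Finset.range n, (X ^ i : R[X]) • (w i : N) + (X ^ n : R[X]) • v = 0) :
    v ∈ F d := by
  rw [← hF.X_pow_smul_mem_iff (k := n), eq_neg_of_add_eq_zero_right hw]
  refine neg_mem (sum_mem fun i hi => hF.mono ?_ (hF.X_pow_smul_mem_iff.2 (w i).2))
  have := Finset.mem_range.1 hi
  omega

variable [IsScalarTower R R[X] N]

/-- Multiplication by `X` between consecutive pieces of a degree filtration. -/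
noncomputable def mulX (hF : IsDegreeFiltration F) (d : ℕ) : F d →ₗ[R] F (d + 1) where
  toFun x := ⟨(X : R[X]) • (x : N), hF.X_smul_mem_iff.2 x.2⟩
  map_add' _ _ := Subtype.ext (smul_add _ _ _)
  map_smul' _ _ := Subtype.ext (smul_comm _ _ _)

/-- The relations `X ⊗ x - 1 ⊗ X x` between the generators `F (d + 1)` of `N`. -/
noncomputable def relations (hF : IsDegreeFiltration F) (d : ℕ) :
    R[X] ⊗[R] F d →ₗ[R[X]] R[X] ⊗[R] F (d + 1) :=
  (X : R[X]) • (Submodule.inclusion (hF.mono d.le_succ)).baseChange R[X] -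
    (hF.mulX d).baseChange R[X]

theorem relations_tmul (hF : IsDegreeFiltration F) (d : ℕ) (f : R[X]) (x : F d) :
    hF.relations d (f ⊗ₜ[R] x) =
      (f * X) ⊗ₜ[R] Submodule.inclusion (hF.mono d.le_succ) x - f ⊗ₜ[R] hF.mulX d x := by
  simp [relations, TensorProduct.smul_tmul', mul_comm]

theorem tensorCoeff_zero_relations (hF : IsDegreeFiltration F) (d : ℕ) (z : R[X] ⊗[R] F d) :
    tensorCoeff 0 (hF.relations d z) = -hF.mulX d (tensorCoeff 0 z) := by
  induction z using TensorProduct.induction_on with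
  | zero => simp
  | tmul f x => simp [relations_tmul, tensorCoeff_tmul]
  | add x y hx hy => simp only [map_add, hx, hy, neg_add]

theorem tensorCoeff_succ_relations (hF : IsDegreeFiltration F) (d i : ℕ) (z : R[X] ⊗[R] F d) :
    tensorCoeff (i + 1) (hF.relations d z) =
      Submodule.inclusion (hF.mono d.le_succ) (tensorCoeff i z) -
        hF.mulX d (tensorCoeff (i + 1) z) := by
  induction z using TensorProduct.induction_on with
  | zero => simp
  | tmul f x => simp [relations_tmul, tensorCoeff_tmul]
  | add x y hx hy => simp only [map_add, hx, hy, add_sub_add_comm]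

theorem mulX_injective (hF : IsDegreeFiltration F) (d : ℕ) : Function.Injective (hF.mulX d) :=
  (injective_iff_map_eq_zero _).2 fun _ hx =>
    Subtype.ext (hF.eq_zero_of_X_smul_eq_zero (congrArg Subtype.val hx))

theorem relations_injective (hF : IsDegreeFiltration F) (d : ℕ) :
    Function.Injective (hF.relations d) := by
  rw [injective_iff_map_eq_zero]
  intro z hz
  refine eq_zero_of_tensorCoeff_eq_zero fun i => ?_
  rw [← map_eq_zero_iff _ (hF.mulX_injective d)]
  induction i with
  | zero => simpa [hz] using hF.tensorCoeff_zero_relations d z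
  | succ i ih =>
    have hi : tensorCoeff i z = 0 := (map_eq_zero_iff _ (hF.mulX_injective d)).1 ih
    simpa [hz, hi] using hF.tensorCoeff_succ_relations d i z

/-- The action map `V[X] → N` of an `R`-submodule `V` of an `R[X]`-module `N`. -/
noncomputable def action (V : Submodule R N) : R[X] ⊗[R] V →ₗ[R[X]] N :=
  TensorProduct.AlgebraTensorModule.lift (LinearMap.toSpanSingleton R[X] (V →ₗ[R] N) V.subtype)

theorem action_tmul (V : Submodule R N) (f : R[X]) (v : V) :
    action V (f ⊗ₜ[R] v) = f • (v : N) := by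
  simp [action]

/-- The leading coefficient `v` lies in `F d`, so the relation given by `v` moves it to the next
lower degree. -/
theorem sum_tmul_mem_range_relations (hF : IsDegreeFiltration F) {d : ℕ} (n : ℕ)
    (w : ℕ → F (d + 1)) (v : F (d + 1))
    (hw : ∑ i ∈ Finset.range n, (X ^ i : R[X]) • (w i : N) + (X ^ n : R[X]) • (v : N) = 0) :
    ∑ i ∈ Finset.range n, (X ^ i : R[X]) ⊗ₜ[R] w i + (X ^ n : R[X]) ⊗ₜ[R] v ∈
      LinearMap.range (hF.relations d) := by
  induction n generalizing v with
  | zero =>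
    have hv : v = 0 := Subtype.ext (by simpa using hw)
    simp [hv]
  | succ n ih =>
    let u : F d := ⟨v, hF.leadingCoeff_mem hw⟩
    have hlow := ih (w n + hF.mulX d u) (by
      rw [Finset.sum_range_succ, pow_succ, mul_smul] at hw
      rw [Submodule.coe_add, smul_add, ← add_assoc]
      exact hw)
    convert add_mem hlow (LinearMap.mem_range_self (hF.relations d) ((X ^ n : R[X]) ⊗ₜ[R] u))
      using 1
    have hu : Submodule.inclusion (hF.mono d.le_succ) u = v := rfl
    rw [relations_tmul, hu, Finset.sum_range_succ, TensorProduct.tmul_add, ← pow_succ]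
    abel

theorem exact_relations_action (hF : IsDegreeFiltration F) (d : ℕ) :
    Function.Exact (hF.relations d) (action (F (d + 1))) := by
  intro z
  constructor
  · intro hz
    obtain ⟨n, hn⟩ := exists_eq_sum_X_pow_tmul_tensorCoeff z
    rw [hn] at hz ⊢
    simpa using hF.sum_tmul_mem_range_relations n _ 0 (by simpa [action_tmul] using hz)
  · rintro ⟨y, rfl⟩
    induction y using TensorProduct.induction_on with
    | zero => simp
    | tmul f x => simp [relations_tmul, action_tmul, mulX, mul_smul]
    | add x y hx hy => rw [map_add, map_add, hx, hy, add_zero]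

end IsDegreeFiltration

end DegreeFiltration

namespace HasFiniteFreeResolution

open Polynomial

variable {R : Type u} [CommRing R]

theorem of_isDegreeFiltration {N : Type u} [AddCommGroup N] [Module R N] [Module R[X] N]
    [IsScalarTower R R[X] N] {F : ℕ → Submodule R N} (hF : IsDegreeFiltration F) {d : ℕ}
    (hd : HasFiniteFreeResolution R (F d)) (hd' : HasFiniteFreeResolution R (F (d + 1)))
    (hspan : Submodule.span R[X] (F (d + 1) : Set N) = ⊤) : HasFiniteFreeResolution R[X] N := by
  refine of_exact_cokernel (hF.relations_injective d) (hF.exact_relations_action d) ?_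
    (hd.baseChange R[X]) (hd'.baseChange R[X])
  rw [← LinearMap.range_eq_top, eq_top_iff, ← hspan, Submodule.span_le]
  exact fun x hx => ⟨1 ⊗ₜ ⟨x, hx⟩, by rw [IsDegreeFiltration.action_tmul, one_smul]⟩

end HasFiniteFreeResolution

section PolynomialRing

open Polynomial

variable {R : Type u} [CommRing R] {ι : Type*} (N : Submodule R[X] (ι → R[X]))

/-- The elements of a submodule of `R[X]^ι` whose components all have degree less than `d`. -/
noncomputable def degreeLTPart (d : ℕ) : Submodule R N :=
  (Submodule.pi Set.univ fun _ : ι => degreeLT R d).comap (N.subtype.restrictScalars R)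

variable {N}

theorem mem_degreeLTPart {d : ℕ} {x : N} : x ∈ degreeLTPart N d ↔ ∀ i, (x.1 i).degree < d := by
  simp [degreeLTPart, mem_degreeLT]

variable (N)

theorem isDegreeFiltration_degreeLTPart : IsDegreeFiltration (degreeLTPart N) where
  mono d e hde x hx := mem_degreeLTPart.2 fun i =>
    (mem_degreeLTPart.1 hx i).trans_le (by exact_mod_cast hde)
  zero := by
    refine (Submodule.eq_bot_iff _).2 fun x hx => Subtype.ext (funext fun i => ?_)
    simpa using mem_degreeLTPart.1 hx i
  X_smul_mem_iff {d x} := by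
    simp only [mem_degreeLTPart, degree_lt_iff_coeff_zero]
    refine forall_congr' fun i => ⟨fun h m hm => ?_, fun h m hm => ?_⟩
    · simpa using h (m + 1) (by omega)
    · obtain ⟨m, rfl⟩ := Nat.exists_eq_succ_of_ne_zero (by omega : m ≠ 0)
      simpa using h m (by omega)

variable [Finite ι]

theorem finite_degreeLTPart [IsNoetherianRing R] (d : ℕ) : Module.Finite R (degreeLTPart N d) := by
  have : Module.Finite R (degreeLT R d) := Module.Finite.equiv (degreeLTEquiv R d).symm
  let f : degreeLTPart N d →ₗ[R] (ι → degreeLT R d) := LinearMap.pi fun i =>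
    ((LinearMap.proj i).comp ((N.subtype.restrictScalars R).comp
      (degreeLTPart N d).subtype)).codRestrict _ fun x => mem_degreeLT.2 (mem_degreeLTPart.1 x.2 i)
  exact Module.Finite.of_injective f fun x y hxy =>
    Subtype.ext (Subtype.ext (funext fun i => congrArg Subtype.val (congrFun hxy i)))

theorem exists_mem_degreeLTPart (x : N) : ∃ d, x ∈ degreeLTPart N d := by
  have hdeg : ∀ i, ∃ d, ∀ e ≥ d, (x.1 i).degree < (e : ℕ) := fun i =>
    ⟨(x.1 i).natDegree + 1, fun e he => degree_le_natDegree.trans_lt (by exact_mod_cast he)⟩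
  choose d hd using hdeg
  obtain ⟨e, he⟩ := Finite.bddAbove_range d
  exact ⟨e, mem_degreeLTPart.2 fun i => hd i e (he ⟨i, rfl⟩)⟩

theorem exists_span_degreeLTPart [IsNoetherianRing R] :
    ∃ d, Submodule.span R[X] (degreeLTPart N d : Set N) = ⊤ := by
  obtain ⟨s, hs⟩ := (inferInstance : Module.Finite R[X] N).fg_top
  choose d hd using exists_mem_degreeLTPart N
  refine ⟨s.sup d, eq_top_iff.2 (hs ▸ Submodule.span_mono fun x hx => ?_)⟩
  exact (isDegreeFiltration_degreeLTPart N).mono (Finset.le_sup hx) (hd x)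

end PolynomialRing

namespace HasFiniteFreeResolutions

open Polynomial

theorem polynomial {R : Type u} [CommRing R] [IsNoetherianRing R]
    (h : HasFiniteFreeResolutions R) : HasFiniteFreeResolutions R[X] := by
  intro M _ _ _
  obtain ⟨b, f, hf⟩ := Module.Finite.exists_fin' R[X] M
  refine HasFiniteFreeResolution.of_surjective f hf ?_
  obtain ⟨d, hd⟩ := exists_span_degreeLTPart (LinearMap.ker f)
  have hfil := isDegreeFiltration_degreeLTPart (LinearMap.ker f)
  have := finite_degreeLTPart (LinearMap.ker f) d
  have := finite_degreeLTPart (LinearMap.ker f) (d + 1)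
  exact .of_isDegreeFiltration hfil (h _) (h _)
    (eq_top_iff.2 (hd ▸ Submodule.span_mono (hfil.mono d.le_succ)))

theorem mvPolynomial (F : Type u) [Field F] (σ : Type) [Finite σ] :
    HasFiniteFreeResolutions (MvPolynomial σ F) := by
  induction σ using Finite.induction_empty_option with
  | of_equiv e ih => exact ih.of_ringEquiv (MvPolynomial.renameEquiv F e).toRingEquiv
  | h_empty => exact (of_field F).of_ringEquiv (MvPolynomial.isEmptyRingEquiv F PEmpty).symm
  | h_option ih =>
    exact ih.polynomial.of_ringEquiv (MvPolynomial.optionEquivLeft F _).symm.toRingEquiv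

end HasFiniteFreeResolutions

/-! ### Reduction of complete ultrametric rings -/

section UnitBall

variable (A : Type u) [NormedCommRing A]

section Uniformizer

variable {A}

/-- A unit of `A` whose norm is multiplicative and is the largest one below `1`. -/
structure IsNormUniformizer (ϖ : A) : Prop where
  isUnit : IsUnit ϖ
  norm_lt_one : ‖ϖ‖ < 1
  norm_mul (x : A) : ‖ϖ * x‖ = ‖ϖ‖ * ‖x‖
  norm_le {x : A} (hx : ‖x‖ < 1) : ‖x‖ ≤ ‖ϖ‖

variable {ϖ : A}

namespace IsNormUniformizer

theorem norm_pow_mul (hϖ : IsNormUniformizer ϖ) (N : ℕ) (x : A) :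
    ‖ϖ ^ N * x‖ = ‖ϖ‖ ^ N * ‖x‖ := by
  induction N with
  | zero => simp
  | succ N ih => rw [pow_succ', mul_assoc, hϖ.norm_mul, ih, pow_succ', mul_assoc]

theorem exists_norm_pow_mul_le_one (hϖ : IsNormUniformizer ϖ) {ι : Type*} [Finite ι] (x : ι → A) :
    ∃ N : ℕ, ∀ i, ‖ϖ ^ N * x i‖ ≤ 1 := by
  have hlim : ∀ i, Tendsto (fun N : ℕ => ‖ϖ‖ ^ N * ‖x i‖) atTop (𝓝 0) := fun i => by
    simpa using (tendsto_pow_atTop_nhds_zero_of_lt_one (norm_nonneg ϖ) hϖ.norm_lt_one).mul_const _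
  have hev : ∀ᶠ N : ℕ in atTop, ∀ i, ‖ϖ‖ ^ N * ‖x i‖ < 1 :=
    eventually_all.2 fun i => (hlim i).eventually_lt_const one_pos
  exact hev.exists.imp fun N hN i => (hϖ.norm_pow_mul N (x i)).trans_le (hN i).le

end IsNormUniformizer

end Uniformizer

variable [NormOneClass A] [IsUltrametricDist A]

/-- The closed unit ball of an ultrametric normed ring. -/
def unitBall : Subring A where
  carrier := {x | ‖x‖ ≤ 1}
  mul_mem' {x y} hx hy := (norm_mul_le x y).trans (mul_le_one₀ hx (norm_nonneg _) hy)
  one_mem' := norm_one.le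
  add_mem' {x y} hx hy := (IsUltrametricDist.norm_add_le_max x y).trans (max_le hx hy)
  zero_mem' := by simp
  neg_mem' {x} hx := by simpa using hx

/-- The open unit ball, as an ideal of the closed unit ball. -/
def openUnitBall : Ideal (unitBall A) where
  carrier := {x | ‖(x : A)‖ < 1}
  add_mem' {x y} hx hy := (IsUltrametricDist.norm_add_le_max (x : A) y).trans_lt (max_lt hx hy)
  zero_mem' := by simp
  smul_mem' c x hx := (norm_mul_le (c : A) x).trans_lt
    (mul_lt_one_of_nonneg_of_lt_one_right c.2 (norm_nonneg _) hx)

/-- The reduction of an ultrametric normed ring: the closed unit ball modulo the open one. -/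
abbrev Reduction : Type u := unitBall A ⧸ openUnitBall A

variable {A}

theorem mem_unitBall {x : A} : x ∈ unitBall A ↔ ‖x‖ ≤ 1 := Iff.rfl

theorem mem_openUnitBall {x : unitBall A} : x ∈ openUnitBall A ↔ ‖(x : A)‖ < 1 := Iff.rfl

theorem isClosed_unitBall : IsClosed (unitBall A : Set A) :=
  isClosed_le continuous_norm continuous_const

instance [CompleteSpace A] : CompleteSpace (unitBall A) := isClosed_unitBall.completeSpace_coe

namespace IsNormUniformizer

variable {ϖ : A}

/-- A uniformizer as an element of the unit ball. -/
def toUnitBall (hϖ : IsNormUniformizer ϖ) : unitBall A := ⟨ϖ, hϖ.norm_lt_one.le⟩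

theorem toUnitBall_mem_openUnitBall (hϖ : IsNormUniformizer ϖ) :
    hϖ.toUnitBall ∈ openUnitBall A := hϖ.norm_lt_one

theorem norm_toUnitBall_pow_smul_le (hϖ : IsNormUniformizer ϖ) {ι : Type*} [Fintype ι] (N : ℕ)
    (x : ι → unitBall A) : ‖hϖ.toUnitBall ^ N • x‖ ≤ ‖ϖ‖ ^ N := by
  refine (pi_norm_le_iff_of_nonneg (by positivity)).2 fun i => ?_
  exact (hϖ.norm_pow_mul N (x i)).trans_le (mul_le_of_le_one_right (by positivity) (x i).2)

theorem exists_eq_mul (hϖ : IsNormUniformizer ϖ) {x : unitBall A} (hx : x ∈ openUnitBall A) :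
    ∃ y : unitBall A, x = hϖ.toUnitBall * y := by
  obtain ⟨v, hv⟩ := hϖ.isUnit
  have : Nontrivial A := NormOneClass.nontrivial
  have hpos : 0 < ‖ϖ‖ := norm_pos_iff.2 hϖ.isUnit.ne_zero
  have hmul : ϖ * (↑v⁻¹ * x) = x := by rw [← hv, Units.mul_inv_cancel_left]
  have hnorm : ‖(↑v⁻¹ * x : A)‖ ≤ 1 := by
    rw [← mul_le_iff_le_one_right hpos, ← hϖ.norm_mul, hmul]
    exact hϖ.norm_le hx
  exact ⟨⟨_, hnorm⟩, Subtype.ext hmul.symm⟩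

end IsNormUniformizer

section ReduceSubmodule

variable {ι κ : Type}

variable (A ι) in
/-- The inclusion of the vectors of the unit ball in all vectors. -/
def coeVec : (ι → unitBall A) →ₗ[unitBall A] (ι → A) :=
  (Algebra.linearMap (unitBall A) A).compLeft ι

variable (A ι) in
/-- The reduction of the vectors of the unit ball. -/
def reduceVec : (ι → unitBall A) →ₛₗ[Ideal.Quotient.mk (openUnitBall A)] (ι → Reduction A) where
  toFun x i := Ideal.Quotient.mk _ (x i)
  map_add' _ _ := rfl
  map_smul' _ _ := rfl

/-- The vectors of the unit ball that lie in a submodule of `A^ι`. -/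
def ballSubmodule (P : Submodule A (ι → A)) : Submodule (unitBall A) (ι → unitBall A) :=
  (P.restrictScalars (unitBall A)).comap (coeVec A ι)

/-- The reduction of a submodule of `A^ι`: the image of its unit ball. -/
def reduceSubmodule (P : Submodule A (ι → A)) : Submodule (Reduction A) (ι → Reduction A) :=
  (ballSubmodule P).map (reduceVec A ι)

theorem coeVec_injective : Function.Injective (coeVec A ι) :=
  Subtype.val_injective.comp_left

variable {ϖ : A} {P : Submodule A (ι → A)}

theorem mem_ballSubmodule {x : ι → unitBall A} : x ∈ ballSubmodule P ↔ coeVec A ι x ∈ P := Iff.rfl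

theorem reduceVec_surjective : Function.Surjective (reduceVec A ι) := fun x =>
  ⟨fun i => (Ideal.Quotient.mk_surjective (x i)).choose,
    funext fun i => (Ideal.Quotient.mk_surjective (x i)).choose_spec⟩

theorem reduceVec_eq_zero_iff {x : ι → unitBall A} :
    reduceVec A ι x = 0 ↔ ∀ i, x i ∈ openUnitBall A := by
  simp only [funext_iff, ← Ideal.Quotient.eq_zero_iff_mem]
  rfl

theorem reduceVec_toUnitBall_smul (hϖ : IsNormUniformizer ϖ) (x : ι → unitBall A) :
    reduceVec A ι (hϖ.toUnitBall • x) = 0 := by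
  rw [map_smulₛₗ, Ideal.Quotient.eq_zero_iff_mem.2 hϖ.toUnitBall_mem_openUnitBall, zero_smul]

theorem exists_eq_smul_of_reduceVec_eq_zero (hϖ : IsNormUniformizer ϖ) {x : ι → unitBall A}
    (hx : x ∈ ballSubmodule P) (hx₀ : reduceVec A ι x = 0) :
    ∃ z ∈ ballSubmodule P, x = hϖ.toUnitBall • z := by
  choose z hz using fun i => hϖ.exists_eq_mul (reduceVec_eq_zero_iff.1 hx₀ i)
  obtain rfl : x = hϖ.toUnitBall • z := funext hz
  exact ⟨z, (P.smul_mem_iff_of_isUnit hϖ.isUnit).1 hx, rfl⟩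

/-- The successive error terms `ϖ ^ N • z` tend to `0`, and the coefficients of the approximations
converge. -/
theorem le_range_of_forall_exists_add_smul [CompleteSpace A] (hϖ : IsNormUniformizer ϖ)
    [Finite ι] [Finite κ] (L : (κ → unitBall A) →ₗ[unitBall A] (ι → unitBall A))
    {Q : Submodule (unitBall A) (ι → unitBall A)}
    (hQ : ∀ y ∈ Q, ∃ c, ∃ z ∈ Q, y = L c + hϖ.toUnitBall • z) : Q ≤ LinearMap.range L := by
  intro y hy
  have := Fintype.ofFinite ι
  have := Fintype.ofFinite κ
  have hstep : ∀ y : Q, ∃ c, ∃ z : Q, (y : ι → unitBall A) = L c + hϖ.toUnitBall • z :=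
    fun y => (hQ y y.2).imp fun c ⟨z, hz, hyz⟩ => ⟨⟨z, hz⟩, hyz⟩
  choose c z hz using hstep
  let Y : ℕ → Q := fun k => z^[k] ⟨y, hy⟩
  have hY : ∀ N, y = L (∑ k ∈ Finset.range N, hϖ.toUnitBall ^ k • c (Y k)) +
      hϖ.toUnitBall ^ N • (Y N : ι → unitBall A) := by
    intro N
    induction N with
    | zero => simp [Y]
    | succ N ih =>
      have hsucc : Y (N + 1) = z (Y N) := Function.iterate_succ_apply' z N _
      rw [Finset.sum_range_succ, map_add, map_smul, add_assoc, pow_succ, mul_smul, hsucc,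
        ← smul_add, ← hz (Y N), ← ih]
  have hgeom : Summable fun k : ℕ => ‖ϖ‖ ^ k :=
    summable_geometric_of_lt_one (norm_nonneg ϖ) hϖ.norm_lt_one
  have hsum : Summable fun k => hϖ.toUnitBall ^ k • c (Y k) :=
    hgeom.of_norm_bounded fun k => hϖ.norm_toUnitBall_pow_smul_le k _
  have herr : Tendsto (fun N => hϖ.toUnitBall ^ N • (Y N : ι → unitBall A)) atTop (𝓝 0) :=
    squeeze_zero_norm (fun N => hϖ.norm_toUnitBall_pow_smul_le N _) hgeom.tendsto_atTop_zero
  have hlim := (((L.continuous_on_pi).tendsto _).comp hsum.hasSum.tendsto_sum_nat).add herr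
  rw [add_zero] at hlim
  exact ⟨_, tendsto_nhds_unique hlim (tendsto_const_nhds.congr hY)⟩

variable [Fintype κ] (x : κ → ι → unitBall A)

theorem coeVec_linearCombination (c : κ → unitBall A) :
    coeVec A ι (Fintype.linearCombination (unitBall A) x c) =
      Fintype.linearCombination A (coeVec A ι ∘ x) (coeVec A κ c) := by
  simp only [Fintype.linearCombination_apply, map_sum, map_smul]
  rfl

theorem reduceVec_linearCombination (c : κ → unitBall A) :
    reduceVec A ι (Fintype.linearCombination (unitBall A) x c) =
      Fintype.linearCombination (Reduction A) (reduceVec A ι ∘ x) (reduceVec A κ c) := by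
  simp only [Fintype.linearCombination_apply, map_sum, map_smulₛₗ]
  rfl

variable {x}

theorem linearCombination_mem {R M : Type*} [CommRing R] [AddCommGroup M] [Module R M]
    {Q : Submodule R M} {x : κ → M} (hx : ∀ j, x j ∈ Q) (c : κ → R) :
    Fintype.linearCombination R x c ∈ Q := by
  rw [Fintype.linearCombination_apply]
  exact sum_mem fun j _ => Q.smul_mem _ (hx j)

theorem ballSubmodule_le_range_linearCombination [CompleteSpace A] (hϖ : IsNormUniformizer ϖ)
    [Finite ι] (hx : ∀ j, x j ∈ ballSubmodule P)
    (hspan : reduceSubmodule P ≤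
      LinearMap.range (Fintype.linearCombination (Reduction A) (reduceVec A ι ∘ x))) :
    ballSubmodule P ≤ LinearMap.range (Fintype.linearCombination (unitBall A) x) := by
  refine le_range_of_forall_exists_add_smul hϖ _ fun y hy => ?_
  obtain ⟨d, hd⟩ := hspan (Submodule.mem_map_of_mem hy)
  obtain ⟨c, rfl⟩ := reduceVec_surjective d
  obtain ⟨z, hz, hyz⟩ := exists_eq_smul_of_reduceVec_eq_zero hϖ
    (sub_mem hy (linearCombination_mem hx c)) <| by
      rw [map_sub, reduceVec_linearCombination, hd, sub_self]
  exact ⟨c, z, hz, by rw [← hyz, add_sub_cancel]⟩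

theorem range_linearCombination_coeVec (hϖ : IsNormUniformizer ϖ) [Finite ι]
    (hx : ∀ j, x j ∈ ballSubmodule P)
    (hgen : ballSubmodule P ≤ LinearMap.range (Fintype.linearCombination (unitBall A) x)) :
    LinearMap.range (Fintype.linearCombination A (coeVec A ι ∘ x)) = P := by
  refine le_antisymm ?_ fun y hy => ?_
  · rw [Fintype.range_linearCombination, Submodule.span_le]
    exact Set.range_subset_iff.2 hx
  obtain ⟨N, hN⟩ := hϖ.exists_norm_pow_mul_le_one y
  obtain ⟨c, hc⟩ := hgen (x := fun i => ⟨ϖ ^ N * y i, hN i⟩) (P.smul_mem (ϖ ^ N) hy)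
  refine (Submodule.smul_mem_iff_of_isUnit _ (hϖ.isUnit.pow N)).1 ⟨coeVec A κ c, ?_⟩
  rw [← coeVec_linearCombination, hc]
  rfl

theorem reduceSubmodule_ker_linearCombination (hϖ : IsNormUniformizer ϖ)
    (hx : ∀ j, x j ∈ ballSubmodule P)
    (hgen : ballSubmodule P ≤ LinearMap.range (Fintype.linearCombination (unitBall A) x)) :
    reduceSubmodule (LinearMap.ker (Fintype.linearCombination A (coeVec A ι ∘ x))) =
      LinearMap.ker (Fintype.linearCombination (Reduction A) (reduceVec A ι ∘ x)) := by
  have hker : ∀ c, c ∈ ballSubmodule (LinearMap.ker (Fintype.linearCombination A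
      (coeVec A ι ∘ x))) ↔ Fintype.linearCombination (unitBall A) x c = 0 := fun c => by
    rw [mem_ballSubmodule, LinearMap.mem_ker, ← coeVec_linearCombination]
    exact map_eq_zero_iff _ coeVec_injective
  ext d
  constructor
  · rintro ⟨c, hc, rfl⟩
    rw [LinearMap.mem_ker, ← reduceVec_linearCombination, (hker c).1 hc, map_zero]
  · intro hd
    obtain ⟨c, rfl⟩ := reduceVec_surjective d
    rw [LinearMap.mem_ker, ← reduceVec_linearCombination] at hd
    obtain ⟨z, hz, hcz⟩ := exists_eq_smul_of_reduceVec_eq_zero hϖ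
      (linearCombination_mem hx c) hd
    obtain ⟨b, rfl⟩ := hgen hz
    refine ⟨c - hϖ.toUnitBall • b, (hker _).2 ?_, ?_⟩
    · rw [map_sub, map_smul, hcz, sub_self]
    · rw [map_sub, reduceVec_toUnitBall_smul, sub_zero]

end ReduceSubmodule

end UnitBall

section StablyFree

theorem isStablyFree_of_equiv_prod {R : Type u} [CommRing R] {M N F : Type u} [AddCommGroup M]
    [Module R M] [AddCommGroup N] [Module R N] [AddCommGroup F] [Module R F] [Module.Finite R F]
    [Module.Free R F] (e : F ≃ₗ[R] M × N) [Module.IsStablyFree R M] : Module.IsStablyFree R N := by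
  obtain ⟨L, _, _, _, _, _⟩ := Module.IsStablyFree.exist_free_prod R M
  have : Module.Finite R M := .of_surjective (LinearMap.fst R M N ∘ₗ e.toLinearMap)
    (Prod.fst_surjective.comp e.surjective)
  have : Module.Free R ((L × M) × N) := .of_equiv
    (((LinearEquiv.refl R L).prodCongr e).trans (LinearEquiv.prodAssoc R L M N).symm)
  have : Module.Free R (L × M) := .of_equiv (LinearEquiv.prodComm R M L)
  exact Module.IsStablyFree.of_free_prod' R N (L × M)

theorem exists_equiv_ker_prod_range {R M P : Type*} [Ring R] [AddCommGroup M] [Module R M]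
    [AddCommGroup P] [Module R P] (φ : M →ₗ[R] P) [Module.Projective R (LinearMap.range φ)] :
    Nonempty (M ≃ₗ[R] LinearMap.ker φ × LinearMap.range φ) := by
  obtain ⟨s, hs⟩ := Module.projective_lifting_property φ.rangeRestrict LinearMap.id
    φ.surjective_rangeRestrict
  have hexact : Function.Exact (LinearMap.ker φ).subtype φ.rangeRestrict := by
    rw [LinearMap.exact_iff, LinearMap.ker_rangeRestrict, Submodule.range_subtype]
  exact ⟨(hexact.splitSurjectiveEquiv (Submodule.injective_subtype _) ⟨s, hs⟩).1⟩

variable {A : Type u} [NormedCommRing A] [NormOneClass A] [IsUltrametricDist A] {ϖ : A}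

theorem exists_linearCombination_reduceVec_eq {ι κ : Type} [Fintype κ] {P : Submodule A (ι → A)}
    (f : (κ → Reduction A) →ₗ[Reduction A] reduceSubmodule P) :
    ∃ x : κ → ι → unitBall A, (∀ j, x j ∈ ballSubmodule P) ∧
      Fintype.linearCombination (Reduction A) (reduceVec A ι ∘ x) =
        (reduceSubmodule P).subtype ∘ₗ f := by
  classical
  choose x hx hxf using fun j => (f (Pi.single j 1)).2
  refine ⟨x, hx, LinearMap.pi_ext' fun j => LinearMap.ext_ring ?_⟩
  simp [hxf]

variable [CompleteSpace A]

theorem IsNormUniformizer.exists_equiv_prod (hϖ : IsNormUniformizer ϖ) {ι κ : Type} [Finite ι]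
    [Finite κ] (P : Submodule A (ι → A)) [Module.Projective A P]
    (f : (κ → Reduction A) →ₗ[Reduction A] reduceSubmodule P) (hf : Function.Surjective f) :
    ∃ Q : Submodule A (κ → A), reduceSubmodule Q = LinearMap.ker f ∧
      Nonempty ((κ → A) ≃ₗ[A] Q × P) := by
  have := Fintype.ofFinite κ
  obtain ⟨x, hx, hxf⟩ := exists_linearCombination_reduceVec_eq f
  have hgen := ballSubmodule_le_range_linearCombination hϖ hx <| by
    rw [hxf, LinearMap.range_comp_of_range_eq_top _ (LinearMap.range_eq_top.2 hf),
      Submodule.range_subtype]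
  have hker := reduceSubmodule_ker_linearCombination hϖ hx hgen
  rw [hxf, LinearMap.ker_comp_of_ker_eq_bot _ (Submodule.ker_subtype _)] at hker
  have hrange := range_linearCombination_coeVec hϖ hx hgen
  have : Module.Projective A (LinearMap.range (Fintype.linearCombination A (coeVec A ι ∘ x))) := by
    rwa [hrange]
  obtain ⟨e⟩ := exists_equiv_ker_prod_range (Fintype.linearCombination A (coeVec A ι ∘ x))
  exact ⟨_, hker, ⟨e.trans ((LinearEquiv.refl A _).prodCongr (.ofEq _ _ hrange))⟩⟩

theorem IsNormUniformizer.isStablyFree_of_reduceSubmodule (hϖ : IsNormUniformizer ϖ)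
    {M : Type u} [AddCommGroup M] [Module (Reduction A) M]
    (h : HasFiniteFreeResolution (Reduction A) M) {n : ℕ} (P : Submodule A (Fin n → A))
    [Module.Projective A P] (e : M ≃ₗ[Reduction A] reduceSubmodule P) :
    Module.IsStablyFree A P := by
  induction h generalizing n with
  | of_subsingleton =>
    have := e.symm.subsingleton
    obtain ⟨Q, -, ⟨e'⟩⟩ := hϖ.exists_equiv_prod (κ := Fin 0) P 0
      (Function.surjective_to_subsingleton _)
    have : Subsingleton P := (Prod.snd_surjective.comp e'.surjective).subsingleton
    infer_instance
  | @of_surjective F _ _ _ _ _ _ _ f hf _ ih =>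
    let b := (Module.Free.chooseBasis (Reduction A) F).reindex (Fintype.equivFin _)
    obtain ⟨Q, hQ, ⟨e'⟩⟩ := hϖ.exists_equiv_prod P
      (e.toLinearMap ∘ₗ f ∘ₗ b.equivFun.symm.toLinearMap)
      (e.surjective.comp (hf.comp b.equivFun.symm.surjective))
    have : Module.Projective A Q := .of_split
      (e'.symm.toLinearMap ∘ₗ LinearMap.inl A Q P) (LinearMap.fst A Q P ∘ₗ e'.toLinearMap)
      (LinearMap.ext fun z => by simp)
    have := ih Q <| (b.equivFun.submoduleMap _).trans <| .ofEq _ _ <| by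
      rw [hQ, LinearEquiv.ker_comp, LinearMap.ker_comp, Submodule.map_equiv_eq_comap_symm]
    exact isStablyFree_of_equiv_prod e'

/-- As a summand of some `A ^ n`, the module `M` has a reduction, and generators of the reduction
lift to generators of `M`. -/
theorem IsNormUniformizer.isStablyFree (hϖ : IsNormUniformizer ϖ) [IsNoetherianRing (Reduction A)]
    (hA : HasFiniteFreeResolutions (Reduction A)) (M : Type*) [AddCommGroup M] [Module A M]
    [Module.Finite A M] [Module.Projective A M] : Module.IsStablyFree A M := by
  obtain ⟨n, f, hf⟩ := Module.Finite.exists_fin' A M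
  obtain ⟨s, hs⟩ := Module.projective_lifting_property f LinearMap.id hf
  let e : M ≃ₗ[A] LinearMap.range s := .ofInjective s
    (Function.LeftInverse.injective (g := f) (LinearMap.congr_fun hs))
  have : Module.Projective A (LinearMap.range s) := .of_equiv e
  have := hϖ.isStablyFree_of_reduceSubmodule (hA _) (LinearMap.range s) (.refl _ _)
  exact .equiv e.symm

end StablyFree

section RankOne

variable {R M : Type*} [CommRing R] [AddCommGroup M] [Module R M] [Module.Finite R M]
  [Module.Projective R M]

theorem rankAtStalk_dual :
    Module.rankAtStalk (R := R) (Module.Dual R M) = Module.rankAtStalk M := by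
  have := Module.finitePresentation_of_projective R M
  ext p
  let S := p.asIdeal.primeCompl
  let e : LocalizedModule S (Module.Dual R M) ≃ₗ[Localization S]
      (LocalizedModule S M →ₗ[Localization S] LocalizedModule S R) :=
    (Module.FinitePresentation.linearEquivMapExtendScalars S).extendScalarsOfIsLocalization S _
  have : Module.Free (Localization S) (LocalizedModule S M) :=
    Module.free_of_flat_of_isLocalRing
  have hself : Module.finrank (Localization S) (LocalizedModule S R) = 1 := by
    have : Nontrivial R := p.nontrivial
    exact congrFun (Module.rankAtStalk_self (R := R)) p
  have : Module.Free (Localization S) (LocalizedModule S R) := Module.free_of_flat_of_isLocalRing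
  rw [Module.rankAtStalk, e.finrank_eq, Module.finrank_linearMap, hself, mul_one]
  rfl

/-- By the dual basis lemma the trace ideal `I` satisfies `I M = M`, so `M` vanishes at the
maximal ideals that contain `I`. -/
theorem contractLeft_surjective (h : ∀ p, 0 < Module.rankAtStalk (R := R) M p) :
    Function.Surjective (contractLeft R M) := by
  rw [← LinearMap.range_eq_top]
  by_contra hne
  obtain ⟨m, hm, hle⟩ := Ideal.exists_le_maximal _ hne
  have hsmul : (⊤ : Submodule R M) ≤ m • ⊤ := by
    obtain ⟨n, f, hf⟩ := Module.Finite.exists_fin' R M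
    obtain ⟨s, hs⟩ := Module.projective_lifting_property f LinearMap.id hf
    intro x _
    have hsx : f (s x) = x := LinearMap.congr_fun hs x
    rw [← hsx, pi_eq_sum_univ' (s x), map_sum]
    refine sum_mem fun i _ => ?_
    rw [map_smul]
    exact Submodule.smul_mem_smul (hle ⟨(LinearMap.proj i ∘ₗ s) ⊗ₜ x, by simp⟩) trivial
  obtain ⟨r, hr, hrM⟩ := Submodule.exists_sub_one_mem_and_smul_eq_zero_of_fg_of_le_smul m ⊤
    Module.Finite.fg_top hsmul
  obtain ⟨x, hx⟩ := Module.mem_support_iff'.1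
    ((Module.rankAtStalk_pos_iff_mem_support ⟨m, hm.isPrime⟩).1 (h _))
  refine hx r (fun hrm => hm.ne_top ((Ideal.eq_top_iff_one m).2 ?_)) (hrM x trivial)
  simpa using m.sub_mem hrm hr

theorem invertible_of_rankAtStalk_eq_one (h : ∀ p, Module.rankAtStalk (R := R) M p = 1) :
    Module.Invertible R M where
  bijective := by
    have hsurj := contractLeft_surjective fun p => (h p).symm ▸ one_pos
    refine Module.bijective_of_surjective_of_rankAtStalk_eq (M := Module.Dual R M ⊗[R] M) hsurj
      fun m hm => ?_
    have : Nontrivial R := PrimeSpectrum.nontrivial ⟨m, hm.isPrime⟩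
    simp [Module.rankAtStalk_tensorProduct, rankAtStalk_dual, h]

end RankOne

/-! ### The Gauss norm -/

namespace Laurent

variable {K σ : Type*} [NormedField K]

theorem finite_setOf_le_norm_coeff (a : Laurent K σ) {ε : ℝ} (hε : 0 < ε) :
    {u | ε ≤ ‖a.coeff u‖}.Finite := by
  simpa [eventually_cofinite] using NormedAddGroup.tendsto_nhds_zero.1 a.coeff_null ε hε

theorem bddAbove_norm_coeff (a : Laurent K σ) : BddAbove (Set.range fun u => ‖a.coeff u‖) :=
  have ⟨_, hN⟩ := a.exists_bound 2 one_lt_two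
  ⟨_, Set.forall_mem_range.2 hN⟩

/-- The Gauss norm. -/
noncomputable instance instNorm : Norm (Laurent K σ) := ⟨fun a => ⨆ u, ‖a.coeff u‖⟩

theorem norm_coeff_le (a : Laurent K σ) (u : σ → ℤ) : ‖a.coeff u‖ ≤ ‖a‖ :=
  le_ciSup a.bddAbove_norm_coeff u

theorem norm_le_iff {a : Laurent K σ} {C : ℝ} : ‖a‖ ≤ C ↔ ∀ u, ‖a.coeff u‖ ≤ C :=
  ciSup_le_iff a.bddAbove_norm_coeff

theorem exists_norm_eq (a : Laurent K σ) : ∃ u, ‖a‖ = ‖a.coeff u‖ := by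
  by_cases h : ∃ v, a.coeff v ≠ 0
  · obtain ⟨v, hv⟩ := h
    obtain ⟨u, hu, hmax⟩ := Set.exists_max_image _ (fun u => ‖a.coeff u‖)
      (a.finite_setOf_le_norm_coeff (norm_pos_iff.2 hv)) ⟨v, le_refl ‖a.coeff v‖⟩
    refine ⟨u, le_antisymm (norm_le_iff.2 fun w => ?_) (norm_coeff_le a u)⟩
    exact (le_total ‖a.coeff v‖ ‖a.coeff w‖).elim (hmax w) fun hw => hw.trans hu
  · push Not at h
    exact ⟨0, le_antisymm (norm_le_iff.2 fun w => by rw [h w, h 0]) (norm_coeff_le a 0)⟩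

theorem norm_lt_iff {a : Laurent K σ} {C : ℝ} : ‖a‖ < C ↔ ∀ u, ‖a.coeff u‖ < C := by
  obtain ⟨v, hv⟩ := exists_norm_eq a
  exact ⟨fun h u => (norm_coeff_le a u).trans_lt h, fun h => hv ▸ h v⟩

theorem gaussNorm_nonneg (a : Laurent K σ) : 0 ≤ ‖a‖ :=
  (norm_nonneg _).trans (norm_coeff_le a 0)

theorem norm_smul_eq (c : K) (a : Laurent K σ) : ‖c • a‖ = ‖c‖ * ‖a‖ := by
  change ⨆ u, ‖c * a.coeff u‖ = ‖c‖ * ⨆ u, ‖a.coeff u‖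
  simp only [norm_mul, Real.mul_iSup_of_nonneg (norm_nonneg c)]

theorem norm_monomial (u : σ → ℤ) (c : K) : ‖(monomial u c : Laurent K σ)‖ = ‖c‖ := by
  classical
  refine le_antisymm (norm_le_iff.2 fun v => ?_) ?_
  · rw [coeff_monomial]
    split_ifs <;> simp
  · simpa only [coeff_monomial, if_true] using norm_coeff_le (monomial u c) u

variable [IsUltrametricDist K]

theorem norm_add_le_max (a b : Laurent K σ) : ‖a + b‖ ≤ max ‖a‖ ‖b‖ :=
  norm_le_iff.2 fun u => (IsUltrametricDist.norm_add_le_max _ _).trans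
    (max_le_max (norm_coeff_le a u) (norm_coeff_le b u))

variable [CompleteSpace K]

theorem gaussNorm_mul_le (a b : Laurent K σ) : ‖a * b‖ ≤ ‖a‖ * ‖b‖ := by
  refine norm_le_iff.2 fun w => ?_
  rw [coeff_mul]
  refine IsUltrametricDist.norm_tsum_le_of_forall_le_of_nonneg
    (mul_nonneg a.gaussNorm_nonneg b.gaussNorm_nonneg) fun u => ?_
  rw [norm_mul]
  exact mul_le_mul (norm_coeff_le a u) (norm_coeff_le b _) (norm_nonneg _) a.gaussNorm_nonneg

/-- The Gauss norm, as a ring norm. -/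
noncomputable def gaussNorm : RingNorm (Laurent K σ) where
  toFun a := ‖a‖
  map_zero' := le_antisymm (norm_le_iff.2 fun u => by simp) (gaussNorm_nonneg 0)
  add_le' a b := (norm_add_le_max a b).trans
    (max_le_add_of_nonneg a.gaussNorm_nonneg b.gaussNorm_nonneg)
  neg' a := congrArg iSup (funext fun u => norm_neg (a.coeff u))
  mul_le' := gaussNorm_mul_le
  eq_zero_of_map_eq_zero' a (ha : ‖a‖ = 0) := by
    ext u
    exact norm_le_zero_iff.1 (ha ▸ norm_coeff_le a u)

noncomputable instance : NormedCommRing (Laurent K σ) :=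
  { instNorm, (inferInstance : CommRing (Laurent K σ)),
    (gaussNorm (K := K) (σ := σ)).toNormedRing with }

instance : IsUltrametricDist (Laurent K σ) :=
  IsUltrametricDist.isUltrametricDist_of_forall_norm_add_le_max_norm norm_add_le_max

noncomputable instance : NormedAlgebra K (Laurent K σ) where
  norm_smul_le c a := (norm_smul_eq c a).le

instance : NormOneClass (Laurent K σ) := ⟨(norm_monomial 0 1).trans norm_one⟩

/-- The coefficient of `T^u`, as an additive map. -/
noncomputable def coeffHom (u : σ → ℤ) : Laurent K σ →+ K :=
  AddMonoidHom.mk' (fun a => a.coeff u) fun _ _ => rfl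

@[simp] theorem coeff_sub (a b : Laurent K σ) (u : σ → ℤ) :
    (a - b).coeff u = a.coeff u - b.coeff u := rfl

theorem coeff_sum {ι : Type*} (s : Finset ι) (f : ι → Laurent K σ) (u : σ → ℤ) :
    (∑ i ∈ s, f i).coeff u = ∑ i ∈ s, (f i).coeff u :=
  map_sum (coeffHom u) f s

theorem dist_coeff_le (a b : Laurent K σ) (u : σ → ℤ) :
    dist (a.coeff u) (b.coeff u) ≤ dist a b := by
  rw [dist_eq_norm, dist_eq_norm]
  exact norm_coeff_le (a - b) u

theorem continuous_coeff (u : σ → ℤ) : Continuous fun a : Laurent K σ => a.coeff u :=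
  (LipschitzWith.of_dist_le_mul (K := 1) fun a b => by
    simpa using dist_coeff_le a b u).continuous

theorem uniformCauchySeqOn_coeff {f : ℕ → Laurent K σ} (hf : CauchySeq f) :
    UniformCauchySeqOn (fun n => (f n).coeff) atTop Set.univ := by
  rw [Metric.uniformCauchySeqOn_iff]
  intro ε hε
  obtain ⟨N, hN⟩ := Metric.cauchySeq_iff.1 hf ε hε
  exact ⟨N, fun m hm n hn u _ => (dist_coeff_le _ _ u).trans_lt (hN m hm n hn)⟩

instance : CompleteSpace (Laurent K σ) := by
  refine Metric.complete_of_cauchySeq_tendsto fun f hf => ?_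
  have hcauchy := uniformCauchySeqOn_coeff hf
  choose l hl using fun u => cauchySeq_tendsto_of_complete (hcauchy.cauchySeq (Set.mem_univ u))
  have hunif : TendstoUniformly (fun n => (f n).coeff) l atTop :=
    tendstoUniformlyOn_univ.1 (hcauchy.tendstoUniformlyOn_of_tendsto fun u _ => hl u)
  have hnull : Tendsto l cofinite (𝓝 0) :=
    (hunif.tendstoUniformlyOnFilter.mono_right le_top).tendsto_of_eventually_tendsto
      (Eventually.of_forall fun n => (f n).coeff_null) tendsto_const_nhds
  let L : Laurent K σ := ⟨l, hnull⟩
  refine ⟨L, Metric.tendsto_atTop.2 fun ε hε => ?_⟩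
  obtain ⟨N, hN⟩ := eventually_atTop.1 (Metric.tendstoUniformly_iff.1 hunif ε hε)
  refine ⟨N, fun n hn => ?_⟩
  rw [dist_comm, dist_eq_norm]
  exact norm_lt_iff.2 fun u => (dist_eq_norm (l u) _).symm.trans_lt (hN n hn u)

theorem coeff_monomial_mul (u w : σ → ℤ) (c : K) (a : Laurent K σ) :
    (monomial u c * a).coeff w = c * a.coeff (w - u) := by
  classical
  rw [coeff_mul, tsum_eq_single u]
  · rw [coeff_monomial, if_pos rfl]
  · intro v hv
    rw [coeff_monomial, if_neg hv, zero_mul]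

theorem monomial_mul_monomial (u v : σ → ℤ) (c d : K) :
    (monomial u c * monomial v d : Laurent K σ) = monomial (u + v) (c * d) := by
  classical
  ext w
  simp only [coeff_monomial_mul, coeff_monomial, sub_eq_iff_eq_add', mul_ite, mul_zero]

theorem algebraMap_eq_monomial (c : K) : algebraMap K (Laurent K σ) c = monomial 0 c := by
  classical
  ext u
  rw [coeff_algebraMap, coeff_monomial]

theorem norm_deriv_le [DecidableEq σ] (s : σ) (a : Laurent K σ) : ‖deriv s a‖ ≤ ‖a‖ :=
  norm_le_iff.2 fun u => by
    rw [coeff_deriv, norm_mul]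
    exact (mul_le_of_le_one_left (norm_nonneg _)
      (IsUltrametricDist.norm_intCast_le_one K _)).trans (norm_coeff_le a _)

end Laurent

namespace Polyannulus

open Laurent

variable (K : Type u) [NormedField K] [IsUltrametricDist K] [CompleteSpace K] (n m : ℕ)

theorem isClosed_ringA : IsClosed (ringA K n m : Set (Laurent K (Fin n ⊕ Fin m))) := by
  have : (ringA K n m : Set (Laurent K (Fin n ⊕ Fin m))) =
      ⋂ (u : Fin n ⊕ Fin m → ℤ) (_ : ∃ j : Fin m, u (Sum.inr j) < 0), {a | a.coeff u = 0} := by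
    ext a
    simp [ringA]
  rw [this]
  exact isClosed_iInter fun u => isClosed_iInter fun _ =>
    isClosed_eq (continuous_coeff u) continuous_const

instance : CompleteSpace (ringA K n m) := (isClosed_ringA K n m).completeSpace_coe

instance : NormOneClass (ringA K n m) := ⟨norm_one (α := Laurent K (Fin n ⊕ Fin m))⟩

instance : IsUltrametricDist (ringA K n m) := IsUltrametricDist.subtype _

variable {K n m}

theorem norm_algebraMap_mul (c : K) (a : ringA K n m) :
    ‖algebraMap K (ringA K n m) c * a‖ = ‖c‖ * ‖a‖ := by
  rw [← Algebra.smul_def]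
  exact norm_smul_eq c a.1

theorem isNormUniformizer_algebraMap {ϖ : K} (hϖ : IsNormUniformizer ϖ) :
    IsNormUniformizer (algebraMap K (ringA K n m) ϖ) where
  isUnit := hϖ.isUnit.map _
  norm_lt_one := by rw [norm_algebraMap']; exact hϖ.norm_lt_one
  norm_mul x := by rw [norm_algebraMap_mul, norm_algebraMap']
  norm_le {x} hx := by
    obtain ⟨u, hu⟩ := exists_norm_eq x.1
    have hxu : ‖x‖ = ‖x.1.coeff u‖ := hu
    rw [norm_algebraMap', hxu]
    exact hϖ.norm_le (hxu ▸ hx)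

end Polyannulus

/-! ### The reduction of `𝒜` -/

theorem isMaximal_openUnitBall {K : Type u} [NormedField K] [IsUltrametricDist K] :
    (openUnitBall K).IsMaximal := by
  refine Ideal.isMaximal_iff.2 ⟨fun h => lt_irrefl (1 : ℝ) (by simpa using mem_openUnitBall.1 h),
    fun J x _ hx hxJ => ?_⟩
  have hnorm : ‖(x : K)‖ = 1 := le_antisymm x.2 (not_lt.1 hx)
  have hne : (x : K) ≠ 0 := norm_ne_zero_iff.1 (hnorm ▸ one_ne_zero)
  have hone : (1 : unitBall K) = ⟨(x : K)⁻¹, by rw [mem_unitBall, norm_inv, hnorm, inv_one]⟩ * x :=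
    Subtype.ext (inv_mul_cancel₀ hne).symm
  exact hone ▸ J.mul_mem_left _ hxJ

namespace Laurent

section IntExponent

variable {σ : Type*}

/-- The exponent of a monomial of a polynomial ring, as the exponent of a Laurent series. -/
noncomputable def intExponent : (σ →₀ ℕ) →+ (σ → ℤ) :=
  ((Nat.castAddMonoidHom ℤ).compLeft σ).comp Finsupp.coeFnAddHom

@[simp] theorem intExponent_apply (v : σ →₀ ℕ) (s : σ) : intExponent v s = v s := rfl

theorem intExponent_injective : Function.Injective (intExponent (σ := σ)) :=
  fun _ _ h => Finsupp.ext fun s => Nat.cast_injective (congrFun h s)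

theorem intExponent_single (s : σ) (k : ℕ) [DecidableEq σ] :
    intExponent (Finsupp.single s k) = k • Pi.single s 1 := by
  ext t
  obtain rfl | h := eq_or_ne s t
  · simp
  · simp [h.symm]

theorem exists_intExponent_eq [Finite σ] {u : σ → ℤ} (hu : ∀ s, 0 ≤ u s) :
    ∃ v, intExponent v = u :=
  ⟨Finsupp.equivFunOnFinite.symm fun s => (u s).toNat,
    funext fun s => by simp [Int.toNat_of_nonneg (hu s)]⟩

end IntExponent

variable {K σ : Type*} [NormedField K] [IsUltrametricDist K] [CompleteSpace K]

theorem monomial_pow (u : σ → ℤ) (k : ℕ) :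
    (monomial u 1 : Laurent K σ) ^ k = monomial (k • u) 1 := by
  induction k with
  | zero => rw [pow_zero, zero_smul]; rfl
  | succ k ih => rw [pow_succ, ih, monomial_mul_monomial, succ_nsmul, one_mul]

theorem norm_sub_sum_monomial_lt (a : Laurent K σ) {ε : ℝ} (hε : 0 < ε) :
    ‖a - ∑ u ∈ (a.finite_setOf_le_norm_coeff hε).toFinset, monomial u (a.coeff u)‖ < ε := by
  classical
  refine norm_lt_iff.2 fun w => ?_
  simp only [coeff_sub, coeff_sum, coeff_monomial, Finset.sum_ite_eq, Set.Finite.mem_toFinset,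
    Set.mem_ofPred_eq]
  split_ifs with hw
  · simpa using hε
  · simpa using not_le.1 hw

variable [DecidableEq σ]

variable (K σ) in
/-- The polynomials with integral coefficients as Laurent series. -/
noncomputable def ofMvPolynomial : MvPolynomial σ (unitBall K) →+* Laurent K σ :=
  MvPolynomial.eval₂Hom ((algebraMap K (Laurent K σ)).comp (unitBall K).subtype)
    fun s => monomial (Pi.single s 1) 1

theorem ofMvPolynomial_monomial_one (v : σ →₀ ℕ) :
    ofMvPolynomial K σ (MvPolynomial.monomial v 1) = monomial (intExponent v) 1 := by
  induction v using Finsupp.induction_linear with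
  | zero => rw [MvPolynomial.monomial_zero', map_one, map_one, map_zero]; rfl
  | add v w hv hw =>
    rw [← mul_one (1 : unitBall K), ← MvPolynomial.monomial_mul, map_mul, hv, hw,
      monomial_mul_monomial, map_add, one_mul]
  | single s k =>
    rw [← MvPolynomial.X_pow_eq_monomial, map_pow, ofMvPolynomial, MvPolynomial.eval₂Hom_X',
      monomial_pow, intExponent_single]

theorem ofMvPolynomial_monomial (v : σ →₀ ℕ) (c : unitBall K) :
    ofMvPolynomial K σ (MvPolynomial.monomial v c) = monomial (intExponent v) (c : K) := by
  rw [← mul_one c, ← MvPolynomial.C_mul_monomial, map_mul, ofMvPolynomial_monomial_one,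
    ofMvPolynomial, MvPolynomial.eval₂Hom_C, RingHom.comp_apply, algebraMap_eq_monomial,
    monomial_mul_monomial, zero_add, mul_one, mul_one]
  rfl

theorem coeff_ofMvPolynomial (f : MvPolynomial σ (unitBall K)) (v : σ →₀ ℕ) :
    (ofMvPolynomial K σ f).coeff (intExponent v) = (f.coeff v : unitBall K) := by
  induction f using MvPolynomial.induction_on' with
  | monomial w c =>
    rw [ofMvPolynomial_monomial, coeff_monomial, MvPolynomial.coeff_monomial]
    simp only [intExponent_injective.eq_iff, eq_comm (a := v)]
    split_ifs <;> rfl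
  | add f g hf hg =>
    rw [map_add, coeff_add, hf, hg, MvPolynomial.coeff_add, Subring.coe_add]

end Laurent

namespace Polyannulus

open Laurent

variable {K : Type u} [NormedField K] [IsUltrametricDist K] [CompleteSpace K] {n m : ℕ}

section Reduction

variable (K n m)

/-- The variable `T_s`, as an element of the unit ball of `𝒜`. -/
noncomputable def varBall (s : Fin n ⊕ Fin m) : unitBall (ringA K n m) :=
  ⟨⟨monomial (Pi.single s 1) 1, by
    rintro u ⟨j, hj⟩
    rw [coeff_monomial, if_neg]
    rintro rfl
    exact hj.not_ge ((Pi.single_nonneg.2 zero_le_one : (0 : Fin n ⊕ Fin m → ℤ) ≤ _) _)⟩,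
    ((norm_monomial _ _).trans norm_one).le⟩

/-- The inclusion of the constants in the unit ball of `𝒜`. -/
noncomputable def constBall : unitBall K →+* unitBall (ringA K n m) :=
  ((algebraMap K (ringA K n m)).comp (unitBall K).subtype).codRestrict _ fun x =>
    (norm_algebraMap' _ (x : K)).trans_le x.2

/-- The inclusion of the polynomials with integral coefficients in the unit ball of `𝒜`. -/
noncomputable def polyBall : MvPolynomial (Fin n ⊕ Fin m) (unitBall K) →+*
    unitBall (ringA K n m) :=
  MvPolynomial.eval₂Hom (constBall K n m) (varBall K n m)

/-- The map from the polynomial ring over the residue field of `K` to the reduction of `𝒜`. -/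
noncomputable def polyReduction : MvPolynomial (Fin n ⊕ Fin m) (Reduction K) →+*
    Reduction (ringA K n m) :=
  MvPolynomial.eval₂Hom
    (Ideal.quotientMap (openUnitBall (ringA K n m)) (constBall K n m) fun x hx =>
      (norm_algebraMap' (ringA K n m) (x : K)).trans_lt hx)
    fun s => Ideal.Quotient.mk _ (varBall K n m s)

/-- The exponent of `T_1 ⋯ T_n`. -/
noncomputable def logExponent : Fin n ⊕ Fin m →₀ ℕ :=
  Finsupp.equivFunOnFinite.symm (Sum.elim (fun _ => 1) fun _ => 0)

/-- The monomial `T_1 ⋯ T_n` over the residue field of `K`. -/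
noncomputable def logMonomial : MvPolynomial (Fin n ⊕ Fin m) (Reduction K) :=
  MvPolynomial.monomial (logExponent n m) 1

variable {K n m}

theorem coe_polyBall (f : MvPolynomial (Fin n ⊕ Fin m) (unitBall K)) :
    ((polyBall K n m f : ringA K n m) : Laurent K (Fin n ⊕ Fin m)) = ofMvPolynomial K _ f :=
  MvPolynomial.hom_eval₂ f (constBall K n m)
    ((ringA K n m).val.toRingHom.comp (unitBall (ringA K n m)).subtype) (varBall K n m)

theorem polyReduction_map (f : MvPolynomial (Fin n ⊕ Fin m) (unitBall K)) :
    polyReduction K n m (MvPolynomial.map (Ideal.Quotient.mk (openUnitBall K)) f) =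
      Ideal.Quotient.mk _ (polyBall K n m f) := by
  induction f using MvPolynomial.induction_on with
  | C c =>
    simp only [MvPolynomial.map_C, polyReduction, polyBall, MvPolynomial.eval₂Hom_C]
    rfl
  | add f g hf hg => simp only [map_add, hf, hg]
  | mul_X f s hf =>
    simp only [map_mul, hf, MvPolynomial.map_X]
    simp [polyReduction, polyBall]

theorem polyReduction_injective : Function.Injective (polyReduction K n m) := by
  refine (injective_iff_map_eq_zero _).2 fun g hg => ?_
  obtain ⟨f, rfl⟩ := MvPolynomial.map_surjective _ Ideal.Quotient.mk_surjective g
  rw [polyReduction_map, Ideal.Quotient.eq_zero_iff_mem, mem_openUnitBall] at hg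
  ext v
  rw [MvPolynomial.coeff_map, MvPolynomial.coeff_zero, Ideal.Quotient.eq_zero_iff_mem,
    mem_openUnitBall, ← coeff_ofMvPolynomial, ← coe_polyBall]
  exact (norm_coeff_le _ _).trans_lt hg

/-- The term `a_u T^u` of an element `a` of the unit ball of `𝒜`. -/
noncomputable def termBall (a : unitBall (ringA K n m)) (u : Fin n ⊕ Fin m → ℤ) :
    unitBall (ringA K n m) :=
  ⟨⟨monomial u (a.1.1.coeff u), fun v hv => by
    rw [coeff_monomial]
    split_ifs with h
    · exact a.1.2 u (h ▸ hv)
    · rfl⟩, (norm_monomial _ _).trans_le ((norm_coeff_le _ _).trans a.2)⟩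

theorem exists_sub_sum_termBall_mem (a : unitBall (ringA K n m)) :
    ∃ S, a - ∑ u ∈ S, termBall a u ∈ openUnitBall (ringA K n m) := by
  refine ⟨(a.1.1.finite_setOf_le_norm_coeff one_pos).toFinset, ?_⟩
  have hsum := map_sum ((ringA K n m).val.toRingHom.comp (unitBall (ringA K n m)).subtype)
    (termBall a) (a.1.1.finite_setOf_le_norm_coeff one_pos).toFinset
  refine lt_of_eq_of_lt ?_ (norm_sub_sum_monomial_lt a.1.1 one_pos)
  exact congrArg (fun b => ‖a.1.1 - b‖) hsum

theorem exists_termBall_mul_polyBall_eq {a : unitBall (ringA K n m)} {u : Fin n ⊕ Fin m → ℤ}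
    {N : ℕ} (h : ∀ s, 0 ≤ (u + N • intExponent (logExponent n m)) s) :
    ∃ f, termBall a u * polyBall K n m (MvPolynomial.monomial (logExponent n m) 1 ^ N) =
      polyBall K n m f := by
  obtain ⟨v, hv⟩ := exists_intExponent_eq h
  refine ⟨MvPolynomial.monomial v ⟨a.1.1.coeff u, (norm_coeff_le _ _).trans a.2⟩,
    Subtype.ext (Subtype.ext ?_)⟩
  have hmul : monomial u (a.1.1.coeff u) *
      ofMvPolynomial K _ (MvPolynomial.monomial (logExponent n m) 1 ^ N) =
        monomial (intExponent v) (a.1.1.coeff u) := by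
    rw [map_pow, ofMvPolynomial_monomial_one, monomial_pow, monomial_mul_monomial, mul_one, hv]
  rw [coe_polyBall, ofMvPolynomial_monomial, ← hmul, ← coe_polyBall]
  rfl

theorem eventually_termBall_mul_logMonomial_pow_mem_range (a : unitBall (ringA K n m))
    (u : Fin n ⊕ Fin m → ℤ) : ∀ᶠ N : ℕ in atTop, Ideal.Quotient.mk _ (termBall a u) *
      polyReduction K n m (logMonomial K n m ^ N) ∈ (polyReduction K n m).range := by
  by_cases hu : ∃ j : Fin m, u (Sum.inr j) < 0
  · have hterm : termBall a u = 0 := Subtype.ext (Subtype.ext (by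
      ext v
      simp [termBall, coeff_monomial, a.1.2 u hu]))
    simp [hterm]
  · push Not at hu
    have hev : ∀ᶠ N : ℕ in atTop, ∀ s, 0 ≤ (u + N • intExponent (logExponent n m)) s := by
      refine eventually_all.2 (Sum.rec (fun i => ?_) fun j => ?_)
      · filter_upwards [eventually_ge_atTop (u (Sum.inl i)).natAbs] with N hN
        simp [logExponent]
        omega
      · exact Eventually.of_forall fun N => by simpa [logExponent] using hu j
    filter_upwards [hev] with N hN
    obtain ⟨f, hf⟩ := exists_termBall_mul_polyBall_eq (a := a) hN
    refine ⟨MvPolynomial.map (Ideal.Quotient.mk _) f, ?_⟩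
    have hpow : logMonomial K n m ^ N = MvPolynomial.map (Ideal.Quotient.mk (openUnitBall K))
        (MvPolynomial.monomial (logExponent n m) 1 ^ N) := by
      rw [map_pow, MvPolynomial.map_monomial, map_one]
      rfl
    rw [hpow, polyReduction_map, polyReduction_map, ← map_mul, hf]

theorem exists_mul_logMonomial_pow_mem_range (z : Reduction (ringA K n m)) :
    ∃ N : ℕ, z * polyReduction K n m (logMonomial K n m ^ N) ∈ (polyReduction K n m).range := by
  obtain ⟨a, rfl⟩ := Ideal.Quotient.mk_surjective z
  obtain ⟨S, hS⟩ := exists_sub_sum_termBall_mem a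
  rw [Ideal.Quotient.eq.2 hS, map_sum]
  refine ((eventually_all_finset S).2 fun u _ =>
    eventually_termBall_mul_logMonomial_pow_mem_range a u).exists.imp fun N hN => ?_
  rw [Finset.sum_mul]
  exact Subring.sum_mem _ hN

theorem isUnit_varBall (i : Fin n) : IsUnit (varBall K n m (Sum.inl i)) := by
  refine IsUnit.of_mul_eq_one ⟨invT K n m i, ((norm_monomial _ _).trans norm_one).le⟩
    (Subtype.ext (Subtype.ext ?_))
  change monomial (Pi.single (Sum.inl i) 1) 1 * monomial (Pi.single (Sum.inl i) (-1)) 1 = _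
  rw [monomial_mul_monomial, ← Pi.single_add, add_neg_cancel, Pi.single_zero, mul_one]
  rfl

theorem isUnit_polyReduction_logMonomial :
    IsUnit (polyReduction K n m (logMonomial K n m)) := by
  have hprod : logMonomial K n m = ∏ i : Fin n, MvPolynomial.X (Sum.inl i) := by
    rw [logMonomial, MvPolynomial.monomial_eq, Finsupp.prod_fintype _ _ (by simp)]
    simp [logExponent, Fintype.prod_sum_type]
  rw [hprod, map_prod]
  refine IsUnit.prod_univ_iff.2 fun i => ?_
  simpa only [polyReduction, MvPolynomial.eval₂Hom_X'] using
    (isUnit_varBall (K := K) (m := m) i).map (Ideal.Quotient.mk (openUnitBall _))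

theorem isLocalization_polyReduction :
    letI := (polyReduction K n m).toAlgebra
    IsLocalization (Submonoid.powers (logMonomial K n m)) (Reduction (ringA K n m)) :=
  letI := (polyReduction K n m).toAlgebra
  { map_units := by
      rintro ⟨_, N, rfl⟩
      change IsUnit (polyReduction K n m _)
      rw [map_pow]
      exact isUnit_polyReduction_logMonomial.pow N
    surj := fun z =>
      have ⟨N, f, hf⟩ := exists_mul_logMonomial_pow_mem_range z
      ⟨(f, ⟨_, N, rfl⟩), hf.symm⟩
    exists_of_eq := fun {x y} h => ⟨1, by rw [polyReduction_injective h]⟩ }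

variable (K n m) in
theorem hasFiniteFreeResolutions_reduction :
    HasFiniteFreeResolutions (Reduction (ringA K n m)) := by
  have := isMaximal_openUnitBall (K := K)
  let : Field (Reduction K) := Ideal.Quotient.field (openUnitBall K)
  let := (polyReduction K n m).toAlgebra
  have := isLocalization_polyReduction (K := K) (n := n) (m := m)
  exact .of_isLocalization (Submonoid.powers (logMonomial K n m)) _
    (.mvPolynomial (Reduction K) (Fin n ⊕ Fin m))

instance : IsNoetherianRing (Reduction (ringA K n m)) := by
  have := isMaximal_openUnitBall (K := K)
  let : Field (Reduction K) := Ideal.Quotient.field (openUnitBall K)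
  let := (polyReduction K n m).toAlgebra
  have := isLocalization_polyReduction (K := K) (n := n) (m := m)
  exact IsLocalization.isNoetherianRing (Submonoid.powers (logMonomial K n m)) _ inferInstance

end Reduction

theorem nonempty_linearEquiv_of_rankAtStalk_eq_one {ϖ : K} (hϖ : IsNormUniformizer ϖ) (M : Type*)
    [AddCommGroup M] [Module (ringA K n m) M] [Module.Finite (ringA K n m) M]
    [Module.Projective (ringA K n m) M] (h : ∀ P, Module.rankAtStalk (R := ringA K n m) M P = 1) :
    Nonempty (M ≃ₗ[ringA K n m] ringA K n m) := by
  have := (isNormUniformizer_algebraMap (n := n) (m := m) hϖ).isStablyFree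
    (hasFiniteFreeResolutions_reduction K n m) M
  have := invertible_of_rankAtStalk_eq_one h
  exact Module.Invertible.free_iff_linearEquiv.1
    (Module.free_of_isStablyFree_of_invertible (ringA K n m) M)

end Polyannulus

/-! ### Norms of integers and the exponential -/

section IntegerNorms

variable {K : Type*} [NormedField K] [IsUltrametricDist K]

theorem norm_natCast_eq_one_of_coprime {a b : ℕ} (h : a.Coprime b) (hb : ‖(b : K)‖ < 1) :
    ‖(a : K)‖ = 1 := by
  refine le_antisymm (IsUltrametricDist.norm_natCast_le_one K a) (not_lt.1 fun ha => ?_)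
  have hmul_lt : ∀ (c : ℤ) {x : K}, ‖x‖ < 1 → ‖(c : K) * x‖ < 1 := fun c x hx => by
    rw [norm_mul]
    exact mul_lt_one_of_nonneg_of_lt_one_right (IsUltrametricDist.norm_intCast_le_one K c)
      (norm_nonneg x) hx
  obtain ⟨c, d, hcd⟩ := Nat.isCoprime_iff_coprime.2 h
  have hone : (c : K) * a + d * b = 1 := by exact_mod_cast congrArg (Int.cast (R := K)) hcd
  have hlt : ‖(c : K) * a + d * b‖ < 1 :=
    (IsUltrametricDist.norm_add_le_max _ _).trans_lt (max_lt (hmul_lt c ha) (hmul_lt d hb))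
  rw [hone, norm_one] at hlt
  exact lt_irrefl _ hlt

variable {p : ℕ} [hp : Fact p.Prime]

theorem norm_natCast_eq_inv_pow_padicValNat (hK : ‖(p : K)‖ = (p : ℝ)⁻¹) {z : ℕ} (hz : z ≠ 0) :
    ‖(z : K)‖ = ((p : ℝ) ^ padicValNat p z)⁻¹ := by
  obtain ⟨v, w, hw, rfl⟩ := Nat.exists_eq_pow_mul_and_not_dvd hz p hp.out.ne_one
  have hw0 : w ≠ 0 := right_ne_zero_of_mul hz
  have hlt : ‖(p : K)‖ < 1 := hK ▸ inv_lt_one_of_one_lt₀ (by exact_mod_cast hp.out.one_lt)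
  have hw1 : ‖(w : K)‖ = 1 :=
    norm_natCast_eq_one_of_coprime ((Nat.Prime.coprime_iff_not_dvd hp.out).2 hw).symm hlt
  rw [padicValNat.mul (pow_ne_zero _ hp.out.ne_zero) hw0, padicValNat.prime_pow,
    padicValNat.eq_zero_of_not_dvd hw, add_zero, Nat.cast_mul, Nat.cast_pow, norm_mul, norm_pow,
    hK, hw1, mul_one, inv_pow]

theorem charZero_of_norm_natCast_prime_eq (hK : ‖(p : K)‖ = (p : ℝ)⁻¹) : CharZero K :=
  charZero_of_inj_zero fun z hz => by
    by_contra hne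
    have hpos : 0 < ((p : ℝ) ^ padicValNat p z)⁻¹ :=
      inv_pos.2 (pow_pos (by exact_mod_cast hp.out.pos) _)
    rw [← norm_natCast_eq_inv_pow_padicValNat hK hne, hz, norm_zero] at hpos
    exact lt_irrefl _ hpos

theorem norm_inv_natCast_le (hK : ‖(p : K)‖ = (p : ℝ)⁻¹) (z : ℕ) : ‖(z : K)⁻¹‖ ≤ z := by
  rcases eq_or_ne z 0 with rfl | hz
  · simp
  · rw [norm_inv, norm_natCast_eq_inv_pow_padicValNat hK hz, inv_inv]
    exact_mod_cast Nat.le_of_dvd (Nat.pos_of_ne_zero hz) pow_padicValNat_dvd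

theorem norm_inv_intCast_le (hK : ‖(p : K)‖ = (p : ℝ)⁻¹) (z : ℤ) : ‖(z : K)⁻¹‖ ≤ z.natAbs := by
  obtain ⟨k, rfl | rfl⟩ := z.eq_nat_or_neg
  · simpa using norm_inv_natCast_le hK k
  · simpa [inv_neg] using norm_inv_natCast_le hK k

theorem norm_inv_factorial_le (hK : ‖(p : K)‖ = (p : ℝ)⁻¹) (l : ℕ) :
    ‖((l.factorial : ℕ) : K)⁻¹‖ ≤ (p : ℝ) ^ l := by
  rw [norm_inv, norm_natCast_eq_inv_pow_padicValNat hK l.factorial_ne_zero, inv_inv]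
  refine pow_le_pow_right₀ (by exact_mod_cast hp.out.one_lt.le) ?_
  calc padicValNat p l.factorial
      ≤ (p - 1) * padicValNat p l.factorial :=
        Nat.le_mul_of_pos_left _ (Nat.sub_pos_of_lt hp.out.one_lt)
    _ ≤ l := by rw [sub_one_mul_padicValNat_factorial]; exact Nat.sub_le _ _

end IntegerNorms

section Exponential

variable (K : Type*) {A : Type*} [NormedField K] [NormedCommRing A] [NormedAlgebra K A]

/-- The exponential series `∑ g^l / l!`. It is meant for a field `K` of characteristic `0` which is
not assumed to be an algebra over the reals, so that the library's exponential does not apply. -/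
noncomputable def expSeriesSum (g : A) : A := ∑' l : ℕ, ((l.factorial : ℕ) : K)⁻¹ • g ^ l

variable {K} {C : ℝ} {g : A}

theorem norm_inv_factorial_smul_pow_le [NormOneClass A]
    (hK : ∀ l : ℕ, ‖((l.factorial : ℕ) : K)⁻¹‖ ≤ C ^ l) (l : ℕ) :
    ‖((l.factorial : ℕ) : K)⁻¹ • g ^ l‖ ≤ (C * ‖g‖) ^ l :=
  calc ‖((l.factorial : ℕ) : K)⁻¹ • g ^ l‖
      ≤ ‖((l.factorial : ℕ) : K)⁻¹‖ * ‖g ^ l‖ := norm_smul_le _ _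
    _ ≤ C ^ l * ‖g‖ ^ l := mul_le_mul (hK l) (norm_pow_le g l) (norm_nonneg _)
        ((norm_nonneg _).trans (hK l))
    _ = (C * ‖g‖) ^ l := (mul_pow C ‖g‖ l).symm

theorem derivation_inv_factorial_smul_pow [CharZero K] (d : Derivation K A A) (l : ℕ) :
    d ((((l + 1).factorial : ℕ) : K)⁻¹ • g ^ (l + 1)) =
      (((l.factorial : ℕ) : K)⁻¹ • g ^ l) * d g := by
  have hl : ((l + 1 : ℕ) : K) ≠ 0 := Nat.cast_ne_zero.2 l.succ_ne_zero
  have hinv : (((l + 1).factorial : ℕ) : K)⁻¹ * ((l + 1 : ℕ) : K) = ((l.factorial : ℕ) : K)⁻¹ := by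
    rw [Nat.factorial_succ, Nat.cast_mul, mul_inv_rev, inv_mul_cancel_right₀ hl]
  rw [Derivation.map_smul, Derivation.leibniz_pow, Nat.add_sub_cancel, ← Nat.cast_smul_eq_nsmul K,
    smul_smul, hinv, smul_mul_assoc, smul_eq_mul]

variable [CompleteSpace A] [NormOneClass A]

theorem summable_inv_factorial_smul_pow (hC : 0 ≤ C)
    (hK : ∀ l : ℕ, ‖((l.factorial : ℕ) : K)⁻¹‖ ≤ C ^ l) (hg : C * ‖g‖ < 1) :
    Summable fun l : ℕ => ((l.factorial : ℕ) : K)⁻¹ • g ^ l :=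
  .of_norm_bounded (summable_geometric_of_lt_one (by positivity) hg)
    (norm_inv_factorial_smul_pow_le hK)

theorem isUnit_expSeriesSum [IsUltrametricDist A] (hC : 0 ≤ C)
    (hK : ∀ l : ℕ, ‖((l.factorial : ℕ) : K)⁻¹‖ ≤ C ^ l) (hg : C * ‖g‖ < 1) :
    IsUnit (expSeriesSum K g) := by
  have hsplit : expSeriesSum K g =
      1 - -∑' l : ℕ, (((l + 1).factorial : ℕ) : K)⁻¹ • g ^ (l + 1) := by
    rw [expSeriesSum, (summable_inv_factorial_smul_pow hC hK hg).tsum_eq_zero_add]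
    simp
  rw [hsplit]
  refine isUnit_one_sub_of_norm_lt_one ?_
  rw [norm_neg]
  refine (IsUltrametricDist.norm_tsum_le_of_forall_le_of_nonneg (by positivity)
    fun l => ?_).trans_lt hg
  calc _ ≤ (C * ‖g‖) ^ (l + 1) := norm_inv_factorial_smul_pow_le hK (l + 1)
    _ ≤ C * ‖g‖ := pow_le_of_le_one (by positivity) hg.le l.succ_ne_zero

theorem derivation_expSeriesSum [CharZero K] (hC : 0 ≤ C)
    (hK : ∀ l : ℕ, ‖((l.factorial : ℕ) : K)⁻¹‖ ≤ C ^ l) (hg : C * ‖g‖ < 1)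
    (d : Derivation K A A) (hd : Continuous d) :
    d (expSeriesSum K g) = expSeriesSum K g * d g := by
  have hsum := (summable_inv_factorial_smul_pow hC hK hg).hasSum
  have hshift : HasSum (fun l : ℕ => d ((((l + 1).factorial : ℕ) : K)⁻¹ • g ^ (l + 1)))
      (expSeriesSum K g * d g) := by
    simp only [derivation_inv_factorial_smul_pow]
    exact hsum.mul_right (d g)
  have hzero : d (((Nat.factorial 0 : ℕ) : K)⁻¹ • g ^ 0) = 0 := by simp
  rw [hasSum_nat_add_iff (f := fun l : ℕ => d (((l.factorial : ℕ) : K)⁻¹ • g ^ l)) 1,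
    Finset.sum_range_one, hzero, add_zero] at hshift
  exact (hsum.map d hd).unique hshift

end Exponential

/-! ### Decay along the poles -/

namespace Polyannulus

open Laurent

section Decay

variable {n m : ℕ}

/-- The total order of the poles of `T^u` along `T_1 ⋯ T_n = 0`. -/
def poleOrder (u : Fin n ⊕ Fin m → ℤ) : ℕ := ∑ i : Fin n, (-u (Sum.inl i)).toNat

@[simp]
theorem poleOrder_zero : poleOrder (0 : Fin n ⊕ Fin m → ℤ) = 0 := by simp [poleOrder]

theorem poleOrder_add_le (u v : Fin n ⊕ Fin m → ℤ) :
    poleOrder (u + v) ≤ poleOrder u + poleOrder v := by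
  simp only [poleOrder, ← Finset.sum_add_distrib, Pi.add_apply]
  exact Finset.sum_le_sum fun i _ => by omega

theorem neg_le_poleOrder (u : Fin n ⊕ Fin m → ℤ) (i : Fin n) : -u (Sum.inl i) ≤ poleOrder u := by
  have hle : (-u (Sum.inl i)).toNat ≤ poleOrder u :=
    Finset.single_le_sum (f := fun i => (-u (Sum.inl i)).toNat) (fun _ _ => Nat.zero_le _)
      (Finset.mem_univ i)
  omega

theorem poleOrder_le_mul {D : ℝ} (hD : 0 ≤ D) {u : Fin n ⊕ Fin m → ℤ}
    (h : ∀ i : Fin n, -(u (Sum.inl i) : ℝ) ≤ D) : (poleOrder u : ℝ) ≤ n * D := by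
  have hi : ∀ i : Fin n, ((-u (Sum.inl i)).toNat : ℝ) ≤ D := fun i => by
    have hcast : (((-u (Sum.inl i)).toNat : ℤ) : ℝ) = max (-(u (Sum.inl i) : ℝ)) 0 := by
      rw [Int.toNat_eq_max]
      push_cast
      rfl
    rw [← Int.cast_natCast, hcast]
    exact max_le (h i) hD
  calc (poleOrder u : ℝ) = ∑ i : Fin n, ((-u (Sum.inl i)).toNat : ℝ) := by
        rw [poleOrder, Nat.cast_sum]
    _ ≤ ∑ _i : Fin n, D := Finset.sum_le_sum fun i _ => hi i
    _ = n * D := by simp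

/-- The `ρ`-th power of the pole order of `T^u`, shifted by one so as to be positive. Decay along
the poles is measured against this weight. -/
noncomputable def poleWeight (ρ : ℝ) (u : Fin n ⊕ Fin m → ℤ) : ℝ := (1 + poleOrder u : ℝ) ^ ρ

theorem poleWeight_pos (ρ : ℝ) (u : Fin n ⊕ Fin m → ℤ) : 0 < poleWeight ρ u := by
  unfold poleWeight
  positivity

theorem poleWeight_add_le_mul {ρ : ℝ} (hρ : 0 ≤ ρ) (u v : Fin n ⊕ Fin m → ℤ) :
    poleWeight ρ (u + v) ≤ poleWeight ρ u * poleWeight ρ v := by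
  unfold poleWeight
  rw [← Real.mul_rpow (by positivity) (by positivity)]
  refine Real.rpow_le_rpow (by positivity) ?_ hρ
  have hadd : (poleOrder (u + v) : ℝ) ≤ poleOrder u + poleOrder v := by
    exact_mod_cast poleOrder_add_le u v
  have hmul : (0 : ℝ) ≤ (poleOrder u : ℝ) * poleOrder v := by positivity
  linarith

theorem poleWeight_add_le_max {ρ : ℝ} (hρ : 0 ≤ ρ) (u v : Fin n ⊕ Fin m → ℤ) :
    poleWeight ρ (u + v) ≤ 2 ^ ρ * max (poleWeight ρ u) (poleWeight ρ v) := by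
  wlog huv : poleOrder u ≤ poleOrder v generalizing u v
  · rw [add_comm u v, max_comm]
    exact this v u (le_of_not_ge huv)
  have hadd : (poleOrder (u + v) : ℝ) ≤ 2 * poleOrder v := by
    exact_mod_cast (poleOrder_add_le u v).trans (by omega)
  calc poleWeight ρ (u + v) ≤ (2 * (1 + poleOrder v)) ^ ρ :=
        Real.rpow_le_rpow (by positivity) (by linarith) hρ
    _ = 2 ^ ρ * poleWeight ρ v := Real.mul_rpow zero_le_two (by positivity)
    _ ≤ 2 ^ ρ * max (poleWeight ρ u) (poleWeight ρ v) := by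
        gcongr
        exact le_max_right _ _

variable {K : Type u} [NormedField K] [IsUltrametricDist K] [CompleteSpace K]

/-- The coefficients of `x` decay like the `-ρ`-th power of the pole order, with constant `C`. For
`ρ > 1` this leaves room for the denominators of a primitive of `x`. -/
def DecayBound (ρ C : ℝ) (x : ringA K n m) : Prop :=
  ∀ u, ‖x.1.coeff u‖ * poleWeight ρ u ≤ C

namespace DecayBound

variable {ρ C C' : ℝ} {x y : ringA K n m}

theorem nonneg (h : DecayBound ρ C x) : 0 ≤ C :=
  (mul_nonneg (norm_nonneg _) (poleWeight_pos ρ 0).le).trans (h 0)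

theorem mono (h : DecayBound ρ C x) (hC : C ≤ C') : DecayBound ρ C' x := fun u => (h u).trans hC

theorem one (ρ : ℝ) : DecayBound ρ 1 (1 : ringA K n m) := fun u => by
  classical
  change ‖(1 : Laurent K (Fin n ⊕ Fin m)).coeff u‖ * _ ≤ 1
  rw [coeff_one]
  split_ifs with h
  · simp [h, poleWeight]
  · simp

theorem add (h : DecayBound ρ C x) (h' : DecayBound ρ C' y) :
    DecayBound ρ (max C C') (x + y) := fun u => by
  have hw := (poleWeight_pos ρ u).le
  calc ‖x.1.coeff u + y.1.coeff u‖ * poleWeight ρ u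
      ≤ max ‖x.1.coeff u‖ ‖y.1.coeff u‖ * poleWeight ρ u :=
        mul_le_mul_of_nonneg_right (IsUltrametricDist.norm_add_le_max _ _) hw
    _ ≤ max C C' := by
        rw [max_mul_of_nonneg _ _ hw]
        exact max_le_max (h u) (h' u)

theorem neg (h : DecayBound ρ C x) : DecayBound ρ C (-x) := fun u =>
  (congrArg (· * poleWeight ρ u) (norm_neg (x.1.coeff u))).trans_le (h u)

theorem mul_of_forall_coeff (hC : 0 ≤ C)
    (h : ∀ u v, ‖x.1.coeff u‖ * ‖y.1.coeff v‖ * poleWeight ρ (u + v) ≤ C) :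
    DecayBound ρ C (x * y) := fun w => by
  have hw := poleWeight_pos ρ w
  rw [← le_div_iff₀ hw]
  change ‖(x.1 * y.1).coeff w‖ ≤ _
  rw [coeff_mul]
  refine IsUltrametricDist.norm_tsum_le_of_forall_le_of_nonneg (by positivity) fun u => ?_
  rw [norm_mul, le_div_iff₀ hw]
  simpa only [add_sub_cancel] using h u (w - u)

theorem mul (hρ : 0 ≤ ρ) (h : DecayBound ρ C x) (h' : DecayBound ρ C' y) :
    DecayBound ρ (C * C') (x * y) :=
  mul_of_forall_coeff (mul_nonneg h.nonneg h'.nonneg) fun u v =>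
    calc ‖x.1.coeff u‖ * ‖y.1.coeff v‖ * poleWeight ρ (u + v)
        ≤ ‖x.1.coeff u‖ * ‖y.1.coeff v‖ * (poleWeight ρ u * poleWeight ρ v) := by
          gcongr
          exact poleWeight_add_le_mul hρ u v
      _ = (‖x.1.coeff u‖ * poleWeight ρ u) * (‖y.1.coeff v‖ * poleWeight ρ v) := by ring
      _ ≤ C * C' := mul_le_mul (h u) (h' v)
          (mul_nonneg (norm_nonneg _) (poleWeight_pos ρ v).le) h.nonneg

theorem mul_of_norm_le (hρ : 0 ≤ ρ) (h : DecayBound ρ C x) (h' : DecayBound ρ C y)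
    (hx : 2 ^ ρ * ‖x‖ ≤ 1) (hy : 2 ^ ρ * ‖y‖ ≤ 1) : DecayBound ρ C (x * y) := by
  have hmul_le : ∀ (z : ringA K n m), 2 ^ ρ * ‖z‖ ≤ 1 → ∀ (v) {t : ℝ}, t ≤ C →
      2 ^ ρ * ‖z.1.coeff v‖ * t ≤ C := fun z hz v t ht =>
    (mul_le_mul_of_nonneg_left ht (by positivity)).trans <|
      mul_le_of_le_one_left h.nonneg <|
        (mul_le_mul_of_nonneg_left (norm_coeff_le z.1 v) (by positivity)).trans hz
  refine mul_of_forall_coeff h.nonneg fun u v => ?_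
  calc ‖x.1.coeff u‖ * ‖y.1.coeff v‖ * poleWeight ρ (u + v)
      ≤ ‖x.1.coeff u‖ * ‖y.1.coeff v‖ * (2 ^ ρ * max (poleWeight ρ u) (poleWeight ρ v)) := by
        gcongr
        exact poleWeight_add_le_max hρ u v
    _ = ‖x.1.coeff u‖ * ‖y.1.coeff v‖ * 2 ^ ρ * max (poleWeight ρ u) (poleWeight ρ v) := by ring
    _ = max (2 ^ ρ * ‖y.1.coeff v‖ * (‖x.1.coeff u‖ * poleWeight ρ u))
          (2 ^ ρ * ‖x.1.coeff u‖ * (‖y.1.coeff v‖ * poleWeight ρ v)) := by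
        rw [mul_max_of_nonneg _ _ (by positivity)]
        ring_nf
    _ ≤ C := max_le (hmul_le y hy v (h u)) (hmul_le x hx u (h' v))

theorem pow_succ (hρ : 0 ≤ ρ) (h : DecayBound ρ C x) (hx : 2 ^ ρ * ‖x‖ ≤ 1) (l : ℕ) :
    DecayBound ρ C (x ^ (l + 1)) := by
  have hone : (1 : ℝ) ≤ 2 ^ ρ := Real.one_le_rpow one_le_two hρ
  have hnorm : ‖x‖ ≤ 1 := (le_mul_of_one_le_left (norm_nonneg x) hone).trans hx
  induction l with
  | zero => simpa using h
  | succ l ih =>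
    have hpow : ‖x ^ (l + 1)‖ ≤ ‖x‖ :=
      (norm_pow_le x (l + 1)).trans (pow_le_of_le_one (norm_nonneg x) hnorm l.succ_ne_zero)
    rw [_root_.pow_succ]
    exact ih.mul_of_norm_le hρ h ((mul_le_mul_of_nonneg_left hpow (by positivity)).trans hx) hx

end DecayBound

theorem exists_one_sub_mul_eq_one_and_decayBound {ρ C : ℝ} {y : ringA K n m} (hρ : 0 ≤ ρ)
    (h : DecayBound ρ C y) (hy : 2 ^ ρ * ‖y‖ ≤ 1) (hy1 : ‖y‖ < 1) :
    ∃ z : ringA K n m, (1 - y) * z = 1 ∧ DecayBound ρ (max 1 C) z := by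
  have hs : Summable fun l => y ^ l := summable_geometric_of_norm_lt_one hy1
  refine ⟨∑' l, y ^ l, mul_neg_geom_series y hy1, fun w => ?_⟩
  have hcoeff : HasSum (fun l => (y ^ l).1.coeff w) ((∑' l, y ^ l).1.coeff w) :=
    hs.hasSum.map ((coeffHom w).comp (ringA K n m).val.toAddMonoidHom)
      ((continuous_coeff w).comp continuous_subtype_val)
  have hpos := poleWeight_pos ρ w
  rw [← hcoeff.tsum_eq, ← le_div_iff₀ hpos]
  refine IsUltrametricDist.norm_tsum_le_of_forall_le_of_nonneg (by positivity) fun l => ?_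
  rw [le_div_iff₀ hpos]
  cases l with
  | zero => exact ((DecayBound.one ρ).mono (le_max_left 1 C)) w
  | succ l => exact ((h.pow_succ hρ hy l).mono (le_max_right 1 C)) w

end Decay

end Polyannulus

theorem exists_inv_pow_le_and_eq_or_lt {b t : ℝ} (hb : 1 < b) (ht : 0 < t) (J : ℕ) :
    ∃ j, J ≤ j ∧ (b ^ j)⁻¹ ≤ t ∧ (j = J ∨ t * b ^ j < b) := by
  classical
  have hex : ∃ j, J ≤ j ∧ (b ^ j)⁻¹ ≤ t :=
    (((tendsto_pow_atTop_atTop_of_one_lt hb).inv_tendsto_atTop.eventually_le_const ht).and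
      (eventually_ge_atTop J)).exists.imp fun j hj => hj.symm
  obtain ⟨hJ, hle⟩ := Nat.find_spec hex
  refine ⟨Nat.find hex, hJ, hle, or_iff_not_imp_left.2 fun hne => ?_⟩
  obtain ⟨l, hl⟩ := Nat.exists_eq_add_of_lt (lt_of_le_of_ne hJ (Ne.symm hne))
  have hmin : t < (b ^ (J + l))⁻¹ :=
    not_le.1 fun hcon => Nat.find_min hex (by omega) ⟨J.le_add_right l, hcon⟩
  have hpos : 0 < b ^ (J + l) := pow_pos (zero_lt_one.trans hb) _
  calc t * b ^ Nat.find hex = t * b ^ (J + l) * b := by rw [hl, pow_succ, mul_assoc]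
    _ < (b ^ (J + l))⁻¹ * b ^ (J + l) * b := by gcongr
    _ = b := by rw [inv_mul_cancel₀ hpos.ne', one_mul]

namespace Polyannulus

open Laurent

section LogDecay

variable {K : Type u} [NormedField K] [IsUltrametricDist K] [CompleteSpace K] {n m : ℕ}
  {p : ℕ} [hp : Fact p.Prime] {r ρ : ℝ} {x : ringA K n m}

theorem exists_poleWeight_le_of_mem_ringAr (hρ : 0 ≤ ρ) (hr : r * ρ ≤ 1)
    (hx : x ∈ ringAr K n m p r) : ∃ B : ℝ, 0 ≤ B ∧ ∃ J : ℕ, ∀ j, J ≤ j → ∀ u,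
      ((p : ℝ) ^ j)⁻¹ ≤ ‖x.1.coeff u‖ → poleWeight ρ u ≤ B * (p : ℝ) ^ j := by
  obtain ⟨c, hc, J, h⟩ := hx
  have hp1 : (1 : ℝ) ≤ p := by exact_mod_cast hp.out.one_lt.le
  have hp0 : (0 : ℝ) < p := zero_lt_one.trans_le hp1
  refine ⟨(1 + n * c) ^ ρ, by positivity, J, fun j hj u hu => ?_⟩
  -- `r` may be negative
  set s := max r 0 with hs
  have hone : 1 ≤ (p : ℝ) ^ (s * j) :=
    Real.one_le_rpow hp1 (mul_nonneg (le_max_right r 0) j.cast_nonneg)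
  have hpole : (poleOrder u : ℝ) ≤ n * (c * (p : ℝ) ^ (s * j)) := by
    refine poleOrder_le_mul (by positivity) fun i => ?_
    have hi : -c * (p : ℝ) ^ (r * j) ≤ u (Sum.inl i) :=
      h j hj i u (by rwa [zpow_neg, zpow_natCast])
    have hrs : (p : ℝ) ^ (r * j) ≤ (p : ℝ) ^ (s * j) :=
      Real.rpow_le_rpow_of_exponent_le hp1 (by gcongr; exact le_max_left r 0)
    linarith [mul_le_mul_of_nonneg_left hrs hc.le]
  have hsρ : s * ρ ≤ 1 := by
    rw [hs, max_mul_of_nonneg _ _ hρ, zero_mul]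
    exact max_le hr zero_le_one
  calc poleWeight ρ u ≤ ((1 + n * c) * (p : ℝ) ^ (s * j)) ^ ρ := by
        refine Real.rpow_le_rpow (by positivity) ?_ hρ
        linarith
    _ = (1 + n * c) ^ ρ * (p : ℝ) ^ (s * j * ρ) := by
        rw [Real.mul_rpow (by positivity) (by positivity), ← Real.rpow_mul hp0.le]
    _ ≤ (1 + n * c) ^ ρ * (p : ℝ) ^ (j : ℝ) := by
        refine mul_le_mul_of_nonneg_left (Real.rpow_le_rpow_of_exponent_le hp1 ?_) (by positivity)
        nlinarith [Nat.cast_nonneg (α := ℝ) j]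
    _ = (1 + n * c) ^ ρ * (p : ℝ) ^ j := by rw [Real.rpow_natCast]

theorem exists_decayBound_of_mem_ringAr (hρ : 0 ≤ ρ) (hr : r * ρ ≤ 1)
    (hx : x ∈ ringAr K n m p r) : ∃ C, DecayBound ρ C x := by
  obtain ⟨B, hB, J, h⟩ := exists_poleWeight_le_of_mem_ringAr hρ hr hx
  refine ⟨max (‖x‖ * (B * (p : ℝ) ^ J)) (B * p), fun u => ?_⟩
  rcases (norm_nonneg (x.1.coeff u)).eq_or_lt with hu | hu
  · rw [← hu, zero_mul]
    positivity
  obtain ⟨j, hJ, hle, hj⟩ :=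
    exists_inv_pow_le_and_eq_or_lt (by exact_mod_cast hp.out.one_lt : (1 : ℝ) < p) hu J
  have hw := mul_le_mul_of_nonneg_left (h j hJ u hle) hu.le
  rcases hj with rfl | hlt
  · refine hw.trans ((mul_le_mul_of_nonneg_right (norm_coeff_le x.1 u) ?_).trans (le_max_left _ _))
    positivity
  · calc ‖x.1.coeff u‖ * poleWeight ρ u ≤ ‖x.1.coeff u‖ * (B * (p : ℝ) ^ j) := hw
      _ = B * (‖x.1.coeff u‖ * (p : ℝ) ^ j) := by ring
      _ ≤ B * p := by gcongr
      _ ≤ _ := le_max_right _ _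

end LogDecay

end Polyannulus

/-! ### Primitives of closed forms -/

theorem tendsto_mul_zero_of_mul_rpow_le {ι : Type*} {l : Filter ι} {a q : ι → ℝ} {ρ B : ℝ}
    (hρ : 1 < ρ) (ha : ∀ i, 0 ≤ a i) (hq : ∀ i, 0 ≤ q i) (hB : ∀ i, a i * q i ^ ρ ≤ B)
    (hlim : Tendsto a l (𝓝 0)) : Tendsto (fun i => a i * q i) l (𝓝 0) := by
  have hρ0 : 0 < ρ := zero_lt_one.trans hρ
  have hexp : 0 < 1 - ρ⁻¹ := sub_pos.2 (inv_lt_one_of_one_lt₀ hρ)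
  have hbound : ∀ i, a i * q i ≤ a i ^ (1 - ρ⁻¹) * B ^ ρ⁻¹ := fun i =>
    calc a i * q i = a i ^ (1 - ρ⁻¹) * (a i ^ ρ⁻¹ * (q i ^ ρ) ^ ρ⁻¹) := by
          rw [Real.rpow_rpow_inv (hq i) hρ0.ne', ← mul_assoc,
            ← Real.rpow_add_of_nonneg (ha i) hexp.le (by positivity), sub_add_cancel,
            Real.rpow_one]
      _ = a i ^ (1 - ρ⁻¹) * (a i * q i ^ ρ) ^ ρ⁻¹ := by
          rw [Real.mul_rpow (ha i) (Real.rpow_nonneg (hq i) ρ)]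
      _ ≤ a i ^ (1 - ρ⁻¹) * B ^ ρ⁻¹ := by
          refine mul_le_mul_of_nonneg_left (Real.rpow_le_rpow ?_ (hB i) (by positivity))
            (Real.rpow_nonneg (ha i) _)
          exact mul_nonneg (ha i) (Real.rpow_nonneg (hq i) ρ)
  refine squeeze_zero (fun i => mul_nonneg (ha i) (hq i)) hbound ?_
  simpa [Real.zero_rpow hexp.ne'] using (hlim.rpow_const (.inr hexp.le)).mul_const (B ^ ρ⁻¹)

namespace Polyannulus

open Laurent

section Primitive

variable {K : Type u} [NormedField K] [IsUltrametricDist K] [CompleteSpace K] {n m : ℕ}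
  {ω : Fin n ⊕ Fin m → ringA K n m}

/-- The coefficient of `T^u dT_s / T_s` in the form `∑ ω_s dT_s`. -/
def logCoeff (ω : Fin n ⊕ Fin m → ringA K n m) (s : Fin n ⊕ Fin m) (u : Fin n ⊕ Fin m → ℤ) : K :=
  (ω s).1.coeff (u - Pi.single s 1)

theorem coeff_eq_logCoeff (s : Fin n ⊕ Fin m) (v : Fin n ⊕ Fin m → ℤ) :
    (ω s).1.coeff v = logCoeff ω s (v + Pi.single s 1) := by
  rw [logCoeff, add_sub_cancel_right]

theorem tendsto_logCoeff_cofinite (s : Fin n ⊕ Fin m) :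
    Tendsto (logCoeff ω s) cofinite (𝓝 0) :=
  (ω s).1.coeff_null.comp sub_left_injective.tendsto_cofinite

theorem logCoeff_derivA (f : ringA K n m) (s : Fin n ⊕ Fin m) (u : Fin n ⊕ Fin m → ℤ) :
    logCoeff (fun t => derivA K n m t f) s u = (u s : K) * f.1.coeff u := by
  change (deriv s f.1).coeff (u - Pi.single s 1) = _
  rw [coeff_deriv]
  simp

/-- The equation `u_s a_{t,u} = u_t a_{s,u}` expresses that `∑ a_{s,u} T^u dT_s / T_s` is closed. -/
theorem intCast_mul_logCoeff_comm (hω : ∀ s t, derivA K n m s (ω t) = derivA K n m t (ω s))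
    (s t : Fin n ⊕ Fin m) (u : Fin n ⊕ Fin m → ℤ) :
    (u s : K) * logCoeff ω t u = u t * logCoeff ω s u := by
  rcases eq_or_ne s t with rfl | hst
  · rfl
  have hcoeff := congrArg (fun a : ringA K n m => a.1.coeff (u - Pi.single s 1 - Pi.single t 1))
    (hω s t)
  change (deriv s (ω t).1).coeff _ = (deriv t (ω s).1).coeff _ at hcoeff
  rw [coeff_deriv, coeff_deriv, sub_add_cancel, sub_right_comm, sub_add_cancel] at hcoeff
  simpa [logCoeff, Pi.single_apply, hst, hst.symm] using hcoeff

open Classical in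
/-- The coefficients of the primitive of the polar part of a closed form `ω`. They can be computed
by integrating with respect to any of the variables along which `T^u` has a pole. -/
noncomputable def primitiveCoeff (ω : Fin n ⊕ Fin m → ringA K n m) (u : Fin n ⊕ Fin m → ℤ) : K :=
  if h : ∃ i : Fin n, u (Sum.inl i) < 0 then
    logCoeff ω (Sum.inl h.choose) u / u (Sum.inl h.choose)
  else 0

theorem intCast_mul_primitiveCoeff [CharZero K]
    (hω : ∀ s t, derivA K n m s (ω t) = derivA K n m t (ω s)) {u : Fin n ⊕ Fin m → ℤ}
    (hu : ∃ i : Fin n, u (Sum.inl i) < 0) (s : Fin n ⊕ Fin m) :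
    (u s : K) * primitiveCoeff ω u = logCoeff ω s u := by
  have hne : (u (Sum.inl hu.choose) : K) ≠ 0 := Int.cast_ne_zero.2 hu.choose_spec.ne
  rw [primitiveCoeff, dif_pos hu, mul_div_assoc', intCast_mul_logCoeff_comm hω,
    mul_div_cancel_left₀ _ hne]

theorem poleOrder_le_sub_single (u : Fin n ⊕ Fin m → ℤ) (s : Fin n ⊕ Fin m) :
    poleOrder u ≤ poleOrder (u - Pi.single s 1) := by
  refine Finset.sum_le_sum fun i _ => Int.toNat_le_toNat (neg_le_neg (sub_le_self _ ?_))
  exact (Pi.single_nonneg.2 zero_le_one : 0 ≤ (Pi.single s 1 : Fin n ⊕ Fin m → ℤ)) _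

theorem norm_primitiveCoeff_le (hK : ∀ z : ℤ, ‖(z : K)⁻¹‖ ≤ z.natAbs)
    (ω : Fin n ⊕ Fin m → ringA K n m) (u : Fin n ⊕ Fin m → ℤ) :
    ‖primitiveCoeff ω u‖ ≤ ∑ s, ‖logCoeff ω s u‖ * poleOrder u := by
  unfold primitiveCoeff
  split_ifs with h
  · have hpole : (u (Sum.inl h.choose)).natAbs ≤ poleOrder u := by
      have := neg_le_poleOrder u h.choose
      have := h.choose_spec
      omega
    rw [div_eq_mul_inv, norm_mul]
    calc _ ≤ ‖logCoeff ω (Sum.inl h.choose) u‖ * poleOrder u := by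
          gcongr
          exact (hK _).trans (by exact_mod_cast hpole)
      _ ≤ ∑ s, ‖logCoeff ω s u‖ * poleOrder u :=
          Finset.single_le_sum (f := fun s => ‖logCoeff ω s u‖ * (poleOrder u : ℝ))
            (fun s _ => by positivity) (Finset.mem_univ _)
  · rw [norm_zero]
    positivity

theorem tendsto_primitiveCoeff_cofinite {ρ : ℝ} (hρ : 1 < ρ)
    (hK : ∀ z : ℤ, ‖(z : K)⁻¹‖ ≤ z.natAbs) (hω : ∀ s, ∃ C, DecayBound ρ C (ω s)) :
    Tendsto (primitiveCoeff ω) cofinite (𝓝 0) := by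
  have hlim : ∀ s, Tendsto (fun u => ‖logCoeff ω s u‖ * (poleOrder u : ℝ)) cofinite (𝓝 0) := by
    intro s
    obtain ⟨C, hC⟩ := hω s
    refine tendsto_mul_zero_of_mul_rpow_le (B := C) hρ (fun u => norm_nonneg _)
      (fun u => Nat.cast_nonneg _) (fun u => ?_) (tendsto_zero_iff_norm_tendsto_zero.1
        (tendsto_logCoeff_cofinite s))
    refine le_trans (mul_le_mul_of_nonneg_left ?_ (norm_nonneg _)) (hC (u - Pi.single s 1))
    refine Real.rpow_le_rpow (Nat.cast_nonneg _) ?_ (zero_le_one.trans hρ.le)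
    exact_mod_cast (poleOrder_le_sub_single u s).trans (Nat.le_add_left _ 1)
  refine squeeze_zero_norm (norm_primitiveCoeff_le hK ω) ?_
  simpa using tendsto_finsetSum Finset.univ fun s _ => hlim s

theorem primitiveCoeff_eq_zero {u : Fin n ⊕ Fin m → ℤ} (hu : ∃ j : Fin m, u (Sum.inr j) < 0) :
    primitiveCoeff ω u = 0 := by
  obtain ⟨j, hj⟩ := hu
  unfold primitiveCoeff
  split_ifs with h
  · rw [show logCoeff ω (Sum.inl h.choose) u = 0 from (ω _).2 _ ⟨j, by simpa using hj⟩, zero_div]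
  · rfl

theorem exists_derivA_logCoeff_eq [CharZero K] {ρ : ℝ} (hρ : 1 < ρ)
    (hK : ∀ z : ℤ, ‖(z : K)⁻¹‖ ≤ z.natAbs) (hdecay : ∀ s, ∃ C, DecayBound ρ C (ω s))
    (hω : ∀ s t, derivA K n m s (ω t) = derivA K n m t (ω s)) :
    ∃ f : ringA K n m, ∀ s u, (∃ i : Fin n, u (Sum.inl i) < 0) →
      logCoeff (fun t => derivA K n m t f) s u = logCoeff ω s u :=
  ⟨⟨⟨primitiveCoeff ω, tendsto_primitiveCoeff_cofinite hρ hK hdecay⟩,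
      fun _ => primitiveCoeff_eq_zero⟩,
    fun s _ hu => (logCoeff_derivA _ s _).trans (intCast_mul_primitiveCoeff hω hu s)⟩

theorem derivA_comm (s t : Fin n ⊕ Fin m) (f : ringA K n m) :
    derivA K n m s (derivA K n m t f) = derivA K n m t (derivA K n m s f) := by
  refine Subtype.ext (Laurent.ext fun u => ?_)
  change (deriv s (deriv t f.1)).coeff u = (deriv t (deriv s f.1)).coeff u
  rcases eq_or_ne s t with rfl | hst
  · rfl
  simp only [coeff_deriv, Pi.add_apply, Pi.single_eq_of_ne hst, Pi.single_eq_of_ne hst.symm,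
    add_zero, add_right_comm u (Pi.single t 1)]
  ring

theorem logCoeff_inl_eq_zero [CharZero K]
    (hω : ∀ s t, derivA K n m s (ω t) = derivA K n m t (ω s))
    (hpolar : ∀ s u, (∃ i : Fin n, u (Sum.inl i) < 0) → logCoeff ω s u = 0) {i k : Fin n}
    {u : Fin n ⊕ Fin m → ℤ} (hu : u ≠ 0)
    (huk : (u - Pi.single (Sum.inl i) 1 : Fin n ⊕ Fin m → ℤ) (Sum.inl k) < 0) :
    logCoeff ω (Sum.inl i) u = 0 := by
  by_cases hneg : u (Sum.inl k) < 0
  · exact hpolar _ _ ⟨k, hneg⟩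
  rcases eq_or_ne k i with rfl | hki
  · have hk : u (Sum.inl k) = 0 := by
      rw [Pi.sub_apply, Pi.single_eq_same] at huk
      omega
    obtain ⟨t, ht⟩ := Function.ne_iff.1 hu
    have hcomm := intCast_mul_logCoeff_comm hω t (Sum.inl k) u
    rw [hk, Int.cast_zero, zero_mul] at hcomm
    exact (mul_eq_zero.1 hcomm).resolve_left (Int.cast_ne_zero.2 ht)
  · rw [Pi.sub_apply, Pi.single_eq_of_ne (by simpa using hki), sub_zero] at huk
    exact absurd huk hneg

theorem exists_eq_smul_invT_add [CharZero K]
    (hω : ∀ s t, derivA K n m s (ω t) = derivA K n m t (ω s))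
    (hpolar : ∀ s u, (∃ i : Fin n, u (Sum.inl i) < 0) → logCoeff ω s u = 0) :
    ∃ (c : Fin n → K) (g : Fin n ⊕ Fin m → ringA K n m), (∀ s, g s ∈ ringTate K n m) ∧
      (∀ i, ω (Sum.inl i) = c i • invT K n m i + g (Sum.inl i)) ∧
      ∀ j, ω (Sum.inr j) = g (Sum.inr j) := by
  classical
  let c : Fin n → K := fun i => logCoeff ω (Sum.inl i) 0
  let g : Fin n ⊕ Fin m → ringA K n m :=
    Sum.elim (fun i => ω (Sum.inl i) - c i • invT K n m i) (fun j => ω (Sum.inr j))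
  refine ⟨c, g, fun s v hv => ?_, fun i => (add_sub_cancel _ _).symm, fun j => rfl⟩
  obtain ⟨k | j, hv⟩ := hv
  swap
  · exact (g s).2 v ⟨j, hv⟩
  rcases s with i | j
  · change (ω (Sum.inl i)).1.coeff v -
      c i * (monomial (Pi.single (Sum.inl i) (-1)) 1 : Laurent K (Fin n ⊕ Fin m)).coeff v = 0
    rw [coeff_eq_logCoeff, coeff_monomial]
    obtain ⟨u, rfl⟩ : ∃ u : Fin n ⊕ Fin m → ℤ, u - Pi.single (Sum.inl i) 1 = v :=
      ⟨_, add_sub_cancel_right v _⟩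
    rw [sub_add_cancel, Pi.single_neg]
    rcases eq_or_ne u 0 with rfl | hu
    · simp [c]
    · rw [logCoeff_inl_eq_zero hω hpolar hu hv, if_neg (mt sub_eq_neg_self.1 hu), mul_zero,
        sub_zero]
  · change (ω (Sum.inr j)).1.coeff v = 0
    rw [coeff_eq_logCoeff]
    exact hpolar _ _ ⟨k, by simpa using hv⟩

/-- Decay with an exponent `ρ > 1` absorbs the denominators which arise from integrating the polar
part of `ω`. -/
theorem exists_eq_derivA_add_smul_invT_add [CharZero K] {ρ : ℝ} (hρ : 1 < ρ)
    (hK : ∀ z : ℤ, ‖(z : K)⁻¹‖ ≤ z.natAbs) (hdecay : ∀ s, ∃ C, DecayBound ρ C (ω s))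
    (hω : ∀ s t, derivA K n m s (ω t) = derivA K n m t (ω s)) :
    ∃ (f : ringA K n m) (c : Fin n → K) (g : Fin n ⊕ Fin m → ringA K n m),
      (∀ s, g s ∈ ringTate K n m) ∧
      (∀ i, ω (Sum.inl i) = derivA K n m (Sum.inl i) f + (c i • invT K n m i + g (Sum.inl i))) ∧
      ∀ j, ω (Sum.inr j) = derivA K n m (Sum.inr j) f + g (Sum.inr j) := by
  obtain ⟨f, hf⟩ := exists_derivA_logCoeff_eq hρ hK hdecay hω
  obtain ⟨c, g, hg, hinl, hinr⟩ :=
    exists_eq_smul_invT_add (ω := fun s => ω s - derivA K n m s f)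
      (fun s t => by rw [map_sub, map_sub, hω s t, derivA_comm s t f])
      fun s u hu => sub_eq_zero.2 (hf s u hu).symm
  exact ⟨f, c, g, hg, fun i => by rw [← hinl i, add_sub_cancel],
    fun j => by rw [← hinr j, add_sub_cancel]⟩

end Primitive

end Polyannulus

/-! ### Connections on line bundles -/

section LineBundle

variable {R A M : Type*} [CommRing R] [CommRing A] [Algebra R A] [AddCommGroup M] [Module R M]

theorem exists_linearEquiv_baseChange_of_apply_eq_one (E : A ⊗[R] M ≃ₗ[A] A) {l : M →ₗ[R] A}
    {e : M} (he : l e = 1) : ∃ L : A ⊗[R] M ≃ₗ[A] A, ∀ x, L (1 ⊗ₜ x) = l x := by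
  have hsurj : Function.Surjective (LinearMap.liftBaseChange A l) := fun a =>
    ⟨a ⊗ₜ e, by rw [LinearMap.liftBaseChange_tmul, he, smul_eq_mul, mul_one]⟩
  have hinj := OrzechProperty.injective_of_surjective_of_injective E.toLinearMap _ E.injective hsurj
  have hbij : Function.Bijective (LinearMap.liftBaseChange A l) := ⟨hinj, hsurj⟩
  exact ⟨LinearEquiv.ofBijective _ hbij, fun x => by simp⟩

theorem eq_apply_smul_of_apply_eq_one {N : Type*} [AddCommGroup N] [Module A N] (L : N ≃ₗ[A] A)
    {w : N} (hw : L w = 1) (x : N) : x = L x • w :=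
  L.injective (by rw [map_smul, hw, smul_eq_mul, mul_one])

section TensorPower

variable (L : A ⊗[R] M ≃ₗ[A] A) {e : M} (he : L (1 ⊗ₜ e) = 1)

include he

theorem one_tmul_tprod_eq_smul_update {ι : Type*} [DecidableEq ι] (x : ι → M) (i : ι) :
    (1 : A) ⊗ₜ[R] PiTensorProduct.tprod R x =
      L (1 ⊗ₜ x i) • ((1 : A) ⊗ₜ[R] PiTensorProduct.tprod R (Function.update x i e)) := by
  have h := congrArg (((PiTensorProduct.tprod R).toLinearMap x i).baseChange A)
    (eq_apply_smul_of_apply_eq_one L he (1 ⊗ₜ x i))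
  simpa only [map_smul, LinearMap.baseChange_tmul, MultilinearMap.toLinearMap_apply,
    Function.update_eq_self] using h

open Classical in
theorem one_tmul_tprod_eq_prod_smul {ι : Type*} [Fintype ι] (x : ι → M) :
    (1 : A) ⊗ₜ[R] PiTensorProduct.tprod R x =
      (∏ i, L (1 ⊗ₜ x i)) • ((1 : A) ⊗ₜ[R] PiTensorProduct.tprod R fun _ => e) := by
  have hpartial (S : Finset ι) : (1 : A) ⊗ₜ[R] PiTensorProduct.tprod R x =
      (∏ i ∈ S, L (1 ⊗ₜ x i)) •
        ((1 : A) ⊗ₜ[R] PiTensorProduct.tprod R (S.piecewise (fun _ => e) x)) := by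
    induction S using Finset.induction_on with
    | empty => simp
    | insert i S hi ih =>
      rw [ih, one_tmul_tprod_eq_smul_update L he _ i, smul_smul, Finset.prod_insert hi,
        Finset.piecewise_eq_of_notMem _ _ _ hi, mul_comm, Finset.piecewise_insert]
  simpa only [Finset.piecewise_univ] using hpartial Finset.univ

theorem exists_linearEquiv_baseChange_tensorPower (q : ℕ) :
    ∃ L' : A ⊗[R] (⨂[R]^q M) ≃ₗ[A] A, L' (1 ⊗ₜ PiTensorProduct.tprod R fun _ => e) = 1 := by
  let l : M →ₗ[R] A := L.toLinearMap.restrictScalars R ∘ₗ TensorProduct.mk R A M 1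
  let lq : ⨂[R]^q M →ₗ[R] A :=
    PiTensorProduct.lift ((MultilinearMap.mkPiAlgebra R (Fin q) A).compLinearMap fun _ => l)
  have hlq (x : Fin q → M) : lq (PiTensorProduct.tprod R x) = ∏ i, L (1 ⊗ₜ x i) := by
    simp [lq, l]
  have hgen : (LinearMap.toSpanSingleton A _ ((1 : A) ⊗ₜ[R] PiTensorProduct.tprod R fun _ => e)) ∘ₗ
      LinearMap.liftBaseChange A lq = LinearMap.id := by
    ext x
    simp [hlq, ← one_tmul_tprod_eq_prod_smul L he x]
  refine ⟨LinearEquiv.ofLinearMap (LinearMap.liftBaseChange A lq) _ ?_ hgen, ?_⟩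
  · ext
    simp [hlq, he]
  · simp [hlq, he]

end TensorPower

end LineBundle

namespace Connection

variable {K R A ι M : Type*} [CommRing K] [CommRing R] [CommRing A] [Algebra R A] [Algebra K R]
  [Algebra K A] {partials : ι → Derivation K R R} {partials' : ι → Derivation K A A}
  [AddCommGroup M] [Module R M] (D : Connection partials M)
  (hd : ∀ s a, partials' s (algebraMap R A a) = algebraMap R A (partials s a))
  (L : A ⊗[R] M ≃ₗ[A] A) {e : M} (he : L (1 ⊗ₜ e) = 1)

include hd he

theorem coordinate_nabla (s : ι) (x : M) :
    L (1 ⊗ₜ D.nabla s x) = partials' s (L (1 ⊗ₜ x)) + L (1 ⊗ₜ x) * L (1 ⊗ₜ D.nabla s e) := by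
  have h := congrArg (fun w => L ((D.baseChange hd).nabla s w))
    (eq_apply_smul_of_apply_eq_one L he (1 ⊗ₜ x))
  simpa [(D.baseChange hd).leibniz, baseChange_tmul, he] using h

theorem Integrable.coordinate_closed {D : Connection partials M} (hD : D.Integrable) (s t : ι) :
    partials' s (L (1 ⊗ₜ D.nabla t e)) = partials' t (L (1 ⊗ₜ D.nabla s e)) := by
  have h := congrArg (fun x => L (1 ⊗ₜ x)) (hD s t e)
  beta_reduce at h
  rw [D.coordinate_nabla hd L he s, D.coordinate_nabla hd L he t (D.nabla s e)] at h
  linear_combination h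

theorem nabla_tensorPower_tprod_const (q : ℕ) (s : ι) :
    ((D.tensorPower q).baseChange hd).nabla s ((1 : A) ⊗ₜ[R] PiTensorProduct.tprod R fun _ => e) =
      (q * L (1 ⊗ₜ D.nabla s e)) •
        ((1 : A) ⊗ₜ[R] PiTensorProduct.tprod R fun _ : Fin q => e) := by
  have hterm (i : Fin q) :
      (1 : A) ⊗ₜ[R] PiTensorProduct.tprod R (Function.update (fun _ => e) i (D.nabla s e)) =
        L (1 ⊗ₜ D.nabla s e) • ((1 : A) ⊗ₜ[R] PiTensorProduct.tprod R fun _ => e) := by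
    rw [one_tmul_tprod_eq_smul_update L he _ i, Function.update_idem, Function.update_self,
      Function.update_eq_self]
  rw [baseChange_tmul, tensorPower_tprod, Derivation.map_one_eq_zero, TensorProduct.zero_tmul,
    zero_add, TensorProduct.tmul_sum]
  simp only [hterm, Finset.sum_const, Finset.card_univ, Fintype.card_fin]
  rw [mul_smul, Nat.cast_smul_eq_nsmul]

theorem exists_basis_tensorPower (q : ℕ) {v : A} (hv : IsUnit v) {η : ι → A}
    (hη : ∀ s, partials' s v = v * η s) :
    ∃ b : Module.Basis Unit A (A ⊗[R] ⨂[R]^q M), ∀ s,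
      ((D.tensorPower q).baseChange hd).nabla s (b ()) =
        (η s + q * L (1 ⊗ₜ D.nabla s e)) • b () := by
  obtain ⟨L', hL'⟩ := exists_linearEquiv_baseChange_tensorPower L he q
  obtain ⟨v, rfl⟩ := hv
  let b := (Module.Basis.singleton Unit A).map ((LinearEquiv.smulOfUnit v).trans L'.symm)
  have hb : b () = (v : A) • (1 ⊗ₜ PiTensorProduct.tprod R fun _ => e) := by
    simp [b, LinearEquiv.symm_apply_eq, hL', LinearEquiv.smulOfUnit, Units.smul_def]
  refine ⟨b, fun s => ?_⟩
  rw [hb, ((D.tensorPower q).baseChange hd).leibniz, D.nabla_tensorPower_tprod_const hd L he, hη]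
  module

end Connection

/-! ### Frames -/

namespace Polyannulus

open Laurent

section Density

variable {K : Type u} [NormedField K] [IsUltrametricDist K] [CompleteSpace K] {n m : ℕ}

variable (K n m) in
/-- The unit `(T_1 ⋯ T_n)^N` of `𝒜`, used to clear and restore finite poles. -/
noncomputable def logVarPow (N : ℤ) : ringA K n m :=
  ⟨monomial (Sum.elim (fun _ => N) 0) 1, by
    rintro u ⟨j, hj⟩
    rw [coeff_monomial, if_neg]
    rintro rfl
    simp at hj⟩

theorem logVarPow_neg_mul_logVarPow (N : ℤ) : logVarPow K n m (-N) * logVarPow K n m N = 1 :=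
  Subtype.ext <| by
    change monomial (Sum.elim (fun _ => -N) 0) 1 * monomial (Sum.elim (fun _ => N) 0) 1 = 1
    have hexp : (Sum.elim (fun _ => -N) 0 + Sum.elim (fun _ => N) 0 : Fin n ⊕ Fin m → ℤ) = 0 := by
      funext s
      cases s <;> simp
    rw [monomial_mul_monomial, hexp, one_mul]
    rfl

theorem coeff_logVarPow_mul (N : ℤ) (a : ringA K n m) (u : Fin n ⊕ Fin m → ℤ) :
    (logVarPow K n m N * a).1.coeff u = a.1.coeff (u - Sum.elim (fun _ => N) 0) :=
  (coeff_monomial_mul _ _ _ _).trans (one_mul _)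

theorem exists_decayBound_logVarPow (ρ : ℝ) (N : ℤ) : ∃ C, DecayBound ρ C (logVarPow K n m N) := by
  classical
  refine ⟨poleWeight ρ (Sum.elim (fun _ : Fin n => N) (0 : Fin m → ℤ)), fun u => ?_⟩
  change ‖(monomial _ _).coeff u‖ * _ ≤ _
  rw [coeff_monomial]
  split_ifs with h
  · simp [h]
  · simpa using (poleWeight_pos ρ _).le

open Classical in
/-- The sum of the terms of `a` with poles of order at most `N` along each `T_i = 0`. -/
noncomputable def polarTruncation (N : ℕ) (a : ringA K n m) : ringA K n m :=
  ⟨⟨fun u => if ∀ i : Fin n, -(N : ℤ) ≤ u (Sum.inl i) then a.1.coeff u else 0, by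
    refine squeeze_zero_norm (fun u => ?_) (tendsto_zero_iff_norm_tendsto_zero.1 a.1.coeff_null)
    split_ifs <;> simp⟩, fun u hu => ite_eq_right_iff.2 fun _ => a.2 u hu⟩

open Classical in
theorem coeff_polarTruncation (N : ℕ) (a : ringA K n m) (u : Fin n ⊕ Fin m → ℤ) :
    (polarTruncation N a).1.coeff u =
      if ∀ i : Fin n, -(N : ℤ) ≤ u (Sum.inl i) then a.1.coeff u else 0 := rfl

theorem logVarPow_mul_polarTruncation_mem_ringTate (N : ℕ) (a : ringA K n m) :
    logVarPow K n m N * polarTruncation N a ∈ ringTate K n m := by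
  rintro u ⟨s, hs⟩
  rw [coeff_logVarPow_mul]
  cases s with
  | inl i =>
    refine if_neg fun h => ?_
    have hi := h i
    simp only [Pi.sub_apply, Sum.elim_inl] at hi
    omega
  | inr j => exact (polarTruncation N a).2 _ ⟨j, by simpa using hs⟩

theorem tendsto_polarTruncation (a : ringA K n m) :
    Tendsto (fun N => polarTruncation N a) atTop (𝓝 a) := by
  refine Metric.tendsto_atTop.2 fun ε hε => ?_
  obtain ⟨N₀, hN₀⟩ := ((a.1.finite_setOf_le_norm_coeff hε).image poleOrder).bddAbove
  refine ⟨N₀, fun N hN => ?_⟩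
  rw [dist_eq_norm]
  refine norm_lt_iff.2 fun u => ?_
  change ‖(polarTruncation N a).1.coeff u - a.1.coeff u‖ < ε
  rw [coeff_polarTruncation]
  split_ifs with h
  · simpa using hε
  · rw [zero_sub, norm_neg]
    contrapose! h
    intro i
    have hu : poleOrder u ≤ N₀ := hN₀ ⟨u, h, rfl⟩
    have := neg_le_poleOrder u i
    omega

theorem ringTate_le_ringAr (p : ℕ) [Fact p.Prime] (r : ℝ) : ringTate K n m ≤ ringAr K n m p r := by
  intro a ha
  have hp0 : (0 : ℝ) < p := by exact_mod_cast (Fact.out : p.Prime).pos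
  refine ⟨1, one_pos, 0, fun j _ i u hu => ?_⟩
  have hu0 : 0 ≤ u (Sum.inl i) := by
    by_contra! h
    rw [ha u ⟨_, h⟩, norm_zero] at hu
    exact hu.not_gt (by positivity)
  calc -1 * (p : ℝ) ^ (r * j) ≤ 0 := by
        rw [neg_one_mul, neg_nonpos]
        positivity
    _ ≤ u (Sum.inl i) := by exact_mod_cast hu0

end Density

end Polyannulus

section DualBasis

variable {R A M : Type*} [CommRing R] [CommRing A] [Algebra R A] [AddCommGroup M] [Module R M]

theorem exists_algebraMap_dual_apply_eq_sum {ι : Type*} [Fintype ι] (g : ι → M)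
    (s : ι → Module.Dual R M) (b d : ι → R) : ∃ (e : M) (ψ : Module.Dual R M),
      algebraMap R A (ψ e) =
        ∑ l, ∑ j, algebraMap R A (b l) * algebraMap R A (d j) * algebraMap R A (s j (g l)) := by
  refine ⟨∑ l, b l • g l, ∑ j, d j • s j, ?_⟩
  simp only [map_sum, map_smul, LinearMap.sum_apply, LinearMap.smul_apply, smul_eq_mul, map_mul,
    Finset.mul_sum, mul_assoc]

variable [Module.Finite R M] [Module.Projective R M]

variable (R M) in
theorem exists_fin_dual_basis : ∃ (a : ℕ) (g : Fin a → M) (s : Fin a → Module.Dual R M),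
    ∀ x, ∑ j, s j x • g j = x := by
  obtain ⟨a, f, hf⟩ := Module.Finite.exists_fin' R M
  obtain ⟨s, hs⟩ := Module.projective_lifting_property f LinearMap.id hf
  refine ⟨a, fun j => f (Pi.single j 1), fun j => LinearMap.proj j ∘ₗ s, fun x => ?_⟩
  conv_rhs => rw [← LinearMap.id_apply (R := R) x, ← hs, LinearMap.comp_apply,
    pi_eq_sum_univ' (s x), map_sum]
  simp

/-- The pairing of `A ⊗ M` with `A ⊗ M^∨` is perfect, so a generator of a line bundle pairs to `1`
with a generator of its dual; both are expanded in a dual basis of `M`. -/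
theorem exists_sum_sum_mul_dual_apply_eq_one (L : A ⊗[R] M ≃ₗ[A] A) :
    ∃ (a : ℕ) (g : Fin a → M) (s : Fin a → Module.Dual R M) (α β : Fin a → A),
      ∑ l, ∑ j, α l * β j * algebraMap R A (s j (g l)) = 1 := by
  obtain ⟨a, g, s, hgs⟩ := exists_fin_dual_basis R M
  let w : A ⊗[R] M := L.symm 1
  let α (j : Fin a) : A := LinearMap.liftBaseChange A (Algebra.linearMap R A ∘ₗ s j) w
  have hexpand (y : A ⊗[R] M) :
      ∑ j, LinearMap.liftBaseChange A (Algebra.linearMap R A ∘ₗ s j) y • (1 : A) ⊗ₜ[R] g j = y := by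
    induction y using TensorProduct.induction_on with
    | zero => simp
    | tmul b x =>
      conv_rhs => rw [← hgs x, TensorProduct.tmul_sum]
      refine Finset.sum_congr rfl fun j _ => ?_
      simp [TensorProduct.smul_tmul', mul_comm b, ← Algebra.smul_def]
    | add y z hy hz =>
      simp only [map_add, add_smul, Finset.sum_add_distrib, hy, hz]
  have hβ (l : Fin a) : ∑ j, L (1 ⊗ₜ g j) * algebraMap R A (s j (g l)) = L (1 ⊗ₜ g l) := by
    conv_rhs => rw [← hexpand (1 ⊗ₜ g l)]
    simp only [LinearMap.liftBaseChange_tmul, LinearMap.comp_apply, Algebra.linearMap_apply,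
      one_mul, map_sum, map_smul, smul_eq_mul, mul_comm]
  refine ⟨a, g, s, α, fun j => L (1 ⊗ₜ g j), ?_⟩
  simp only [mul_assoc, ← Finset.mul_sum, hβ]
  have hw := congrArg L (hexpand w)
  simpa [α, w] using hw

end DualBasis

namespace Polyannulus

variable {K : Type u} [NormedField K] [IsUltrametricDist K] [CompleteSpace K] {n m p : ℕ}
  [Fact p.Prime] {r : ℝ} {M : Type*} [AddCommGroup M] [Module (ringAr K n m p r) M]
  [Module.Finite (ringAr K n m p r) M] [Module.Projective (ringAr K n m p r) M]

theorem exists_norm_one_sub_logVarPow_mul_lt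
    (L : ringA K n m ⊗[ringAr K n m p r] M ≃ₗ[ringA K n m] ringA K n m) {ε : ℝ} (hε : 0 < ε) :
    ∃ (N : ℤ) (e : M) (ψ : Module.Dual (ringAr K n m p r) M),
      ‖1 - logVarPow K n m N * logVarPow K n m N * (ψ e : ringA K n m)‖ < ε := by
  obtain ⟨a, g, s, α, β, hαβ⟩ := exists_sum_sum_mul_dual_apply_eq_one L
  have hlim : Tendsto (fun N => ∑ l, ∑ j, polarTruncation N (α l) * polarTruncation N (β j) *
      algebraMap _ (ringA K n m) (s j (g l))) atTop (𝓝 1) := by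
    rw [← hαβ]
    exact tendsto_finsetSum _ fun l _ => tendsto_finsetSum _ fun j _ =>
      ((tendsto_polarTruncation (α l)).mul (tendsto_polarTruncation (β j))).mul_const _
  obtain ⟨N, hN⟩ := (Metric.tendsto_nhds.1 hlim ε hε).exists
  let clear (a : ringA K n m) : ringAr K n m p r := ⟨logVarPow K n m N * polarTruncation N a,
    ringTate_le_ringAr p r (logVarPow_mul_polarTruncation_mem_ringTate N a)⟩
  obtain ⟨e, ψ, heψ⟩ := exists_algebraMap_dual_apply_eq_sum (A := ringA K n m) g s
    (fun l => clear (α l)) fun j => clear (β j)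
  refine ⟨-N, e, ψ, ?_⟩
  have hclear : logVarPow K n m (-N) * logVarPow K n m (-N) * (ψ e : ringA K n m) =
      ∑ l, ∑ j, polarTruncation N (α l) * polarTruncation N (β j) *
        algebraMap _ (ringA K n m) (s j (g l)) := by
    refine (congrArg (_ * ·) heψ).trans ?_
    simp only [Finset.mul_sum]
    refine Finset.sum_congr rfl fun l _ => Finset.sum_congr rfl fun j _ => ?_
    have hunit := logVarPow_neg_mul_logVarPow (K := K) (n := n) (m := m) N
    change _ * _ * (logVarPow K n m N * polarTruncation N (α l) *
      (logVarPow K n m N * polarTruncation N (β j)) * _) = _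
    linear_combination (logVarPow K n m (-N) * logVarPow K n m N + 1) *
      (polarTruncation N (α l) * polarTruncation N (β j) * algebraMap _ _ (s j (g l))) * hunit
  rw [hclear, ← dist_eq_norm, dist_comm]
  exact hN

theorem exists_mul_eq_one_and_decayBound {ρ : ℝ} (hρ : 0 ≤ ρ) (hr : r * ρ ≤ 1)
    (L : ringA K n m ⊗[ringAr K n m p r] M ≃ₗ[ringA K n m] ringA K n m) :
    ∃ (e : M) (ψ : Module.Dual (ringAr K n m p r) M) (z : ringA K n m) (C : ℝ),
      (ψ e : ringA K n m) * z = 1 ∧ DecayBound ρ C z := by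
  have h2ρ : (0 : ℝ) < 2 ^ ρ := by positivity
  obtain ⟨N, e, ψ, hy⟩ := exists_norm_one_sub_logVarPow_mul_lt L
    (ε := min 1 (2 ^ ρ)⁻¹) (by positivity)
  obtain ⟨hy1, hy2⟩ := lt_min_iff.1 hy
  obtain ⟨C, hC⟩ := exists_decayBound_logVarPow (K := K) (n := n) (m := m) ρ N
  obtain ⟨C', hC'⟩ := exists_decayBound_of_mem_ringAr hρ hr (ψ e).2
  have hCC := DecayBound.mul hρ hC hC
  have hdecay := (DecayBound.one ρ).add (DecayBound.mul hρ hCC hC').neg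
  rw [← sub_eq_add_neg] at hdecay
  obtain ⟨z, hz, hzC⟩ := exists_one_sub_mul_eq_one_and_decayBound hρ hdecay
    ((le_inv_mul_iff₀ h2ρ).1 (by simpa using hy2.le)) hy1
  refine ⟨e, ψ, _, _, ?_, DecayBound.mul hρ hCC hzC⟩
  linear_combination hz

end Polyannulus

/-! ### Regular singularities -/

theorem exists_one_lt_and_mul_le_one {r : ℝ} (hr : r < 1) : ∃ ρ : ℝ, 1 < ρ ∧ r * ρ ≤ 1 := by
  rcases le_or_gt r 0 with h | h
  · exact ⟨2, by norm_num, by linarith⟩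
  · exact ⟨r⁻¹, (one_lt_inv₀ h).2 hr, (mul_inv_cancel₀ h.ne').le⟩

theorem exists_mul_norm_pow_mul_lt_one {A : Type*} [NormedRing A] {x : A} (hx : ‖x‖ < 1) (f : A)
    (C : ℝ) : ∃ N : ℕ, C * ‖x ^ N * f‖ < 1 := by
  have h : Tendsto (fun N : ℕ => C * ‖x ^ N * f‖) atTop (𝓝 (C * ‖0 * f‖)) :=
    ((tendsto_pow_atTop_nhds_zero_of_norm_lt_one hx).mul_const f).norm.const_mul C
  exact (h.eventually_lt_const (by simp)).exists

namespace Polyannulus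

theorem continuous_derivA {K : Type*} [NormedField K] [IsUltrametricDist K]
    [CompleteSpace K] {n m : ℕ} (s : Fin n ⊕ Fin m) : Continuous (derivA K n m s) :=
  AddMonoidHomClass.continuous_of_bound (derivA K n m s) 1 fun x => by
    rw [one_mul]
    exact Laurent.norm_deriv_le s x.1

section RankOne

variable {K : Type u} [NormedField K] [IsUltrametricDist K] [CompleteSpace K] {n m p : ℕ}
  [Fact p.Prime] {r : ℝ} {M : Type*} [AddCommGroup M] [Module (ringAr K n m p r) M]

theorem exists_linearEquiv_baseChange_decayBound [Module.Finite (ringAr K n m p r) M]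
    [Module.Projective (ringAr K n m p r) M] {ϖ : K} (hϖ : IsNormUniformizer ϖ)
    (hrank : ∀ P : PrimeSpectrum (ringAr K n m p r), Module.rankAtStalk M P = 1)
    {ρ : ℝ} (hρ : 0 ≤ ρ) (hr : r * ρ ≤ 1) :
    ∃ (L : ringA K n m ⊗[ringAr K n m p r] M ≃ₗ[ringA K n m] ringA K n m) (e : M),
      L (1 ⊗ₜ e) = 1 ∧ ∀ x : M, ∃ C, DecayBound ρ C (L (1 ⊗ₜ x)) := by
  have hflat : Module.Flat (ringAr K n m p r) M := Module.Flat.of_projective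
  obtain ⟨E⟩ := nonempty_linearEquiv_of_rankAtStalk_eq_one hϖ
    (ringA K n m ⊗[ringAr K n m p r] M) fun P => by rw [Module.rankAtStalk_baseChange, hrank]
  obtain ⟨e, ψ, z, C, hψz, hz⟩ := exists_mul_eq_one_and_decayBound hρ hr E
  let l : M →ₗ[ringAr K n m p r] ringA K n m :=
    LinearMap.toSpanSingleton (ringAr K n m p r) (ringA K n m) z ∘ₗ ψ
  obtain ⟨L, hL⟩ := exists_linearEquiv_baseChange_of_apply_eq_one E (l := l) hψz
  refine ⟨L, e, (hL e).trans hψz, fun x => ?_⟩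
  obtain ⟨C', hψx⟩ := exists_decayBound_of_mem_ringAr hρ hr (ψ x).2
  rw [hL]
  exact ⟨_, DecayBound.mul hρ hψx hz⟩

/-- The basis is `exp(-p ^ N f)` times the `p ^ N`-th tensor power of `e`: multiplying by the
exponential removes the exact part `p ^ N df` of the connection form, and a large `N` makes the
exponential converge. -/
theorem exists_hasRegularSingularities_tensorPower_prime_pow (hp : ‖(p : K)‖ = (p : ℝ)⁻¹)
    (D : Connection (derivAr K n m p r) M)
    (L : ringA K n m ⊗[ringAr K n m p r] M ≃ₗ[ringA K n m] ringA K n m) {e : M}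
    (he : L (1 ⊗ₜ e) = 1) {f : ringA K n m} {c : Fin n → K} {g : Fin n ⊕ Fin m → ringA K n m}
    (hg : ∀ s, g s ∈ ringTate K n m)
    (hinl : ∀ i, L (1 ⊗ₜ D.nabla (Sum.inl i) e) =
      derivA K n m (Sum.inl i) f + (c i • invT K n m i + g (Sum.inl i)))
    (hinr : ∀ j, L (1 ⊗ₜ D.nabla (Sum.inr j) e) = derivA K n m (Sum.inr j) f + g (Sum.inr j)) :
    ∃ N : ℕ, HasRegularSingularities (D.tensorPower (p ^ N)) := by
  have hcharZero : CharZero K := charZero_of_norm_natCast_prime_eq hp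
  have hp1 : ‖(p : ringA K n m)‖ < 1 := by
    rw [← map_natCast (algebraMap K (ringA K n m)), norm_algebraMap', hp]
    exact inv_lt_one_of_one_lt₀ (mod_cast (Fact.out : p.Prime).one_lt)
  obtain ⟨N, hN⟩ := exists_mul_norm_pow_mul_lt_one hp1 f p
  rw [← norm_neg] at hN
  have hp0 : (0 : ℝ) ≤ p := p.cast_nonneg
  have hderiv (s : Fin n ⊕ Fin m) :
      derivA K n m s (-((p : ringA K n m) ^ N * f)) = -(p ^ N * derivA K n m s f) := by
    rw [map_neg, Derivation.leibniz, ← Nat.cast_pow, Derivation.map_natCast, smul_zero, add_zero,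
      smul_eq_mul]
  obtain ⟨b, hb⟩ := D.exists_basis_tensorPower (fun _ _ => rfl) L he (p ^ N)
    (isUnit_expSeriesSum hp0 (norm_inv_factorial_le hp) hN) fun s =>
      (derivation_expSeriesSum hp0 (norm_inv_factorial_le hp) hN _ (continuous_derivA s)).trans
        (congrArg _ (hderiv s))
  refine ⟨N, b, fun i => p ^ N * c i, fun s => p ^ N * g s,
    fun s => mul_mem (pow_mem (natCast_mem _ _) _) (hg s), fun i => ?_, fun j => ?_⟩
  · refine (hb (Sum.inl i)).trans (congrArg (· • b ()) ?_)
    rw [hinl, mul_smul, ← Nat.cast_pow (α := K), Nat.cast_smul_eq_nsmul, nsmul_eq_mul]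
    push_cast
    ring
  · refine (hb (Sum.inr j)).trans (congrArg (· • b ()) ?_)
    rw [hinr]
    push_cast
    ring

end RankOne

end Polyannulus

theorem WittField.isNormUniformizer_natCast_prime (p : ℕ) [Fact p.Prime] (k : Type*) [Field k]
    [CharP k p] [PerfectRing k p] : IsNormUniformizer (p : WittField p k) where
  isUnit := isUnit_iff_ne_zero.2 <| norm_ne_zero_iff.1 <| by
    rw [norm_p]
    exact inv_ne_zero (mod_cast (Fact.out : p.Prime).ne_zero)
  norm_lt_one := by
    rw [norm_p]
    exact inv_lt_one_of_one_lt₀ (mod_cast (Fact.out : p.Prime).one_lt)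
  norm_mul := norm_mul _
  norm_le {x} hx := by
    obtain ⟨a, rfl⟩ := exists_of_norm_le_one p k x hx.le
    have ha : ¬ IsUnit a := by
      rintro ⟨b, rfl⟩
      have hinv : ‖algebraMap (WittVector p k) (WittField p k) ↑b⁻¹‖ ≤ 1 := by
        simpa using (norm_algebraMap_le_iff p k (↑b⁻¹) 0).2 (by simp)
      have hone : ‖algebraMap (WittVector p k) (WittField p k) b‖ *
          ‖algebraMap (WittVector p k) (WittField p k) ↑b⁻¹‖ = 1 := by
        rw [← norm_mul, ← map_mul, Units.mul_inv, map_one, norm_one]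
      nlinarith [norm_nonneg (algebraMap (WittVector p k) (WittField p k) b)]
    have hmem : a ∈ (primeP p k).asIdeal ^ 1 := by
      rwa [pow_one, IsLocalRing.eq_maximalIdeal (primeP p k).isMaximal,
        IsLocalRing.mem_maximalIdeal]
    have hnorm := (norm_algebraMap_le_iff p k a 1).2 hmem
    rw [norm_p]
    simpa using hnorm

theorem mainTheorem5_general {K : Type u} [NormedField K] [IsUltrametricDist K] [CompleteSpace K]
    (p : ℕ) [Fact p.Prime] (hp : ‖(p : K)‖ = (p : ℝ)⁻¹) {ϖ : K} (hϖ : IsNormUniformizer ϖ)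
    (n m : ℕ) (r : ℝ) (hr : r < 1)
    (M : Type*) [AddCommGroup M] [Module (Polyannulus.ringAr K n m p r) M]
    [Module.Finite (Polyannulus.ringAr K n m p r) M]
    [Module.Projective (Polyannulus.ringAr K n m p r) M]
    (hrank : ∀ P : PrimeSpectrum (Polyannulus.ringAr K n m p r), Module.rankAtStalk M P = 1)
    (D : Connection (Polyannulus.derivAr K n m p r) M) (hD : D.Integrable) :
    ∃ N : ℕ, Polyannulus.HasRegularSingularities (D.tensorPower (p ^ N)) := by
  have hcharZero : CharZero K := charZero_of_norm_natCast_prime_eq hp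
  obtain ⟨ρ, hρ, hrρ⟩ := exists_one_lt_and_mul_le_one hr
  obtain ⟨L, e, he, hdecay⟩ := Polyannulus.exists_linearEquiv_baseChange_decayBound hϖ hrank
    (zero_le_one.trans hρ.le) hrρ
  obtain ⟨f, c, g, hg, hinl, hinr⟩ := Polyannulus.exists_eq_derivA_add_smul_invT_add hρ
    (norm_inv_intCast_le hp) (fun s => hdecay (D.nabla s e))
    (Connection.Integrable.coordinate_closed (fun _ _ => rfl) L he hD)
  exact Polyannulus.exists_hasRegularSingularities_tensorPower_prime_pow hp D L he hg hinl hinr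

theorem mainTheorem5 (p : ℕ) [Fact p.Prime] (k : Type*) [Field k] [CharP k p] [PerfectRing k p]
    (n m : ℕ) (r : ℝ) (hr : r < 1)
    (M : Type*) [AddCommGroup M] [Module (Polyannulus.ringAr (WittField p k) n m p r) M]
    [Module.Finite (Polyannulus.ringAr (WittField p k) n m p r) M]
    [Module.Projective (Polyannulus.ringAr (WittField p k) n m p r) M]
    (hrank : ∀ P : PrimeSpectrum (Polyannulus.ringAr (WittField p k) n m p r),
      Module.rankAtStalk M P = 1)
    (D : Connection (Polyannulus.derivAr (WittField p k) n m p r) M) (hD : D.Integrable) :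
    ∃ N : ℕ, Polyannulus.HasRegularSingularities (D.tensorPower (p ^ N)) :=
  mainTheorem5_general p (WittField.norm_p p k) (WittField.isNormUniformizer_natCast_prime p k)
    n m r hr M hrank D hD
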